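/- Let $R$ be a commutative ring; all categories are small (in a fixed universe containing $R$). **Conventions.** A non unital $A_\infty$-category $\mathscr A$ is a graded $R$-linear quiver with multilinear operations $m^n$, $n\ge 1$, of degree $2-n$ such that $$\sum_{m=1}^{n}\sum_{d=0}^{n-m}(-1)^{\dagger_d}\,m^{n-m+1}\big(f_n,\dots,f_{d+m+1},m^m(f_{d+m},\dots,f_{d+1}),f_d,\dots,f_1\big)=0,\qquad \dagger_d=\deg f_1+\dots+\deg f_d-d .$$ It is strictly unital if every object $x$ has a closed degree $0$ morphism $1_x$ with $m^2(f,1_x)=f$ and $m^2(1_y,f)=(-1)^{\deg f}f$ for all homogeneous $f:x\to y$, and $m^n(\dots,1_x,\dots)=0$ for $n\ge 3$. A strict $A_\infty$-functor $\mathsf F$ is given by a map on objects and degree $0$ linear maps on hom-spaces commuting with all $m^n$; it is strictly unital if $\mathsf F(1_x)=1_{\mathsf F(x)}$. Strictly unital $A_\infty$-categories and strict strictly unital $A_\infty$-functors form the category $\mathrm{A_\infty Cat_{strict}}$. Such a functor is a quasi-equivalence if it is a quasi-isomorphism on all hom-complexes $(\mathrm{Hom}(x,y),m^1)$ and $H^0(\mathsf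 F)$ is essentially surjective. For a DG quiver $\mathcal Q$ (a graded quiver with a differential on each hom-space), $\mathfrak F(\mathcal Q)$ denotes the free non unital $A_\infty$-category on $\mathcal Q$; write $|\mathscr A|$ for the DG quiver $(\mathscr A,m^1)$. A strictly unital $A_\infty$-category $\mathscr A$ is *semi-free* if it is the union of an increasing sequence $$|\mathscr A_0|\subset\mathcal Q_1\subset|\mathscr A_1|\subset\mathcal Q_2\subset|\mathscr A_2|\subset\dots\subset|\mathscr A|$$ of strictly unital $A_\infty$-subcategories $\mathscr A_n$ and DG subquivers $\mathcal Q_n$, all with the objects of $\mathscr A$, such that 1. $\mathscr A_0$ is the discrete category: its hom-spaces are spanned by the units $1_x$, and $R\to R\cdot 1_x$ is bijective for every $x$; 2. for $n\ge1$, $\mathcal Q_n=|\mathscr A_{n-1}|\oplus\mathscr B_n$ as graded quivers, for some graded quiver $\mathscr B_n$; 3. for $n\ge 1$, evaluation induces an isomorphism from $\mathfrak F(\mathcal Q_n)/I_n$ to $\mathscr A_n$, where $I_n$ is the $A_\infty$-ideal generated by the differences between $m^k_{\mathfrak F(\mathcal Q_n)}(f_k,\dots,f_1)$ and the generator $m^k_{\mathscr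 A_{n-1}}(f_k,\dots,f_1)$, for $f_1,\dots,f_k$ in $\mathscr A_{n-1}$, and by the relations saying that the units $1_x$ of $\mathscr A_{n-1}$ are strict units; 4. for $n\ge1$, the quotient DG quiver $\mathcal Q_n/|\mathscr A_{n-1}|$ has zero differential and its hom-spaces are free graded $R$-modules. **Theorem.** Every strictly unital $A_\infty$-category $\mathscr A$ has a semi-free resolution: there are a semi-free strictly unital $A_\infty$-category $\mathscr A^{\mathrm{sf}}$ and a strict, strictly unital quasi-equivalence $\Psi_{\mathscr A}:\mathscr A^{\mathrm{sf}}\to\mathscr A$ that is surjective on morphisms. Moreover the resolution can be chosen functorially: there are a functor $(-)^{\mathrm{sf}}:\mathrm{A_\infty Cat_{strict}}\to\mathrm{A_\infty Cat_{strict}}$ and a natural transformation $\Psi:(-)^{\mathrm{sf}}\Rightarrow\mathrm{Id}$ all of whose components $\Psi_{\mathscr A}$ are as above. -/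

import Mathlib

open CategoryTheory

universe u

/-! ### Composable chains -/

/-- Composable chains of homogeneous morphisms of a graded quiver with hom-spaces `H x y k`
(`k` is the degree).  The chain `x₀ → x₁ → ⋯ → xₙ` with arrows `f₁, …, fₙ` is written
`cons f₁ (cons f₂ (⋯ nil))`; it stands for the argument list `(fₙ, …, f₁)` of an operation. -/
inductive Chain {O : Type u} (H : O → O → ℤ → Type u) : O → O → Type u
  | nil (x : O) : Chain H x x
  | cons {x y z : O} {k : ℤ} (f : H x y k) (p : Chain H y z) : Chain H x z

namespace Chain

variable {O O' O'' : Type u} {H : O → O → ℤ → Type u} {H' : O' → O' → ℤ → Type u}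
  {H'' : O'' → O'' → ℤ → Type u}

/-- The number of morphisms. -/
def length : ∀ {x y : O}, Chain H x y → ℤ
  | _, _, nil _ => 0
  | _, _, cons _ p => p.length + 1

/-- The sum of the degrees of the morphisms. -/
def deg : ∀ {x y : O}, Chain H x y → ℤ
  | _, _, nil _ => 0
  | _, _, cons (k := k) _ p => k + p.deg

/-- Concatenation. -/
def append : ∀ {x y z : O}, Chain H x y → Chain H y z → Chain H x z
  | _, _, _, nil _, q => q
  | _, _, _, cons f p, q => cons f (p.append q)

/-- The chain with one morphism. -/
def single {x y : O} {k : ℤ} (f : H x y k) : Chain H x y := cons f (nil y)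

/-- Apply a map of graded quivers to every morphism of a chain. -/
def map (F : O → O') (φ : ∀ {x y : O} {k : ℤ}, H x y k → H' (F x) (F y) k) :
    ∀ {x y : O}, Chain H x y → Chain H' (F x) (F y)
  | _, _, nil x => nil (F x)
  | _, _, cons f p => cons (φ f) (p.map F φ)

/-- All `length + 1` ways to cut a chain into a first and a last part. -/
def splits : ∀ {x y : O}, Chain H x y → List (Σ z : O, Chain H x z × Chain H z y)
  | _, _, nil x => [⟨x, nil x, nil x⟩]
  | x, _, cons f p => ⟨x, nil x, cons f p⟩ :: p.splits.map fun s => ⟨s.1, cons f s.2.1, s.2.2⟩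

theorem length_map (F : O → O') (φ : ∀ {x y : O} {k : ℤ}, H x y k → H' (F x) (F y) k)
    {x y : O} (p : Chain H x y) : (p.map F φ).length = p.length := by
  induction p with
  | nil => rfl
  | cons f p ih => simp only [map, length, ih]

theorem deg_map (F : O → O') (φ : ∀ {x y : O} {k : ℤ}, H x y k → H' (F x) (F y) k)
    {x y : O} (p : Chain H x y) : (p.map F φ).deg = p.deg := by
  induction p with
  | nil => rfl
  | cons f p ih => simp only [map, deg, ih]

theorem map_append (F : O → O') (φ : ∀ {x y : O} {k : ℤ}, H x y k → H' (F x) (F y) k)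
    {x y z : O} (p : Chain H x y) (q : Chain H y z) :
    (p.append q).map F φ = (p.map F φ).append (q.map F φ) := by
  induction p with
  | nil => rfl
  | cons f p ih => simp only [map, append, ih]

theorem map_map (F : O → O') (φ : ∀ {x y : O} {k : ℤ}, H x y k → H' (F x) (F y) k)
    (G : O' → O'') (ψ : ∀ {x y : O'} {k : ℤ}, H' x y k → H'' (G x) (G y) k)
    {x y : O} (p : Chain H x y) :
    (p.map F φ).map G ψ = p.map (fun x => G (F x)) (fun f => ψ (φ f)) := by
  induction p with
  | nil => rfl
  | cons f p ih => simp only [map, ih]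

theorem map_id {x y : O} (p : Chain H x y) : p.map (fun x => x) (fun f => f) = p := by
  induction p with
  | nil => rfl
  | cons f p ih => simp only [map, ih]

theorem splits_map (F : O → O') (φ : ∀ {x y : O} {k : ℤ}, H x y k → H' (F x) (F y) k)
    {x y : O} (p : Chain H x y) :
    (p.map F φ).splits = p.splits.map fun s => ⟨F s.1, s.2.1.map F φ, s.2.2.map F φ⟩ := by
  induction p with
  | nil => rfl
  | cons f p ih => simp [map, splits, ih, List.map_map, Function.comp_def]

end Chain

/-! ### A∞-categories -/

section AInfSum

variable {R : Type u} [CommRing R] {O O' : Type u} {H : O → O → ℤ → Type u}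
  {H' : O' → O' → ℤ → Type u}

/-- The left-hand side of the A∞-equation for the arguments `p = (fₙ, …, f₁)`, in degree `k`:
the sum over all decompositions of `p` into three consecutive parts `a = (f_d, …, f₁)`,
`b = (f_{d+m}, …, f_{d+1})`, `c = (fₙ, …, f_{d+m+1})` of
`(-1)^(deg f₁ + ⋯ + deg f_d - d) • m (c, m b, a)`.
(The summands with empty `b` vanish, since `m` is linear and `m` of an empty chain is `0`.) -/
def ainfSum [∀ x y k, Zero (H x y k)] [∀ x y k, Add (H x y k)] [∀ x y k, SMul R (H x y k)]
    (m : ∀ {x y : O}, Chain H x y → ∀ k : ℤ, H x y k) {x y : O} (p : Chain H x y) (k : ℤ) :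
    H x y k :=
  (p.splits.map fun s => (s.2.2.splits.map fun t =>
    (((s.2.1.deg - s.2.1.length).negOnePow : ℤ) : R) •
      m (s.2.1.append (Chain.cons (m t.2.1 (t.2.1.deg + 2 - t.2.1.length)) t.2.2)) k).sum).sum

theorem ainfSum_map [∀ x y k, Zero (H x y k)] [∀ x y k, Add (H x y k)]
    [∀ x y k, SMul R (H x y k)] [∀ x y k, Zero (H' x y k)] [∀ x y k, Add (H' x y k)]
    [∀ x y k, SMul R (H' x y k)]
    (m : ∀ {x y : O}, Chain H x y → ∀ k : ℤ, H x y k)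
    (m' : ∀ {x y : O'}, Chain H' x y → ∀ k : ℤ, H' x y k)
    (F : O → O') (φ : ∀ {x y : O} {k : ℤ}, H x y k → H' (F x) (F y) k)
    (h0 : ∀ {x y : O} {k : ℤ}, φ (0 : H x y k) = 0)
    (ha : ∀ {x y : O} {k : ℤ} (f g : H x y k), φ (f + g) = φ f + φ g)
    (hs : ∀ {x y : O} {k : ℤ} (r : R) (f : H x y k), φ (r • f) = r • φ f)
    (hm : ∀ {x y : O} (p : Chain H x y) (k : ℤ), φ (m p k) = m' (p.map F φ) k)
    {x y : O} (p : Chain H x y) (k : ℤ) :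
    φ (ainfSum (R := R) m p k) = ainfSum (R := R) m' (p.map F φ) k := by
  have hsum : ∀ {x y : O} {k : ℤ} (l : List (H x y k)), φ l.sum = (l.map φ).sum := by
    intro x y k l
    induction l with
    | nil => simpa using h0
    | cons a l ih => simp only [List.sum_cons, List.map_cons, ha, ih]
  have hcons : ∀ {x y : O} {z : O'} (b : Chain H x y) (c : Chain H' (F y) z),
      Chain.cons (m' (b.map F φ) ((b.map F φ).deg + 2 - (b.map F φ).length)) c =
        Chain.cons (m' (b.map F φ) (b.deg + 2 - b.length)) c := by
    intro x y z b c
    rw [Chain.deg_map, Chain.length_map]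
  simp only [ainfSum, Chain.splits_map, hsum, List.map_map, Function.comp_def, hs, hm,
    Chain.map_append, Chain.map, hcons, Chain.deg_map, Chain.length_map]

end AInfSum

/-- A graded `R`-linear quiver; `Hom x y k` is the degree `k` part of the hom-space. -/
structure GradedQuiver (R : Type u) [CommRing R] where
  Ob : Type u
  Hom : Ob → Ob → ℤ → Type u
  [addCommGroup : ∀ x y k, AddCommGroup (Hom x y k)]
  [module : ∀ x y k, Module R (Hom x y k)]

attribute [instance] GradedQuiver.addCommGroup GradedQuiver.module

/-- A DG quiver: a graded quiver with a differential of degree `1` on every hom-space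
(`d x y i j` vanishes unless `j = i + 1`). -/
structure DGQuiver (R : Type u) [CommRing R] extends GradedQuiver R where
  d : ∀ (x y : Ob) (i j : ℤ), Hom x y i →ₗ[R] Hom x y j
  shape : ∀ (x y : Ob) (i j : ℤ), i + 1 ≠ j → d x y i j = 0
  d_d : ∀ (x y : Ob) (i j k : ℤ) (f : Hom x y i), d x y j k (d x y i j f) = 0

/-- A non unital A∞-category.  For a chain `p = (fₙ, …, f₁)` of homogeneous morphisms, `m p k` is
the degree `k` component of `mⁿ(fₙ, …, f₁)`; as `mⁿ` has degree `2 - n`, it vanishes unless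
`k = deg f₁ + ⋯ + deg fₙ + 2 - n`.  There is no operation `m⁰`. -/
structure AInfCat (R : Type u) [CommRing R] extends GradedQuiver R where
  m : ∀ {x y : Ob}, Chain Hom x y → ∀ k : ℤ, Hom x y k
  m_nil : ∀ (x : Ob) (k : ℤ), m (Chain.nil x) k = 0
  m_deg : ∀ {x y : Ob} (p : Chain Hom x y) (k : ℤ), k ≠ p.deg + 2 - p.length → m p k = 0
  m_add : ∀ {w x y z : Ob} (p : Chain Hom w x) {j : ℤ} (f g : Hom x y j) (q : Chain Hom y z)
    (k : ℤ), m (p.append (.cons (f + g) q)) k =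
      m (p.append (.cons f q)) k + m (p.append (.cons g q)) k
  m_smul : ∀ {w x y z : Ob} (p : Chain Hom w x) {j : ℤ} (r : R) (f : Hom x y j)
    (q : Chain Hom y z) (k : ℤ), m (p.append (.cons (r • f) q)) k = r • m (p.append (.cons f q)) k
  ainf : ∀ {x y : Ob} (p : Chain Hom x y) (k : ℤ), ainfSum (R := R) m p k = 0

namespace AInfCat

variable {R : Type u} [CommRing R]

/-- The differential `m¹`, as a map from degree `i` to degree `j`. -/
def d (A : AInfCat R) (x y : A.Ob) (i j : ℤ) : A.Hom x y i →ₗ[R] A.Hom x y j where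
  toFun f := A.m (.single f) j
  map_add' f g := A.m_add (.nil x) f g (.nil y) j
  map_smul' r f := A.m_smul (.nil x) r f (.nil y) j

theorem shape (A : AInfCat R) (x y : A.Ob) (i j : ℤ) (h : i + 1 ≠ j) : A.d x y i j = 0 := by
  ext f
  refine A.m_deg _ _ ?_
  simp only [Chain.single, Chain.deg, Chain.length]
  omega

theorem d_d (A : AInfCat R) (x y : A.Ob) (i j k : ℤ) (f : A.Hom x y i) :
    A.d x y j k (A.d x y i j f) = 0 := by
  by_cases h : i + 1 = j
  · subst h
    have h1 := A.ainf (.single f) k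
    simp only [ainfSum, Chain.single, Chain.splits, List.map_cons, List.map_nil, List.sum_cons,
      List.sum_nil, Chain.deg, Chain.length, Chain.append, add_zero, sub_self] at h1
    have e1 : A.m (.cons (A.m (.nil x) (0 + 2 - 0)) (.cons f (.nil y))) k = 0 := by
      rw [A.m_nil]
      simpa [Chain.append] using A.m_smul (.nil x) (0 : R) (0 : A.Hom x x (0 + 2 - 0)) (.cons f (.nil y)) k
    have e2 : A.m (.cons f (.cons (A.m (.nil y) (0 + 2 - 0)) (.nil y))) k = 0 := by
      rw [A.m_nil]
      simpa [Chain.append] using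
        A.m_smul (.cons f (.nil y)) (0 : R) (0 : A.Hom y y (0 + 2 - 0)) (.nil y) k
    rw [e1, e2] at h1
    have e3 : i + 0 + 2 - (0 + 1) = i + 1 := by ring
    rw [e3] at h1
    change A.m (.cons (A.m (.cons f (.nil y)) (i + 1)) (.nil y)) k = 0
    simpa using h1
  · rw [A.shape x y i j h]; simp

/-- The underlying DG quiver `|A|`. -/
abbrev toDGQuiver (A : AInfCat R) : DGQuiver R where
  toGradedQuiver := A.toGradedQuiver
  d := A.d
  shape := A.shape
  d_d := A.d_d

/-- The hom-complex `(Hom(x, y), m¹)`. -/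
def homComplex (A : AInfCat R) (x y : A.Ob) : CochainComplex (ModuleCat.{u} R) ℤ where
  X k := ModuleCat.of R (A.Hom x y k)
  d i j := ModuleCat.ofHom (A.d x y i j)
  shape i j h := by
    rw [A.shape x y i j h]; rfl
  d_comp_d' i j k _ _ := by
    ext f; exact A.d_d x y i j k f

end AInfCat

/-- A strictly unital A∞-category.  With the signs of the A∞-equation used here, the unit axioms
read `m²(f, 1) = f` and `m²(1, f) = (-1)^(deg f) f`. -/
structure SUAInfCat (R : Type u) [CommRing R] extends AInfCat R where
  one : ∀ x : Ob, Hom x x 0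
  one_closed : ∀ (x : Ob) (k : ℤ), m (.single (one x)) k = 0
  m_one_right : ∀ {x y : Ob} {k : ℤ} (f : Hom x y k), m (.cons (one x) (.single f)) k = f
  m_one_left : ∀ {x y : Ob} {k : ℤ} (f : Hom x y k),
    m (.cons f (.single (one y))) k = ((k.negOnePow : ℤ) : R) • f
  m_one : ∀ {x y z : Ob} (p : Chain Hom x y) (q : Chain Hom y z) (k : ℤ),
    2 ≤ p.length + q.length → m (p.append (.cons (one y) q)) k = 0

/-! ### Strict functors -/

/-- A strict non unital A∞-functor. -/
structure StrictFunctor {R : Type u} [CommRing R] (A B : AInfCat R) where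
  obj : A.Ob → B.Ob
  map : ∀ {x y : A.Ob} {k : ℤ}, A.Hom x y k →ₗ[R] B.Hom (obj x) (obj y) k
  map_m : ∀ {x y : A.Ob} (p : Chain A.Hom x y) (k : ℤ),
    map (A.m p k) = B.m (p.map obj (fun f => map f)) k

/-- A strict, strictly unital A∞-functor. -/
structure SUStrictFunctor {R : Type u} [CommRing R] (A B : SUAInfCat R) extends
    StrictFunctor A.toAInfCat B.toAInfCat where
  map_one : ∀ x : A.Ob, map (A.one x) = B.one (obj x)

/-- The category of strictly unital A∞-categories and strict strictly unital A∞-functors. -/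
instance {R : Type u} [CommRing R] : Category.{u} (SUAInfCat R) where
  Hom A B := SUStrictFunctor A B
  id A :=
    { obj := fun x => x
      map := LinearMap.id
      map_m := fun p k => by simp only [LinearMap.id_coe, id_eq, Chain.map_id]
      map_one := fun _ => rfl }
  comp F G :=
    { obj := fun x => G.obj (F.obj x)
      map := G.map ∘ₗ F.map
      map_m := fun p k => by
        simp only [LinearMap.coe_comp, Function.comp_apply, F.map_m, G.map_m]
        rw [Chain.map_map (G := G.obj) (ψ := fun f => G.map f)]
      map_one := fun x => by
        simp only [LinearMap.coe_comp, Function.comp_apply, F.map_one, G.map_one] }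

namespace SUStrictFunctor

variable {R : Type u} [CommRing R] {A B : SUAInfCat R}

/-- The map of hom-complexes induced by a strict functor. -/
def homComplexMap (F : SUStrictFunctor A B) (x y : A.Ob) :
    A.homComplex x y ⟶ B.homComplex (F.obj x) (F.obj y) where
  f k := ModuleCat.ofHom (F.map (x := x) (y := y) (k := k))
  comm' i j _ := by
    ext f; exact (F.map_m (.single f) j).symm

/-- `F` is a quasi-equivalence: it is a quasi-isomorphism on all hom-complexes, and every object
of `B` is isomorphic in `H⁰(B)` to one in the image of `F`. -/
def IsQuasiEquivalence (F : SUStrictFunctor A B) : Prop :=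
  (∀ x y : A.Ob, QuasiIso (F.homComplexMap x y)) ∧
  ∀ y : B.Ob, ∃ (x : A.Ob) (f : B.Hom (F.obj x) y 0) (g : B.Hom y (F.obj x) 0),
    B.d _ _ 0 1 f = 0 ∧ B.d _ _ 0 1 g = 0 ∧
    B.m (.cons f (.single g)) 0 - B.one (F.obj x) ∈ LinearMap.range (B.d _ _ (-1) 0) ∧
    B.m (.cons g (.single f)) 0 - B.one y ∈ LinearMap.range (B.d _ _ (-1) 0)

/-- `F` is surjective on the morphisms. -/
def IsSurjectiveOnMorphisms (F : SUStrictFunctor A B) : Prop :=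
  ∀ (x y : A.Ob) (k : ℤ), Function.Surjective (F.map (x := x) (y := y) (k := k))

end SUStrictFunctor

/-! ### The free A∞-category on a DG quiver -/

section Free

variable {R : Type u} [CommRing R]

/-- Formal expressions in the morphisms of a DG quiver `Q`, built with the operations of
an A∞-category. -/
inductive FreeTerm (Q : DGQuiver R) : Q.Ob → Q.Ob → ℤ → Type u
  | gen {x y : Q.Ob} {k : ℤ} (f : Q.Hom x y k) : FreeTerm Q x y k
  | zero {x y : Q.Ob} {k : ℤ} : FreeTerm Q x y k
  | add {x y : Q.Ob} {k : ℤ} (s t : FreeTerm Q x y k) : FreeTerm Q x y k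
  | smul {x y : Q.Ob} {k : ℤ} (r : R) (t : FreeTerm Q x y k) : FreeTerm Q x y k
  | op {x y : Q.Ob} (p : Chain (FreeTerm Q) x y) (k : ℤ) : FreeTerm Q x y k

namespace FreeTerm

variable {Q : DGQuiver R}

instance (x y : Q.Ob) (k : ℤ) : Zero (FreeTerm Q x y k) := ⟨zero⟩
instance (x y : Q.Ob) (k : ℤ) : Add (FreeTerm Q x y k) := ⟨add⟩
instance (x y : Q.Ob) (k : ℤ) : SMul R (FreeTerm Q x y k) := ⟨smul⟩

/-- The smallest congruence on expressions for which the hom-spaces become `R`-modules, the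
operations satisfy the axioms of an A∞-category, and `Q` maps to the result by a map of
DG quivers. -/
inductive Rel : ∀ {x y : Q.Ob} {k : ℤ}, FreeTerm Q x y k → FreeTerm Q x y k → Prop
  | refl {x y k} (s : FreeTerm Q x y k) : Rel s s
  | symm {x y k} {s t : FreeTerm Q x y k} : Rel s t → Rel t s
  | trans {x y k} {s t v : FreeTerm Q x y k} : Rel s t → Rel t v → Rel s v
  | add_congr {x y k} {s s' t t' : FreeTerm Q x y k} : Rel s s' → Rel t t' → Rel (s + t) (s' + t')
  | smul_congr {x y k} (r : R) {s t : FreeTerm Q x y k} : Rel s t → Rel (r • s) (r • t)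
  | op_congr {w x y z : Q.Ob} {j : ℤ} (p : Chain (FreeTerm Q) w x) {s t : FreeTerm Q x y j}
      (q : Chain (FreeTerm Q) y z) (k : ℤ) : Rel s t →
      Rel (op (p.append (.cons s q)) k) (op (p.append (.cons t q)) k)
  | add_assoc {x y k} (s t v : FreeTerm Q x y k) : Rel (s + t + v) (s + (t + v))
  | add_comm {x y k} (s t : FreeTerm Q x y k) : Rel (s + t) (t + s)
  | zero_add {x y k} (s : FreeTerm Q x y k) : Rel (0 + s) s
  | zero_smul {x y k} (s : FreeTerm Q x y k) : Rel ((0 : R) • s) 0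
  | one_smul {x y k} (s : FreeTerm Q x y k) : Rel ((1 : R) • s) s
  | mul_smul {x y k} (a b : R) (s : FreeTerm Q x y k) : Rel ((a * b) • s) (a • b • s)
  | add_smul {x y k} (a b : R) (s : FreeTerm Q x y k) : Rel ((a + b) • s) (a • s + b • s)
  | smul_add {x y k} (a : R) (s t : FreeTerm Q x y k) : Rel (a • (s + t)) (a • s + a • t)
  | gen_add {x y k} (f g : Q.Hom x y k) : Rel (gen (f + g)) (gen f + gen g)
  | gen_smul {x y k} (r : R) (f : Q.Hom x y k) : Rel (gen (r • f)) (r • gen f)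
  | gen_d {x y} (i j : ℤ) (f : Q.Hom x y i) : Rel (op (.single (gen f)) j) (gen (Q.d x y i j f))
  | op_nil (x : Q.Ob) (k : ℤ) : Rel (op (.nil x) k) 0
  | op_deg {x y} (p : Chain (FreeTerm Q) x y) (k : ℤ) : k ≠ p.deg + 2 - p.length → Rel (op p k) 0
  | op_add {w x y z : Q.Ob} {j : ℤ} (p : Chain (FreeTerm Q) w x) (s t : FreeTerm Q x y j)
      (q : Chain (FreeTerm Q) y z) (k : ℤ) : Rel (op (p.append (.cons (s + t) q)) k)
        (op (p.append (.cons s q)) k + op (p.append (.cons t q)) k)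
  | op_smul {w x y z : Q.Ob} {j : ℤ} (p : Chain (FreeTerm Q) w x) (r : R) (s : FreeTerm Q x y j)
      (q : Chain (FreeTerm Q) y z) (k : ℤ) : Rel (op (p.append (.cons (r • s) q)) k)
        (r • op (p.append (.cons s q)) k)
  | ainf {x y} (p : Chain (FreeTerm Q) x y) (k : ℤ) :
      Rel (ainfSum (R := R) (H := FreeTerm Q) op p k) 0

/-- The congruence as a setoid. -/
def setoid (Q : DGQuiver R) (x y : Q.Ob) (k : ℤ) : Setoid (FreeTerm Q x y k) where
  r := Rel
  iseqv := ⟨Rel.refl, Rel.symm, Rel.trans⟩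

end FreeTerm

/-- The hom-spaces of the free A∞-category. -/
def FreeHom (Q : DGQuiver R) (x y : Q.Ob) (k : ℤ) : Type u := Quotient (FreeTerm.setoid Q x y k)

namespace FreeHom

variable {Q : DGQuiver R}

/-- The class of an expression. -/
def mk {x y : Q.Ob} {k : ℤ} (t : FreeTerm Q x y k) : FreeHom Q x y k :=
  Quotient.mk (FreeTerm.setoid Q x y k) t

/-- A representative. -/
noncomputable def out {x y : Q.Ob} {k : ℤ} (f : FreeHom Q x y k) : FreeTerm Q x y k :=
  Quotient.out f

theorem mk_out {x y : Q.Ob} {k : ℤ} (f : FreeHom Q x y k) : mk f.out = f := Quotient.out_eq _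

theorem sound {x y : Q.Ob} {k : ℤ} {s t : FreeTerm Q x y k} (h : s.Rel t) : mk s = mk t :=
  Quotient.sound (s := FreeTerm.setoid Q x y k) h

theorem exact {x y : Q.Ob} {k : ℤ} {s t : FreeTerm Q x y k} (h : mk s = mk t) : s.Rel t :=
  Quotient.exact (s := FreeTerm.setoid Q x y k) h

theorem ind {x y : Q.Ob} {k : ℤ} {P : FreeHom Q x y k → Prop} (h : ∀ t, P (mk t)) (f) : P f :=
  Quotient.ind (s := FreeTerm.setoid Q x y k) h f

instance (x y : Q.Ob) (k : ℤ) : Zero (FreeHom Q x y k) := ⟨mk 0⟩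

instance (x y : Q.Ob) (k : ℤ) : Add (FreeHom Q x y k) :=
  ⟨Quotient.map₂ (· + ·) fun _ _ h _ _ h' => FreeTerm.Rel.add_congr h h'⟩

instance (x y : Q.Ob) (k : ℤ) : SMul R (FreeHom Q x y k) :=
  ⟨fun r => Quotient.map (r • ·) fun _ _ h => FreeTerm.Rel.smul_congr r h⟩

theorem mk_zero {x y : Q.Ob} {k : ℤ} : mk (0 : FreeTerm Q x y k) = 0 := rfl
theorem mk_add {x y : Q.Ob} {k : ℤ} (s t : FreeTerm Q x y k) : mk (s + t) = mk s + mk t := rfl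
theorem mk_smul {x y : Q.Ob} {k : ℤ} (r : R) (t : FreeTerm Q x y k) : mk (r • t) = r • mk t := rfl

theorem add_comm' {x y : Q.Ob} {k : ℤ} (f g : FreeHom Q x y k) : f + g = g + f := by
  induction f using ind with | _ s =>
  induction g using ind with | _ t => exact sound (.add_comm s t)

theorem zero_add' {x y : Q.Ob} {k : ℤ} (f : FreeHom Q x y k) : 0 + f = f := by
  induction f using ind with | _ s => exact sound (.zero_add s)

theorem add_assoc' {x y : Q.Ob} {k : ℤ} (f g h : FreeHom Q x y k) : f + g + h = f + (g + h) := by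
  induction f using ind with | _ s =>
  induction g using ind with | _ t =>
  induction h using ind with | _ v => exact sound (.add_assoc s t v)

theorem zero_smul' {x y : Q.Ob} {k : ℤ} (f : FreeHom Q x y k) : (0 : R) • f = 0 := by
  induction f using ind with | _ s => exact sound (.zero_smul s)

theorem one_smul' {x y : Q.Ob} {k : ℤ} (f : FreeHom Q x y k) : (1 : R) • f = f := by
  induction f using ind with | _ s => exact sound (.one_smul s)

theorem add_smul' {x y : Q.Ob} {k : ℤ} (a b : R) (f : FreeHom Q x y k) :
    (a + b) • f = a • f + b • f := by
  induction f using ind with | _ s => exact sound (.add_smul a b s)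

theorem mul_smul' {x y : Q.Ob} {k : ℤ} (a b : R) (f : FreeHom Q x y k) :
    (a * b) • f = a • b • f := by
  induction f using ind with | _ s => exact sound (.mul_smul a b s)

theorem smul_add' {x y : Q.Ob} {k : ℤ} (a : R) (f g : FreeHom Q x y k) :
    a • (f + g) = a • f + a • g := by
  induction f using ind with | _ s =>
  induction g using ind with | _ t => exact sound (.smul_add a s t)

instance (x y : Q.Ob) (k : ℤ) : Neg (FreeHom Q x y k) := ⟨fun f => (-1 : R) • f⟩

instance (x y : Q.Ob) (k : ℤ) : AddCommGroup (FreeHom Q x y k) where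
  add_assoc := add_assoc'
  zero_add := zero_add'
  add_zero f := by rw [add_comm', zero_add']
  add_comm := add_comm'
  nsmul := nsmulRec
  zsmul := zsmulRec
  neg_add_cancel f := by
    change (-1 : R) • f + f = 0
    conv_lhs => rw [← one_smul' f, ← mul_smul', ← add_smul']
    simpa using zero_smul' f

instance (x y : Q.Ob) (k : ℤ) : Module R (FreeHom Q x y k) where
  one_smul := one_smul'
  mul_smul := mul_smul'
  smul_add := smul_add'
  smul_zero a := by
    have h := mul_smul' a 0 (0 : FreeHom Q x y k)
    rwa [mul_zero, zero_smul', eq_comm] at h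
  add_smul := add_smul'
  zero_smul := zero_smul'

/-- The operations of the free A∞-category. -/
noncomputable def m {x y : Q.Ob} (p : Chain (FreeHom Q) x y) (k : ℤ) : FreeHom Q x y k :=
  mk (.op (p.map (fun x => x) (fun f => f.out)) k)

theorem op_congr_chain {w x y : Q.Ob} (a : Chain (FreeTerm Q) w x) (p : Chain (FreeTerm Q) x y)
    (k : ℤ) :
    FreeTerm.Rel (.op (a.append (p.map (fun x => x) (fun t => (mk t).out))) k)
      (.op (a.append p) k) := by
  have app : ∀ {w x y z : Q.Ob} {j : ℤ} (a : Chain (FreeTerm Q) w x) (t : FreeTerm Q x y j)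
      (q : Chain (FreeTerm Q) y z), a.append (.cons t q) = (a.append (.single t)).append q := by
    intro w x y z j a t q
    induction a with
    | nil => rfl
    | cons f a ih => simp only [Chain.append, ih]
  induction p with
  | nil => exact .refl _
  | cons f p ih =>
    simp only [Chain.map]
    refine .trans (.op_congr a _ k (exact (mk_out (mk f)))) ?_
    rw [app, app a]
    exact ih _

theorem m_mk {x y : Q.Ob} (p : Chain (FreeTerm Q) x y) (k : ℤ) :
    m (p.map (fun x => x) (fun t => mk t)) k = mk (.op p k) := by
  have h := Chain.map_map (fun x => x) (fun t : FreeTerm Q _ _ _ => mk t) (fun x => x)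
    (fun f : FreeHom Q _ _ _ => f.out) p
  exact (congrArg (fun c => mk (.op c k)) h).trans (sound (op_congr_chain (.nil x) p k))

theorem exists_chain {x y : Q.Ob} (p : Chain (FreeHom Q) x y) :
    ∃ q : Chain (FreeTerm Q) x y, q.map (fun x => x) (fun t => mk t) = p := by
  refine ⟨p.map (fun x => x) (fun f => f.out), ?_⟩
  refine (Chain.map_map (fun x => x) (fun f : FreeHom Q _ _ _ => f.out) (fun x => x)
    (fun t : FreeTerm Q _ _ _ => mk t) p).trans ?_
  simp only [mk_out]
  exact Chain.map_id p

end FreeHom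

/-- The free A∞-category on a DG quiver `Q`, given by generators and relations: it is generated
by the morphisms of `Q` under the operations `mⁿ`, subject only to linearity and the A∞-equations,
where `m¹` restricts to the differential on `Q`. -/
noncomputable abbrev freeAInfCat (Q : DGQuiver R) : AInfCat R where
  Ob := Q.Ob
  Hom := FreeHom Q
  m := FreeHom.m
  m_nil x k := FreeHom.sound (.op_nil x k)
  m_deg p k h := by
    obtain ⟨p, rfl⟩ := FreeHom.exists_chain p
    rw [Chain.deg_map, Chain.length_map] at h
    rw [FreeHom.m_mk]
    exact FreeHom.sound (.op_deg p k h)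
  m_add p j f g q k := by
    obtain ⟨p, rfl⟩ := FreeHom.exists_chain p
    obtain ⟨q, rfl⟩ := FreeHom.exists_chain q
    induction f using FreeHom.ind with | _ s =>
    induction g using FreeHom.ind with | _ t =>
    have h := FreeHom.sound (FreeTerm.Rel.op_add p s t q k)
    simpa only [FreeHom.mk_add, ← FreeHom.m_mk, Chain.map_append, Chain.map] using h
  m_smul p j r f q k := by
    obtain ⟨p, rfl⟩ := FreeHom.exists_chain p
    obtain ⟨q, rfl⟩ := FreeHom.exists_chain q
    induction f using FreeHom.ind with | _ s =>
    have h := FreeHom.sound (FreeTerm.Rel.op_smul p r s q k)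
    simpa only [FreeHom.mk_smul, ← FreeHom.m_mk, Chain.map_append, Chain.map] using h
  ainf p k := by
    obtain ⟨p, rfl⟩ := FreeHom.exists_chain p
    rw [← FreeHom.mk_zero, ← FreeHom.sound (FreeTerm.Rel.ainf p k)]
    exact (ainfSum_map (R := R) (H := FreeTerm Q) (H' := FreeHom Q) FreeTerm.op FreeHom.m
      (fun x => x) (fun t => FreeHom.mk t) FreeHom.mk_zero FreeHom.mk_add FreeHom.mk_smul
      (fun p k => (FreeHom.m_mk p k).symm) p k).symm

/-- The inclusion of the generators, `Q → |freeAInfCat Q|`. -/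
def freeGen (Q : DGQuiver R) {x y : Q.Ob} {k : ℤ} (f : Q.Hom x y k) :
    (freeAInfCat Q).Hom x y k :=
  FreeHom.mk (.gen f)

/-- A map of DG quivers. -/
structure DGQuiverMap (P Q : DGQuiver R) where
  obj : P.Ob → Q.Ob
  map : ∀ {x y : P.Ob} {k : ℤ}, P.Hom x y k →ₗ[R] Q.Hom (obj x) (obj y) k
  map_d : ∀ {x y : P.Ob} (i j : ℤ) (f : P.Hom x y i), map (P.d x y i j f) = Q.d _ _ i j (map f)

section Lift

variable {Q : DGQuiver R} {B : AInfCat R} (G : DGQuiverMap Q B.toDGQuiver)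

mutual

/-- Evaluation of a formal expression in an A∞-category `B`, along `G : Q → |B|`. -/
def FreeTerm.eval : ∀ {x y : Q.Ob} {k : ℤ}, FreeTerm Q x y k → B.Hom (G.obj x) (G.obj y) k
  | _, _, _, .gen f => G.map f
  | _, _, _, .zero => 0
  | _, _, _, .add s t => FreeTerm.eval s + FreeTerm.eval t
  | _, _, _, .smul r t => r • FreeTerm.eval t
  | _, _, _, .op p k => B.m (FreeTerm.evalChain p) k

/-- Evaluation of a chain of formal expressions. -/
def FreeTerm.evalChain : ∀ {x y : Q.Ob}, Chain (FreeTerm Q) x y →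
    Chain B.Hom (G.obj x) (G.obj y)
  | _, _, .nil x => .nil (G.obj x)
  | _, _, .cons t p => .cons (FreeTerm.eval t) (FreeTerm.evalChain p)

end

theorem FreeTerm.evalChain_eq {x y : Q.Ob} (p : Chain (FreeTerm Q) x y) :
    FreeTerm.evalChain G p = p.map G.obj (fun t => FreeTerm.eval G t) := by
  induction p with
  | nil => rw [FreeTerm.evalChain, Chain.map]
  | cons t p ih => rw [FreeTerm.evalChain, Chain.map, ih]

theorem FreeTerm.eval_gen {x y : Q.Ob} {k : ℤ} (f : Q.Hom x y k) :
    FreeTerm.eval G (.gen f) = G.map f := by rw [FreeTerm.eval]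

theorem FreeTerm.eval_zero {x y : Q.Ob} {k : ℤ} :
    FreeTerm.eval G (0 : FreeTerm Q x y k) = 0 := by
  change FreeTerm.eval G .zero = 0
  rw [FreeTerm.eval]

theorem FreeTerm.eval_add {x y : Q.Ob} {k : ℤ} (s t : FreeTerm Q x y k) :
    FreeTerm.eval G (s + t) = FreeTerm.eval G s + FreeTerm.eval G t := by
  change FreeTerm.eval G (.add s t) = _
  rw [FreeTerm.eval]

theorem FreeTerm.eval_smul {x y : Q.Ob} {k : ℤ} (r : R) (t : FreeTerm Q x y k) :
    FreeTerm.eval G (r • t) = r • FreeTerm.eval G t := by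
  change FreeTerm.eval G (.smul r t) = _
  rw [FreeTerm.eval]

theorem FreeTerm.eval_op {x y : Q.Ob} (p : Chain (FreeTerm Q) x y) (k : ℤ) :
    FreeTerm.eval G (.op p k) = B.m (p.map G.obj (fun t => FreeTerm.eval G t)) k := by
  rw [FreeTerm.eval, FreeTerm.evalChain_eq]

theorem FreeTerm.eval_rel {x y : Q.Ob} {k : ℤ} {s t : FreeTerm Q x y k} (h : s.Rel t) :
    FreeTerm.eval G s = FreeTerm.eval G t := by
  induction h with
  | refl => rfl
  | symm _ ih => exact ih.symm
  | trans _ _ ih ih' => exact ih.trans ih'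
  | add_congr _ _ ih ih' => simp only [eval_add, ih, ih']
  | smul_congr r _ ih => simp only [eval_smul, ih]
  | op_congr p q k _ ih => simp only [eval_op, Chain.map_append, Chain.map, ih]
  | add_assoc => simp only [eval_add, _root_.add_assoc]
  | add_comm => simp only [eval_add]; exact _root_.add_comm _ _
  | zero_add => simp only [eval_add, eval_zero, _root_.zero_add]
  | zero_smul => simp only [eval_smul, eval_zero, _root_.zero_smul]
  | one_smul => simp only [eval_smul, _root_.one_smul]
  | mul_smul => simp only [eval_smul, SemigroupAction.mul_smul]
  | add_smul => simp only [eval_smul, eval_add, _root_.add_smul]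
  | smul_add => simp only [eval_smul, eval_add, _root_.smul_add]
  | gen_add => simp only [eval_add, eval_gen, map_add]
  | gen_smul => simp only [eval_smul, eval_gen, map_smul]
  | gen_d i j f =>
    rw [eval_op, eval_gen, G.map_d]
    simp only [Chain.single, Chain.map, eval_gen]
    rfl
  | op_nil x k => rw [eval_op, eval_zero]; exact B.m_nil _ _
  | op_deg p k h =>
    rw [eval_op, eval_zero]
    exact B.m_deg _ _ (by rwa [Chain.deg_map, Chain.length_map])
  | op_add p s t q k =>
    simp only [eval_op, eval_add, Chain.map_append, Chain.map]
    exact B.m_add _ _ _ _ _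
  | op_smul p r s q k =>
    simp only [eval_op, eval_smul, Chain.map_append, Chain.map]
    exact B.m_smul _ _ _ _ _
  | ainf p k =>
    rw [eval_zero]
    exact (ainfSum_map (R := R) (H := FreeTerm Q) (H' := B.Hom) FreeTerm.op B.m G.obj
      (fun t => FreeTerm.eval G t) (eval_zero G) (eval_add G) (eval_smul G) (eval_op G) p k).trans
      (B.ainf _ k)

/-- Evaluation on the hom-spaces of the free A∞-category. -/
def FreeHom.eval {x y : Q.Ob} {k : ℤ} : FreeHom Q x y k →ₗ[R] B.Hom (G.obj x) (G.obj y) k where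
  toFun := Quotient.lift (s := FreeTerm.setoid Q x y k) (fun t => FreeTerm.eval G t)
    (fun _ _ h => FreeTerm.eval_rel G h)
  map_add' f g := by
    induction f using FreeHom.ind with | _ s =>
    induction g using FreeHom.ind with | _ t => exact FreeTerm.eval_add G s t
  map_smul' r f := by
    induction f using FreeHom.ind with | _ s => exact FreeTerm.eval_smul G r s

/-- The strict functor out of the free A∞-category which extends a map `G : Q → |B|` of
DG quivers: an expression in morphisms of `Q` is sent to its value in `B`. -/
def freeLift : StrictFunctor (freeAInfCat Q) B where
  obj := G.obj
  map := FreeHom.eval G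
  map_m p k := by
    obtain ⟨p, rfl⟩ := FreeHom.exists_chain p
    refine (congrArg (FreeHom.eval G) (FreeHom.m_mk p k)).trans ?_
    refine (FreeTerm.eval_op G p k).trans (congrArg (fun c => B.m c k) ?_)
    exact (Chain.map_map (fun x => x) (fun t : FreeTerm Q _ _ _ => FreeHom.mk t) G.obj
      (fun f : FreeHom Q _ _ _ => FreeHom.eval G f) p).symm

end Lift

end Free

/-! ### Subquivers, subcategories, ideals -/

section Sub

variable {R : Type u} [CommRing R]

/-- A DG subquiver, with the same objects. -/
structure DGSubquiver (Q : DGQuiver R) where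
  carrier : ∀ (x y : Q.Ob) (k : ℤ), Submodule R (Q.Hom x y k)
  d_mem : ∀ {x y : Q.Ob} (i j : ℤ) (f : Q.Hom x y i), f ∈ carrier x y i →
    Q.d x y i j f ∈ carrier x y j

namespace DGSubquiver

variable {Q : DGQuiver R}

/-- A DG subquiver as a DG quiver. -/
abbrev toDGQuiver (S : DGSubquiver Q) : DGQuiver R where
  Ob := Q.Ob
  Hom x y k := S.carrier x y k
  d x y i j := (Q.d x y i j).restrict (fun f hf => S.d_mem i j f hf)
  shape x y i j h := by
    ext f
    simp [Q.shape x y i j h]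
  d_d x y i j k f := Subtype.ext (Q.d_d x y i j k f)

/-- The inclusion. -/
def incl (S : DGSubquiver Q) : DGQuiverMap S.toDGQuiver Q where
  obj := fun x => x
  map {x y k} := (S.carrier x y k).subtype
  map_d _ _ _ := rfl

end DGSubquiver

/-- A strictly unital A∞-subcategory, with the same objects. -/
structure AInfSubcategory (A : SUAInfCat R) where
  carrier : ∀ (x y : A.Ob) (k : ℤ), Submodule R (A.Hom x y k)
  m_mem : ∀ {x y : A.Ob} (p : Chain (fun x y k => carrier x y k) x y) (k : ℤ),
    A.m (p.map (H' := A.Hom) (fun x => x) (fun f => f.1)) k ∈ carrier x y k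
  one_mem : ∀ x : A.Ob, A.one x ∈ carrier x x 0

/-- An A∞-ideal: a family of submodules of the hom-spaces such that `mⁿ(fₙ, …, f₁)`, `n ≥ 1`, lies
in the family as soon as one of the `fᵢ` does. -/
def AInfCat.IsIdeal (C : AInfCat R) (I : ∀ (x y : C.Ob) (k : ℤ), Submodule R (C.Hom x y k)) :
    Prop :=
  ∀ {w x y z : C.Ob} {j : ℤ} (p : Chain C.Hom w x) (f : C.Hom x y j) (q : Chain C.Hom y z) (k : ℤ),
    f ∈ I x y j → C.m (p.append (.cons f q)) k ∈ I w z k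

/-- The smallest A∞-ideal that contains the morphisms in `S`. -/
def AInfCat.idealGeneratedBy (C : AInfCat R) (S : ∀ {x y : C.Ob} {k : ℤ}, C.Hom x y k → Prop)
    (x y : C.Ob) (k : ℤ) : Submodule R (C.Hom x y k) :=
  ⨅ (I : ∀ (x y : C.Ob) (k : ℤ), Submodule R (C.Hom x y k)) (_ : C.IsIdeal I)
    (_ : ∀ {x y : C.Ob} {k : ℤ} (f : C.Hom x y k), S f → f ∈ I x y k), I x y k

/-! ### Semi-free A∞-categories -/

variable {A : SUAInfCat R}

/-- The defining relations, in the free A∞-category on a DG subquiver `Q` of `|A|`, of the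
strictly unital A∞-category freely generated by `Q` relative to an A∞-subcategory `K ⊆ Q`:
* the operations `mⁿ` of the free A∞-category agree with those of `K` on morphisms of `K`;
* the units of `K` are strict units. -/
inductive RelFreeRelation (K : AInfSubcategory A) (Q : DGSubquiver A.toDGQuiver)
    (hKQ : ∀ x y k, K.carrier x y k ≤ Q.carrier x y k) :
    ∀ {x y : A.Ob} {k : ℤ}, (freeAInfCat Q.toDGQuiver).Hom x y k → Prop
  | m {x y : A.Ob} (p : Chain (fun x y k => K.carrier x y k) x y) (k : ℤ) :
      RelFreeRelation K Q hKQ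
        ((freeAInfCat Q.toDGQuiver).m
            (p.map (fun x => x) (fun f => freeGen Q.toDGQuiver ⟨f.1, hKQ _ _ _ f.2⟩)) k -
          freeGen Q.toDGQuiver (x := x) (y := y) ⟨_, hKQ _ _ _ (K.m_mem p k)⟩)
  | one_right {x y : A.Ob} {k : ℤ} (t : (freeAInfCat Q.toDGQuiver).Hom x y k) :
      RelFreeRelation K Q hKQ
        ((freeAInfCat Q.toDGQuiver).m
          (.cons (freeGen Q.toDGQuiver ⟨A.one x, hKQ _ _ _ (K.one_mem x)⟩) (.single t)) k - t)
  | one_left {x y : A.Ob} {k : ℤ} (t : (freeAInfCat Q.toDGQuiver).Hom x y k) :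
      RelFreeRelation K Q hKQ
        ((freeAInfCat Q.toDGQuiver).m
          (.cons t (.single (freeGen Q.toDGQuiver ⟨A.one y, hKQ _ _ _ (K.one_mem y)⟩))) k -
            ((k.negOnePow : ℤ) : R) • t)
  | one {x y z : A.Ob} (p : Chain (freeAInfCat Q.toDGQuiver).Hom x y)
      (q : Chain (freeAInfCat Q.toDGQuiver).Hom y z) (k : ℤ) (h : 2 ≤ p.length + q.length) :
      RelFreeRelation K Q hKQ
        ((freeAInfCat Q.toDGQuiver).m
          (p.append (.cons (freeGen Q.toDGQuiver ⟨A.one y, hKQ _ _ _ (K.one_mem y)⟩) q)) k)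

/-- The evaluation `freeAInfCat Q → A` for a DG subquiver `Q` of `|A|`. -/
def evaluation (Q : DGSubquiver A.toDGQuiver) :
    StrictFunctor (freeAInfCat Q.toDGQuiver) A.toAInfCat :=
  freeLift Q.incl

/-- `f` is the unit of some object. -/
inductive SUAInfCat.IsUnitMorphism (A : SUAInfCat R) :
    ∀ {x y : A.Ob} {k : ℤ}, A.Hom x y k → Prop
  | one (x : A.Ob) : A.IsUnitMorphism (A.one x)

/-- The data exhibiting `A` as semi-free over its discrete category: a filtration
`A₀ ⊆ Q₀ ⊆ A₁ ⊆ Q₁ ⊆ A₂ ⊆ ⋯ ⊆ A` by A∞-subcategories and DG subquivers. -/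
structure SemiFreeFiltration (A : SUAInfCat R) where
  sub : ℕ → AInfSubcategory A
  quiv : ℕ → DGSubquiver A.toDGQuiver
  sub_le_quiv : ∀ n x y k, (sub n).carrier x y k ≤ (quiv n).carrier x y k
  quiv_le_sub : ∀ n x y k, (quiv n).carrier x y k ≤ (sub (n + 1)).carrier x y k
  /-- `A` is the union. -/
  exhaust : ∀ {x y : A.Ob} {k : ℤ} (f : A.Hom x y k), ∃ n, f ∈ (sub n).carrier x y k
  /-- The discrete category maps isomorphically onto `A₀`: the hom-spaces of `A₀` are spanned by
  the units, and the submodules `R · 1ₓ` are free of rank one. -/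
  sub_zero : ∀ x y k, (sub 0).carrier x y k = Submodule.span R {f | A.IsUnitMorphism f}
  one_free : ∀ (x : A.Ob) (r : R), r • A.one x = 0 → r = 0
  /-- As a graded quiver, `Qₙ` is the sum of `Aₙ` and a graded quiver `Bₙ`. -/
  complement : ∀ n x y k, ∃ B : Submodule R (A.Hom x y k),
    Disjoint ((sub n).carrier x y k) B ∧ (sub n).carrier x y k ⊔ B = (quiv n).carrier x y k
  /-- The quotient `Qₙ / Aₙ` has free hom-spaces and zero differential. -/
  quotient_free : ∀ n x y k, Module.Free R
    ((quiv n).carrier x y k ⧸ ((sub n).carrier x y k).submoduleOf ((quiv n).carrier x y k))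
  quotient_d : ∀ n {x y : A.Ob} (i j : ℤ) (f : A.Hom x y i), f ∈ (quiv n).carrier x y i →
    A.d x y i j f ∈ (sub n).carrier x y j
  /-- `Aₙ₊₁` is the quotient of the free A∞-category on `Qₙ` by the ideal of the relations:
  evaluation in `A` has image `Aₙ₊₁` and kernel that ideal. -/
  range_evaluation : ∀ n (x y : A.Ob) (k : ℤ),
    LinearMap.range ((evaluation (quiv n)).map (x := x) (y := y) (k := k)) =
      (sub (n + 1)).carrier x y k
  ker_evaluation : ∀ n (x y : A.Ob) (k : ℤ),
    LinearMap.ker ((evaluation (quiv n)).map (x := x) (y := y) (k := k)) =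
      (freeAInfCat (quiv n).toDGQuiver).idealGeneratedBy
        (RelFreeRelation (sub n) (quiv n) (sub_le_quiv n)) x y k

/-- `A` is semi-free. -/
def SUAInfCat.IsSemiFree (A : SUAInfCat R) : Prop := Nonempty (SemiFreeFiltration A)

end Sub

-- The resolution kills all cycles at once. Its morphisms are expressions in the units and in
-- generators `gen c f`, one for every closed expression `c` and every `f` in `A` with `m¹ f` equal
-- to the value of `c`; the boundary of `gen c f` is declared to be `c` and its image in `A` is `f`.
-- Only the axioms of a strictly unital A∞-category and the equations `m¹ (gen c f) = c` are imposed
-- (`sfObj`). The projection is then a surjective quasi-equivalence almost by construction: a cycle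
-- `c` whose value is a boundary `m¹ f` is the boundary of `gen c f`, a cycle `f` of `A` is the
-- image of the cycle `gen 0 f`, and an arbitrary `f` is the image of `gen (gen 0 (m¹ f)) f`.
-- Nothing is chosen, so a strict functor `F` acts on expressions by `f ↦ F f`, and functoriality
-- and naturality follow by structural induction.
--
-- The filtration is by the depth of nesting of generators (`Raw.level`). The boundary of a
-- generator of level `n + 1` has level `n`, so the differential vanishes on the quotients. What
-- needs an argument is that no unexpected relations occur: (a) the generators of level `n + 1` are
-- linearly independent modulo level `≤ n` (`genVec_independent`); (b) the kernel of the evaluation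
-- of the free category on the `n`-th quiver is no larger than the ideal of the prescribed relations
-- (`ker_evaluation_sfQuiv`).
--
-- No normal form for expressions is used; both are detected by functors out of the resolution. By
-- `sfObj.lift`, such a functor to `C` amounts to a value for each generator `gen c f` whose
-- boundary is the value of `c`. Homology classes of `C` may obstruct this, so `C` is replaced by
-- `C.eps`, that is `C ⊗ R[ε]` with `m¹ ε = 1`: it contains `C` as a subcategory, and a closed `a +
-- ε a'` is the boundary of `ε a` (`SUAInfCat.d_epsContraction`). Hence values always exist and may
-- be altered by any closed morphism. The A∞-equations for `C.eps` are checked in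
-- `Chain.ainfSum_epsOp`.
--
-- For (a), `C` is the category of Laurent polynomials in a variable of degree one: it has zero
-- differential and a copy of `R` in every degree, so the value of one chosen generator can be
-- shifted by a closed element `1`. The difference of the shifted and the unshifted functor vanishes
-- on level `≤ n` and reads off the coefficient of the chosen generator. For (b), `C` is the
-- quotient of the free category by the ideal (`sfStep`). Generators in the `n`-th quiver go to
-- their classes, all others to contractions. Evaluation followed by this functor is the quotient
-- map followed by the injection of `C` into `C.eps`; so whatever evaluates to zero lies in the
-- ideal.

/-! ### Signs and chains -/

/-- The sign `(-1)ⁿ` as an element of `R`. -/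
def koszulSign (R : Type u) [CommRing R] (n : ℤ) : R := ((n.negOnePow : ℤ) : R)

section KoszulSign

variable {R : Type u} [CommRing R]

theorem koszulSign_zero : koszulSign R 0 = 1 := by simp [koszulSign]

theorem koszulSign_add (m n : ℤ) : koszulSign R (m + n) = koszulSign R m * koszulSign R n := by
  simp [koszulSign, Int.negOnePow_add]

theorem koszulSign_add_one (n : ℤ) : koszulSign R (n + 1) = -koszulSign R n := by
  simp [koszulSign, Int.negOnePow_succ]

theorem koszulSign_sub_one (n : ℤ) : koszulSign R (n - 1) = -koszulSign R n := by
  have h := koszulSign_add_one (R := R) (n - 1)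
  rw [sub_add_cancel] at h
  rw [h, neg_neg]

theorem koszulSign_mul_self (n : ℤ) : koszulSign R n * koszulSign R n = 1 := by
  rw [← koszulSign_add]
  simp [koszulSign, Int.negOnePow_even _ (Even.add_self n)]

end KoszulSign

namespace Chain

variable {O : Type u} {H : O → O → ℤ → Type u}

/-- Every morphism of the chain satisfies `P`. -/
def All (P : ∀ {x y : O} {k : ℤ}, H x y k → Prop) : ∀ {x y : O}, Chain H x y → Prop
  | _, _, nil _ => True
  | _, _, cons f p => P f ∧ p.All P

theorem length_nonneg {x y : O} (p : Chain H x y) : 0 ≤ p.length := by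
  induction p with
  | nil => exact le_refl _
  | cons f p ih => simp only [length]; omega

theorem length_append {x y z : O} (p : Chain H x y) (q : Chain H y z) :
    (p.append q).length = p.length + q.length := by
  induction p with
  | nil => simp [append, length]
  | cons f p ih => simp only [append, length, ih]; ring

theorem append_assoc {w x y z : O} (p : Chain H w x) (q : Chain H x y) (r : Chain H y z) :
    (p.append q).append r = p.append (q.append r) := by
  induction p with
  | nil => rfl
  | cons f p ih => simp only [append, ih]

theorem All.imp {P Q : ∀ {x y : O} {k : ℤ}, H x y k → Prop}
    (h : ∀ {x y : O} {k : ℤ} (f : H x y k), P f → Q f) {x y : O} {p : Chain H x y}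
    (hp : p.All P) : p.All Q := by
  induction p with
  | nil => trivial
  | cons f p ih => exact ⟨h f hp.1, ih hp.2⟩

theorem All.of_forall {P : ∀ {x y : O} {k : ℤ}, H x y k → Prop}
    (h : ∀ {x y : O} {k : ℤ} (f : H x y k), P f) {x y : O} (p : Chain H x y) : p.All P := by
  induction p with
  | nil => trivial
  | cons f p ih => exact ⟨h f, ih⟩

theorem All.and {P Q : ∀ {x y : O} {k : ℤ}, H x y k → Prop} {x y : O} {p : Chain H x y}
    (hp : p.All P) (hq : p.All Q) : p.All (fun f => P f ∧ Q f) := by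
  induction p with
  | nil => trivial
  | cons f p ih => exact ⟨⟨hp.1, hq.1⟩, ih hp.2 hq.2⟩

theorem All.map {O' : Type u} {H' : O' → O' → ℤ → Type u}
    {P : ∀ {x y : O} {k : ℤ}, H x y k → Prop} {Q : ∀ {x y : O'} {k : ℤ}, H' x y k → Prop}
    (F : O → O') (φ : ∀ {x y : O} {k : ℤ}, H x y k → H' (F x) (F y) k)
    (h : ∀ {x y : O} {k : ℤ} (f : H x y k), P f → Q (φ f)) {x y : O} {p : Chain H x y}
    (hp : p.All P) : (p.map F φ).All Q := by
  induction p with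
  | nil => trivial
  | cons f p ih => exact ⟨h f hp.1, ih hp.2⟩

theorem map_congr {O' : Type u} {H' : O' → O' → ℤ → Type u} (F : O → O')
    (φ ψ : ∀ {x y : O} {k : ℤ}, H x y k → H' (F x) (F y) k) {x y : O} {p : Chain H x y}
    (hp : p.All (fun f => φ f = ψ f)) : p.map F φ = p.map F ψ := by
  induction p with
  | nil => rfl
  | cons f p ih => simp only [map, hp.1, ih hp.2]

/-- The morphisms of a chain, with proofs that they satisfy `P`. -/
def attach {P : ∀ {x y : O} {k : ℤ}, H x y k → Prop} :
    ∀ {x y : O} (p : Chain H x y), p.All P → Chain (fun x y k => {f : H x y k // P f}) x y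
  | _, _, nil x, _ => nil x
  | _, _, cons f p, h => cons ⟨f, h.1⟩ (p.attach h.2)

theorem attach_map_val {P : ∀ {x y : O} {k : ℤ}, H x y k → Prop} {x y : O} (p : Chain H x y)
    (h : p.All P) : (p.attach h).map (fun x => x) (fun f => f.1) = p := by
  induction p with
  | nil => rfl
  | cons f p ih => simp only [attach, map, ih]

end Chain

/-! ### Strictly unital A∞-categories given by expressions and relations -/

/-- Expressions, closed under the operations of a strictly unital A∞-category, with a congruence
that contains all the axioms. -/
structure AInfPresentation (R : Type u) [CommRing R] where
  Ob : Type u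
  T : Ob → Ob → ℤ → Type u
  [zero : ∀ x y k, Zero (T x y k)]
  [add : ∀ x y k, Add (T x y k)]
  [smul : ∀ x y k, SMul R (T x y k)]
  op : ∀ {x y : Ob}, Chain T x y → ∀ k : ℤ, T x y k
  one : ∀ x : Ob, T x x 0
  rel : ∀ {x y : Ob} {k : ℤ}, T x y k → T x y k → Prop
  refl : ∀ {x y : Ob} {k : ℤ} (s : T x y k), rel s s
  symm : ∀ {x y : Ob} {k : ℤ} {s t : T x y k}, rel s t → rel t s
  trans : ∀ {x y : Ob} {k : ℤ} {s t v : T x y k}, rel s t → rel t v → rel s v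
  add_congr : ∀ {x y : Ob} {k : ℤ} {s s' t t' : T x y k}, rel s s' → rel t t' →
    rel (s + t) (s' + t')
  smul_congr : ∀ {x y : Ob} {k : ℤ} (r : R) {s t : T x y k}, rel s t → rel (r • s) (r • t)
  op_congr : ∀ {w x y z : Ob} {j : ℤ} (p : Chain T w x) {s t : T x y j} (q : Chain T y z) (k : ℤ),
    rel s t → rel (op (p.append (.cons s q)) k) (op (p.append (.cons t q)) k)
  add_assoc : ∀ {x y : Ob} {k : ℤ} (s t v : T x y k), rel (s + t + v) (s + (t + v))
  add_comm : ∀ {x y : Ob} {k : ℤ} (s t : T x y k), rel (s + t) (t + s)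
  zero_add : ∀ {x y : Ob} {k : ℤ} (s : T x y k), rel (0 + s) s
  zero_smul : ∀ {x y : Ob} {k : ℤ} (s : T x y k), rel ((0 : R) • s) 0
  one_smul : ∀ {x y : Ob} {k : ℤ} (s : T x y k), rel ((1 : R) • s) s
  mul_smul : ∀ {x y : Ob} {k : ℤ} (a b : R) (s : T x y k), rel ((a * b) • s) (a • b • s)
  add_smul : ∀ {x y : Ob} {k : ℤ} (a b : R) (s : T x y k), rel ((a + b) • s) (a • s + b • s)
  smul_add : ∀ {x y : Ob} {k : ℤ} (a : R) (s t : T x y k), rel (a • (s + t)) (a • s + a • t)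
  op_nil : ∀ (x : Ob) (k : ℤ), rel (op (.nil x) k) 0
  op_deg : ∀ {x y : Ob} (p : Chain T x y) (k : ℤ), k ≠ p.deg + 2 - p.length → rel (op p k) 0
  op_add : ∀ {w x y z : Ob} {j : ℤ} (p : Chain T w x) (s t : T x y j) (q : Chain T y z) (k : ℤ),
    rel (op (p.append (.cons (s + t) q)) k)
      (op (p.append (.cons s q)) k + op (p.append (.cons t q)) k)
  op_smul : ∀ {w x y z : Ob} {j : ℤ} (p : Chain T w x) (r : R) (s : T x y j) (q : Chain T y z)
    (k : ℤ), rel (op (p.append (.cons (r • s) q)) k) (r • op (p.append (.cons s q)) k)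
  ainf : ∀ {x y : Ob} (p : Chain T x y) (k : ℤ), rel (ainfSum (R := R) (H := T) op p k) 0
  one_closed : ∀ (x : Ob) (k : ℤ), rel (op (.single (one x)) k) 0
  one_right : ∀ {x y : Ob} {k : ℤ} (f : T x y k), rel (op (.cons (one x) (.single f)) k) f
  one_left : ∀ {x y : Ob} {k : ℤ} (f : T x y k),
    rel (op (.cons f (.single (one y))) k) (((k.negOnePow : ℤ) : R) • f)
  op_one : ∀ {x y z : Ob} (p : Chain T x y) (q : Chain T y z) (k : ℤ),
    2 ≤ p.length + q.length → rel (op (p.append (.cons (one y) q)) k) 0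

namespace AInfPresentation

attribute [instance] zero add smul

variable {R : Type u} [CommRing R] (P : AInfPresentation R)

/-- The congruence as a setoid. -/
def setoid (x y : P.Ob) (k : ℤ) : Setoid (P.T x y k) where
  r := P.rel
  iseqv := ⟨P.refl, P.symm, P.trans⟩

/-- Classes of expressions. -/
def QHom (x y : P.Ob) (k : ℤ) : Type u := Quotient (P.setoid x y k)

namespace QHom

variable {P}

/-- The class of an expression. -/
def mk {x y : P.Ob} {k : ℤ} (t : P.T x y k) : P.QHom x y k := Quotient.mk (P.setoid x y k) t

/-- A representative. -/
noncomputable def out {x y : P.Ob} {k : ℤ} (f : P.QHom x y k) : P.T x y k := Quotient.out f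

theorem mk_out {x y : P.Ob} {k : ℤ} (f : P.QHom x y k) : mk f.out = f := Quotient.out_eq _

theorem sound {x y : P.Ob} {k : ℤ} {s t : P.T x y k} (h : P.rel s t) : mk s = mk t :=
  Quotient.sound (s := P.setoid x y k) h

theorem exact {x y : P.Ob} {k : ℤ} {s t : P.T x y k} (h : mk s = mk t) : P.rel s t :=
  Quotient.exact (s := P.setoid x y k) h

theorem ind {x y : P.Ob} {k : ℤ} {C : P.QHom x y k → Prop} (h : ∀ t, C (mk t)) (f) : C f :=
  Quotient.ind (s := P.setoid x y k) h f

instance (x y : P.Ob) (k : ℤ) : Zero (P.QHom x y k) := ⟨mk 0⟩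

instance (x y : P.Ob) (k : ℤ) : Add (P.QHom x y k) :=
  ⟨Quotient.map₂ (· + ·) fun _ _ h _ _ h' => P.add_congr h h'⟩

instance (x y : P.Ob) (k : ℤ) : SMul R (P.QHom x y k) :=
  ⟨fun r => Quotient.map (r • ·) fun _ _ h => P.smul_congr r h⟩

theorem mk_zero {x y : P.Ob} {k : ℤ} : mk (0 : P.T x y k) = 0 := rfl
theorem mk_add {x y : P.Ob} {k : ℤ} (s t : P.T x y k) : mk (s + t) = mk s + mk t := rfl
theorem mk_smul {x y : P.Ob} {k : ℤ} (r : R) (t : P.T x y k) : mk (r • t) = r • mk t := rfl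

theorem add_comm' {x y : P.Ob} {k : ℤ} (f g : P.QHom x y k) : f + g = g + f := by
  induction f using ind with | _ s =>
  induction g using ind with | _ t => exact sound (P.add_comm s t)

theorem zero_add' {x y : P.Ob} {k : ℤ} (f : P.QHom x y k) : 0 + f = f := by
  induction f using ind with | _ s => exact sound (P.zero_add s)

theorem add_assoc' {x y : P.Ob} {k : ℤ} (f g h : P.QHom x y k) : f + g + h = f + (g + h) := by
  induction f using ind with | _ s =>
  induction g using ind with | _ t =>
  induction h using ind with | _ v => exact sound (P.add_assoc s t v)

theorem zero_smul' {x y : P.Ob} {k : ℤ} (f : P.QHom x y k) : (0 : R) • f = 0 := by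
  induction f using ind with | _ s => exact sound (P.zero_smul s)

theorem one_smul' {x y : P.Ob} {k : ℤ} (f : P.QHom x y k) : (1 : R) • f = f := by
  induction f using ind with | _ s => exact sound (P.one_smul s)

theorem add_smul' {x y : P.Ob} {k : ℤ} (a b : R) (f : P.QHom x y k) :
    (a + b) • f = a • f + b • f := by
  induction f using ind with | _ s => exact sound (P.add_smul a b s)

theorem mul_smul' {x y : P.Ob} {k : ℤ} (a b : R) (f : P.QHom x y k) :
    (a * b) • f = a • b • f := by
  induction f using ind with | _ s => exact sound (P.mul_smul a b s)

theorem smul_add' {x y : P.Ob} {k : ℤ} (a : R) (f g : P.QHom x y k) :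
    a • (f + g) = a • f + a • g := by
  induction f using ind with | _ s =>
  induction g using ind with | _ t => exact sound (P.smul_add a s t)

instance (x y : P.Ob) (k : ℤ) : Neg (P.QHom x y k) := ⟨fun f => (-1 : R) • f⟩

instance (x y : P.Ob) (k : ℤ) : AddCommGroup (P.QHom x y k) where
  add_assoc := add_assoc'
  zero_add := zero_add'
  add_zero f := by rw [add_comm', zero_add']
  add_comm := add_comm'
  nsmul := nsmulRec
  zsmul := zsmulRec
  neg_add_cancel f := by
    change (-1 : R) • f + f = 0
    conv_lhs => rw [← one_smul' f, ← mul_smul', ← add_smul']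
    simpa using zero_smul' f

instance (x y : P.Ob) (k : ℤ) : Module R (P.QHom x y k) where
  one_smul := one_smul'
  mul_smul := mul_smul'
  smul_add := smul_add'
  smul_zero a := by
    have h := mul_smul' a 0 (0 : P.QHom x y k)
    rwa [mul_zero, zero_smul', eq_comm] at h
  add_smul := add_smul'
  zero_smul := zero_smul'

/-- The operations on classes. -/
noncomputable def m {x y : P.Ob} (p : Chain P.QHom x y) (k : ℤ) : P.QHom x y k :=
  mk (P.op (p.map (fun x => x) (fun f => f.out)) k)

/-- The congruence axiom changes one argument at a time. The prefix `a` collects the arguments that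
have already been changed back, which makes the induction go through. -/
theorem op_congr_chain {w x y : P.Ob} (a : Chain P.T w x) (p : Chain P.T x y) (k : ℤ) :
    P.rel (P.op (a.append (p.map (fun x => x) (fun t => (mk t).out))) k)
      (P.op (a.append p) k) := by
  induction p with
  | nil => exact P.refl _
  | cons f p ih =>
    simp only [Chain.map]
    refine P.trans (P.op_congr a _ k (exact (mk_out (mk f)))) ?_
    have h := ih (a.append (.single f))
    rwa [Chain.append_assoc, Chain.append_assoc] at h

theorem m_mk {x y : P.Ob} (p : Chain P.T x y) (k : ℤ) :
    m (p.map (fun x => x) (fun t => mk t)) k = mk (P.op p k) := by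
  have h := Chain.map_map (fun x => x) (fun t : P.T _ _ _ => mk t) (fun x => x)
    (fun f : P.QHom _ _ _ => f.out) p
  exact (congrArg (fun c => mk (P.op c k)) h).trans (sound (op_congr_chain (.nil x) p k))

theorem exists_chain {x y : P.Ob} (p : Chain P.QHom x y) :
    ∃ q : Chain P.T x y, q.map (fun x => x) (fun t => mk t) = p := by
  refine ⟨p.map (fun x => x) (fun f => f.out), ?_⟩
  refine (Chain.map_map (fun x => x) (fun f : P.QHom _ _ _ => f.out) (fun x => x)
    (fun t : P.T _ _ _ => mk t) p).trans ?_
  simp only [mk_out]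
  exact Chain.map_id p

end QHom

open QHom in
/-- The strictly unital A∞-category of classes of expressions. -/
noncomputable abbrev toSUAInfCat : SUAInfCat R where
  Ob := P.Ob
  Hom := P.QHom
  m := QHom.m
  m_nil x k := sound (P.op_nil x k)
  m_deg p k h := by
    obtain ⟨p, rfl⟩ := exists_chain p
    rw [Chain.deg_map, Chain.length_map] at h
    rw [m_mk]
    exact sound (P.op_deg p k h)
  m_add p j f g q k := by
    obtain ⟨p, rfl⟩ := exists_chain p
    obtain ⟨q, rfl⟩ := exists_chain q
    induction f using QHom.ind with | _ s =>
    induction g using QHom.ind with | _ t =>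
    have h := sound (P.op_add p s t q k)
    simpa only [mk_add, ← m_mk, Chain.map_append, Chain.map] using h
  m_smul p j r f q k := by
    obtain ⟨p, rfl⟩ := exists_chain p
    obtain ⟨q, rfl⟩ := exists_chain q
    induction f using QHom.ind with | _ s =>
    have h := sound (P.op_smul p r s q k)
    simpa only [mk_smul, ← m_mk, Chain.map_append, Chain.map] using h
  ainf p k := by
    obtain ⟨p, rfl⟩ := exists_chain p
    rw [← mk_zero, ← sound (P.ainf p k)]
    exact (ainfSum_map (R := R) (H := P.T) (H' := P.QHom) P.op QHom.m
      (fun x => x) (fun t => QHom.mk t) mk_zero mk_add mk_smul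
      (fun p k => (m_mk p k).symm) p k).symm
  one x := QHom.mk (P.one x)
  one_closed x k := (m_mk (.single (P.one x)) k).trans (sound (P.one_closed x k))
  m_one_right {x y k} f := by
    induction f using QHom.ind with | _ s =>
    exact (m_mk (.cons (P.one x) (.single s)) k).trans (sound (P.one_right s))
  m_one_left {x y k} f := by
    induction f using QHom.ind with | _ s =>
    exact (m_mk (.cons s (.single (P.one y))) k).trans (sound (P.one_left s))
  m_one {x y z} p q k h := by
    obtain ⟨p, rfl⟩ := exists_chain p
    obtain ⟨q, rfl⟩ := exists_chain q
    rw [Chain.length_map, Chain.length_map] at h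
    have h' := (m_mk (p.append (.cons (P.one y) q)) k).trans (sound (P.op_one p q k h))
    rwa [Chain.map_append] at h'

end AInfPresentation

/-! ### Expressions for the semi-free resolution -/

section Raw

variable {R : Type u} [CommRing R]

/-- Formal expressions in units and generators `gen c f`, where `c` is itself an expression, the
intended boundary of the generator, and `f` is its intended image in `A`. -/
inductive Raw (A : SUAInfCat R) : A.Ob → A.Ob → ℤ → Type u
  | one (x : A.Ob) : Raw A x x 0
  | gen {x y : A.Ob} {k : ℤ} (c : Raw A x y (k + 1)) (f : A.Hom x y k) : Raw A x y k
  | zero {x y : A.Ob} {k : ℤ} : Raw A x y k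
  | add {x y : A.Ob} {k : ℤ} (s t : Raw A x y k) : Raw A x y k
  | smul {x y : A.Ob} {k : ℤ} (r : R) (t : Raw A x y k) : Raw A x y k
  | op {x y : A.Ob} (p : Chain (Raw A) x y) (k : ℤ) : Raw A x y k

namespace Raw

variable {A B C : SUAInfCat R}

instance (x y : A.Ob) (k : ℤ) : Zero (Raw A x y k) := ⟨zero⟩
instance (x y : A.Ob) (k : ℤ) : Add (Raw A x y k) := ⟨add⟩
instance (x y : A.Ob) (k : ℤ) : SMul R (Raw A x y k) := ⟨smul⟩

-- Structural induction on expressions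

section Induction

set_option linter.unusedSectionVars false

variable {P : ∀ {x y : A.Ob} {k : ℤ}, Raw A x y k → Prop}
  (one : ∀ x, P (one x))
  (gen : ∀ {x y : A.Ob} {k : ℤ} (c : Raw A x y (k + 1)) (f : A.Hom x y k), P c → P (gen c f))
  (zero : ∀ {x y : A.Ob} {k : ℤ}, P (0 : Raw A x y k))
  (add : ∀ {x y : A.Ob} {k : ℤ} (s t : Raw A x y k), P s → P t → P (s + t))
  (smul : ∀ {x y : A.Ob} {k : ℤ} (r : R) (t : Raw A x y k), P t → P (r • t))
  (op : ∀ {x y : A.Ob} (p : Chain (Raw A) x y) (k : ℤ), p.All P → P (op p k))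

include one gen zero add smul op

mutual

/-- Structural induction on expressions. -/
theorem induct : ∀ {x y : A.Ob} {k : ℤ} (t : Raw A x y k), P t
  | _, _, _, .one x => one x
  | _, _, _, .gen c f => gen c f (induct c)
  | _, _, _, .zero => zero
  | _, _, _, .add s t => add s t (induct s) (induct t)
  | _, _, _, .smul r t => smul r t (induct t)
  | _, _, _, .op p k => op p k (inductChain p)

/-- Structural induction on the members of a chain of expressions. -/
theorem inductChain : ∀ {x y : A.Ob} (p : Chain (Raw A) x y), p.All P
  | _, _, .nil _ => trivial
  | _, _, .cons t p => ⟨induct t, inductChain p⟩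

end

end Induction

-- Recursion on expressions and their values in a strictly unital A∞-category

section Fold

variable {O : Type u} {T : O → O → ℤ → Type u} [∀ x y k, Zero (T x y k)] [∀ x y k, Add (T x y k)]
  [∀ x y k, SMul R (T x y k)] (m : ∀ {x y : O}, Chain T x y → ∀ k : ℤ, T x y k)
  (e : ∀ x : O, T x x 0) (obj : A.Ob → O)
  (γ : ∀ {x y : A.Ob} {k : ℤ}, Raw A x y (k + 1) → A.Hom x y k → T (obj x) (obj y) (k + 1) →
    T (obj x) (obj y) k)

mutual

/-- The value of an expression, when values `γ c f v` are given for the generators `gen c f`,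
which may depend on the value `v` of `c`. -/
def fold : ∀ {x y : A.Ob} {k : ℤ}, Raw A x y k → T (obj x) (obj y) k
  | _, _, _, .one x => e (obj x)
  | _, _, _, .gen c f => γ c f (fold c)
  | _, _, _, .zero => 0
  | _, _, _, .add s t => fold s + fold t
  | _, _, _, .smul r t => r • fold t
  | _, _, _, .op p k => m (foldChain p) k

/-- The values of a chain of expressions. -/
def foldChain : ∀ {x y : A.Ob}, Chain (Raw A) x y → Chain T (obj x) (obj y)
  | _, _, .nil x => .nil (obj x)
  | _, _, .cons t p => .cons (fold t) (foldChain p)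

end

theorem foldChain_eq {x y : A.Ob} (p : Chain (Raw A) x y) :
    foldChain m e obj γ p = p.map obj (fun t => fold m e obj γ t) := by
  induction p with
  | nil => rw [foldChain, Chain.map]
  | cons t p ih => rw [foldChain, Chain.map, ih]

theorem fold_one (x : A.Ob) : fold m e obj γ (.one x) = e (obj x) := by rw [fold]

theorem fold_gen {x y : A.Ob} {k : ℤ} (c : Raw A x y (k + 1)) (f : A.Hom x y k) :
    fold m e obj γ (.gen c f) = γ c f (fold m e obj γ c) := by rw [fold]

theorem fold_zero {x y : A.Ob} {k : ℤ} : fold m e obj γ (0 : Raw A x y k) = 0 := by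
  change fold m e obj γ .zero = 0
  rw [fold]

theorem fold_add {x y : A.Ob} {k : ℤ} (s t : Raw A x y k) :
    fold m e obj γ (s + t) = fold m e obj γ s + fold m e obj γ t := by
  change fold m e obj γ (.add s t) = _
  rw [fold]

theorem fold_smul {x y : A.Ob} {k : ℤ} (r : R) (t : Raw A x y k) :
    fold m e obj γ (r • t) = r • fold m e obj γ t := by
  change fold m e obj γ (.smul r t) = _
  rw [fold]

theorem fold_op {x y : A.Ob} (p : Chain (Raw A) x y) (k : ℤ) :
    fold m e obj γ (.op p k) = m (p.map obj (fun t => fold m e obj γ t)) k := by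
  rw [fold, foldChain_eq]

end Fold

section Eval

variable (obj : A.Ob → C.Ob)
  (γ : ∀ {x y : A.Ob} {k : ℤ}, Raw A x y (k + 1) → A.Hom x y k →
    C.Hom (obj x) (obj y) (k + 1) → C.Hom (obj x) (obj y) k)

/-- The value of an expression in a strictly unital A∞-category `C`. -/
def eval {x y : A.Ob} {k : ℤ} (t : Raw A x y k) : C.Hom (obj x) (obj y) k :=
  fold (T := C.Hom) C.m C.one obj γ t

theorem eval_one (x : A.Ob) : eval obj γ (.one x) = C.one (obj x) := fold_one _ _ _ _ _

theorem eval_gen {x y : A.Ob} {k : ℤ} (c : Raw A x y (k + 1)) (f : A.Hom x y k) :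
    eval obj γ (.gen c f) = γ c f (eval obj γ c) := fold_gen _ _ _ _ _ _

theorem eval_zero {x y : A.Ob} {k : ℤ} : eval obj γ (0 : Raw A x y k) = 0 := fold_zero _ _ _ _

theorem eval_add {x y : A.Ob} {k : ℤ} (s t : Raw A x y k) :
    eval obj γ (s + t) = eval obj γ s + eval obj γ t := fold_add _ _ _ _ _ _

theorem eval_smul {x y : A.Ob} {k : ℤ} (r : R) (t : Raw A x y k) :
    eval obj γ (r • t) = r • eval obj γ t := fold_smul _ _ _ _ _ _

theorem eval_op {x y : A.Ob} (p : Chain (Raw A) x y) (k : ℤ) :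
    eval obj γ (.op p k) = C.m (p.map obj (fun t => eval obj γ t)) k := fold_op _ _ _ _ _ _

end Eval

/-- The value of an expression in `A`. -/
def value {x y : A.Ob} {k : ℤ} (t : Raw A x y k) : A.Hom x y k :=
  eval (fun x => x) (fun _ f _ => f) t

/-- The congruence on expressions generated by the axioms of a strictly unital A∞-category and by
`m¹ (gen c f) = c`, whenever `m¹ c = 0` and the value of `c` is `m¹ f`. -/
inductive Rel : ∀ {x y : A.Ob} {k : ℤ}, Raw A x y k → Raw A x y k → Prop
  | refl {x y k} (s : Raw A x y k) : Rel s s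
  | symm {x y k} {s t : Raw A x y k} : Rel s t → Rel t s
  | trans {x y k} {s t v : Raw A x y k} : Rel s t → Rel t v → Rel s v
  | add_congr {x y k} {s s' t t' : Raw A x y k} : Rel s s' → Rel t t' → Rel (s + t) (s' + t')
  | smul_congr {x y k} (r : R) {s t : Raw A x y k} : Rel s t → Rel (r • s) (r • t)
  | op_congr {w x y z : A.Ob} {j : ℤ} (p : Chain (Raw A) w x) {s t : Raw A x y j}
      (q : Chain (Raw A) y z) (k : ℤ) : Rel s t →
      Rel (op (p.append (.cons s q)) k) (op (p.append (.cons t q)) k)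
  | add_assoc {x y k} (s t v : Raw A x y k) : Rel (s + t + v) (s + (t + v))
  | add_comm {x y k} (s t : Raw A x y k) : Rel (s + t) (t + s)
  | zero_add {x y k} (s : Raw A x y k) : Rel (0 + s) s
  | zero_smul {x y k} (s : Raw A x y k) : Rel ((0 : R) • s) 0
  | one_smul {x y k} (s : Raw A x y k) : Rel ((1 : R) • s) s
  | mul_smul {x y k} (a b : R) (s : Raw A x y k) : Rel ((a * b) • s) (a • b • s)
  | add_smul {x y k} (a b : R) (s : Raw A x y k) : Rel ((a + b) • s) (a • s + b • s)
  | smul_add {x y k} (a : R) (s t : Raw A x y k) : Rel (a • (s + t)) (a • s + a • t)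
  | op_nil (x : A.Ob) (k : ℤ) : Rel (op (.nil x) k) 0
  | op_deg {x y} (p : Chain (Raw A) x y) (k : ℤ) : k ≠ p.deg + 2 - p.length → Rel (op p k) 0
  | op_add {w x y z : A.Ob} {j : ℤ} (p : Chain (Raw A) w x) (s t : Raw A x y j)
      (q : Chain (Raw A) y z) (k : ℤ) : Rel (op (p.append (.cons (s + t) q)) k)
        (op (p.append (.cons s q)) k + op (p.append (.cons t q)) k)
  | op_smul {w x y z : A.Ob} {j : ℤ} (p : Chain (Raw A) w x) (r : R) (s : Raw A x y j)
      (q : Chain (Raw A) y z) (k : ℤ) : Rel (op (p.append (.cons (r • s) q)) k)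
        (r • op (p.append (.cons s q)) k)
  | ainf {x y} (p : Chain (Raw A) x y) (k : ℤ) :
      Rel (ainfSum (R := R) (H := Raw A) op p k) 0
  | one_closed (x : A.Ob) (k : ℤ) : Rel (op (.single (one x)) k) 0
  | one_right {x y k} (t : Raw A x y k) : Rel (op (.cons (one x) (.single t)) k) t
  | one_left {x y k} (t : Raw A x y k) :
      Rel (op (.cons t (.single (one y))) k) (((k.negOnePow : ℤ) : R) • t)
  | op_one {x y z : A.Ob} (p : Chain (Raw A) x y) (q : Chain (Raw A) y z) (k : ℤ) :
      2 ≤ p.length + q.length → Rel (op (p.append (.cons (one y) q)) k) 0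
  -- The two premises replace the requirement that the generator be valid: validity refers to the
  -- congruence, so the congruence has to be defined first, on all expressions.
  | gen_d {x y : A.Ob} {k : ℤ} (c : Raw A x y (k + 1)) (f : A.Hom x y k) :
      Rel (op (.single c) (k + 1 + 1)) 0 → c.value = A.d x y k (k + 1) f →
      Rel (op (.single (gen c f)) (k + 1)) c

theorem Rel.of_eq {x y : A.Ob} {k : ℤ} {s t : Raw A x y k} (h : s = t) : Rel s t := h ▸ .refl s

-- Valid expressions and depth of nesting

mutual

/-- All the generators `gen c f` in the expression satisfy `m¹ c = 0` and `value c = m¹ f`. -/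
def Valid : ∀ {x y : A.Ob} {k : ℤ}, Raw A x y k → Prop
  | _, _, _, .one _ => True
  | x, y, k, .gen c f => Valid c ∧ Rel (op (.single c) (k + 1 + 1)) 0 ∧
      c.value = A.d x y k (k + 1) f
  | _, _, _, .zero => True
  | _, _, _, .add s t => Valid s ∧ Valid t
  | _, _, _, .smul _ t => Valid t
  | _, _, _, .op p _ => ValidChain p

/-- All the expressions in the chain are valid. -/
def ValidChain : ∀ {x y : A.Ob}, Chain (Raw A) x y → Prop
  | _, _, .nil _ => True
  | _, _, .cons t p => Valid t ∧ ValidChain p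

end

mutual

/-- The depth of nesting of generators. -/
def level : ∀ {x y : A.Ob} {k : ℤ}, Raw A x y k → ℕ
  | _, _, _, .one _ => 0
  | _, _, _, .gen c _ => level c + 1
  | _, _, _, .zero => 0
  | _, _, _, .add s t => max (level s) (level t)
  | _, _, _, .smul _ t => level t
  | _, _, _, .op p _ => levelChain p

/-- The largest level in a chain of expressions. -/
def levelChain : ∀ {x y : A.Ob}, Chain (Raw A) x y → ℕ
  | _, _, .nil _ => 0
  | _, _, .cons t p => max (level t) (levelChain p)

end

theorem validChain_iff {x y : A.Ob} (p : Chain (Raw A) x y) :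
    ValidChain p ↔ p.All (fun t => t.Valid) := by
  induction p with
  | nil => rw [ValidChain, Chain.All]
  | cons t p ih => rw [ValidChain, Chain.All, ih]

theorem levelChain_le_iff {n : ℕ} {x y : A.Ob} (p : Chain (Raw A) x y) :
    levelChain p ≤ n ↔ p.All (fun t => t.level ≤ n) := by
  induction p with
  | nil => rw [levelChain, Chain.All]; simp
  | cons t p ih => rw [levelChain, Chain.All, ← ih, max_le_iff]

theorem valid_one (x : A.Ob) : (one x : Raw A x x 0).Valid := by rw [Valid]; trivial

theorem valid_zero {x y : A.Ob} {k : ℤ} : (0 : Raw A x y k).Valid := by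
  change Valid .zero
  rw [Valid]; trivial

theorem valid_add_iff {x y : A.Ob} {k : ℤ} {s t : Raw A x y k} :
    (s + t).Valid ↔ s.Valid ∧ t.Valid := by
  change Valid (.add s t) ↔ _
  rw [Valid]

theorem valid_smul_iff {x y : A.Ob} {k : ℤ} {r : R} {t : Raw A x y k} :
    (r • t).Valid ↔ t.Valid := by
  change Valid (.smul r t) ↔ _
  rw [Valid]

theorem valid_op_iff {x y : A.Ob} {k : ℤ} {p : Chain (Raw A) x y} :
    (op p k).Valid ↔ p.All (fun t => t.Valid) := by
  rw [Valid, validChain_iff]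

theorem valid_gen_iff {x y : A.Ob} {k : ℤ} {c : Raw A x y (k + 1)} {f : A.Hom x y k} :
    (gen c f).Valid ↔ c.Valid ∧ Rel (op (.single c) (k + 1 + 1)) 0 ∧
      c.value = A.d x y k (k + 1) f := by
  rw [Valid]

theorem level_one (x : A.Ob) : (one x : Raw A x x 0).level = 0 := by rw [level]

theorem level_zero {x y : A.Ob} {k : ℤ} : (0 : Raw A x y k).level = 0 := by
  change level .zero = 0
  rw [level]

theorem level_add {x y : A.Ob} {k : ℤ} (s t : Raw A x y k) :
    (s + t).level = max s.level t.level := by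
  change level (.add s t) = _
  rw [level]

theorem level_smul {x y : A.Ob} {k : ℤ} (r : R) (t : Raw A x y k) :
    (r • t).level = t.level := by
  change level (.smul r t) = _
  rw [level]

theorem level_op_le_iff {n : ℕ} {x y : A.Ob} {k : ℤ} {p : Chain (Raw A) x y} :
    (op p k).level ≤ n ↔ p.All (fun t => t.level ≤ n) := by
  rw [level, levelChain_le_iff]

theorem level_gen {x y : A.Ob} {k : ℤ} (c : Raw A x y (k + 1)) (f : A.Hom x y k) :
    (gen c f).level = c.level + 1 := by
  rw [level]

section Eval

variable (obj : A.Ob → C.Ob)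
  (γ : ∀ {x y : A.Ob} {k : ℤ}, Raw A x y (k + 1) → A.Hom x y k →
    C.Hom (obj x) (obj y) (k + 1) → C.Hom (obj x) (obj y) k)

/-- Evaluation is compatible with the congruence if the values of the generators have the
right boundaries. -/
theorem eval_rel
    (hγ : ∀ {x y : A.Ob} {k : ℤ} (c : Raw A x y (k + 1)) (f : A.Hom x y k),
      C.d _ _ (k + 1) (k + 1 + 1) (eval obj γ c) = 0 → c.value = A.d x y k (k + 1) f →
      C.d _ _ k (k + 1) (γ c f (eval obj γ c)) = eval obj γ c)
    {x y : A.Ob} {k : ℤ} {s t : Raw A x y k} (h : Rel s t) :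
    eval obj γ s = eval obj γ t := by
  induction h with
  | refl => rfl
  | symm _ ih => exact ih.symm
  | trans _ _ ih ih' => exact ih.trans ih'
  | add_congr _ _ ih ih' => simp only [eval_add, ih, ih']
  | smul_congr r _ ih => simp only [eval_smul, ih]
  | op_congr p q k _ ih => simp only [eval_op, Chain.map_append, Chain.map, ih]
  | add_assoc => simp only [eval_add, _root_.add_assoc]
  | add_comm => simp only [eval_add]; exact _root_.add_comm _ _
  | zero_add => simp only [eval_add, eval_zero, _root_.zero_add]
  | zero_smul => simp only [eval_smul, eval_zero, _root_.zero_smul]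
  | one_smul => simp only [eval_smul, _root_.one_smul]
  | mul_smul => simp only [eval_smul, SemigroupAction.mul_smul]
  | add_smul => simp only [eval_smul, eval_add, _root_.add_smul]
  | smul_add => simp only [eval_smul, eval_add, _root_.smul_add]
  | op_nil x k => rw [eval_op, eval_zero]; exact C.m_nil _ _
  | op_deg p k h =>
    rw [eval_op, eval_zero]
    exact C.m_deg _ _ (by rwa [Chain.deg_map, Chain.length_map])
  | op_add p s t q k =>
    simp only [eval_op, eval_add, Chain.map_append, Chain.map]
    exact C.m_add _ _ _ _ _
  | op_smul p r s q k =>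
    simp only [eval_op, eval_smul, Chain.map_append, Chain.map]
    exact C.m_smul _ _ _ _ _
  | ainf p k =>
    rw [eval_zero]
    exact (ainfSum_map (R := R) (H := Raw A) (H' := C.Hom) Raw.op C.m obj
      (fun t => eval obj γ t) (eval_zero _ _) (eval_add _ _) (eval_smul _ _)
      (eval_op _ _) p k).trans (C.ainf _ k)
  | one_closed x k =>
    simp only [eval_op, eval_zero, Chain.single, Chain.map, eval_one]
    exact C.one_closed _ _
  | one_right t =>
    simp only [eval_op, Chain.single, Chain.map, eval_one]
    exact C.m_one_right _
  | one_left t =>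
    simp only [eval_op, eval_smul, Chain.single, Chain.map, eval_one]
    exact C.m_one_left _
  | op_one p q k h =>
    simp only [eval_op, eval_zero, Chain.map_append, Chain.map, eval_one]
    exact C.m_one _ _ _ (by rwa [Chain.length_map, Chain.length_map])
  -- The induction hypothesis for the premise `m¹ c ∼ 0` says that the value of `c` is closed in
  -- `C`. This is why `hγ` need only treat closed values.
  | gen_d c f _ hv ih =>
    rw [eval_op, eval_zero] at ih
    rw [eval_op]
    simp only [Chain.single, Chain.map, eval_gen] at ih ⊢
    exact hγ c f ih hv

end Eval

/-- A strict functor applied to an expression. -/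
def map (F : SUStrictFunctor A B) {x y : A.Ob} {k : ℤ} (t : Raw A x y k) :
    Raw B (F.obj x) (F.obj y) k :=
  fold (T := Raw B) Raw.op Raw.one F.obj (fun _ f c => .gen c (F.map f)) t

-- Action of strict functors on expressions

section Map

variable (F : SUStrictFunctor A B)

theorem map_one (x : A.Ob) : (one x : Raw A x x 0).map F = one (F.obj x) := fold_one _ _ _ _ _

theorem map_gen {x y : A.Ob} {k : ℤ} (c : Raw A x y (k + 1)) (f : A.Hom x y k) :
    (gen c f).map F = gen (c.map F) (F.map f) := fold_gen _ _ _ _ _ _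

theorem map_zero {x y : A.Ob} {k : ℤ} : (0 : Raw A x y k).map F = 0 := fold_zero _ _ _ _

theorem map_add {x y : A.Ob} {k : ℤ} (s t : Raw A x y k) :
    (s + t).map F = s.map F + t.map F := fold_add _ _ _ _ _ _

theorem map_smul {x y : A.Ob} {k : ℤ} (r : R) (t : Raw A x y k) :
    (r • t).map F = r • t.map F := fold_smul _ _ _ _ _ _

theorem map_op {x y : A.Ob} (p : Chain (Raw A) x y) (k : ℤ) :
    (op p k).map F = op (p.map F.obj (fun t => t.map F)) k := fold_op _ _ _ _ _ _

/-- A strict functor commutes with units, sums and operations, and the value of a generator is its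
label, to which `F` is applied. This is the naturality of the projection; it also shows that `F`
preserves the condition that the value of `c` is `m¹ f`. -/
theorem value_map {x y : A.Ob} {k : ℤ} (t : Raw A x y k) : (t.map F).value = F.map t.value := by
  induction t using induct with
  | one x =>
    rw [map_one, value, value, eval_one, eval_one, F.map_one]
  | gen c f _ => rw [map_gen, value, value, eval_gen, eval_gen]
  | zero => rw [map_zero, value, value, eval_zero, eval_zero, _root_.map_zero]
  | add s t hs ht =>
    rw [map_add]
    simp only [value, eval_add, _root_.map_add] at hs ht ⊢
    rw [hs, ht]
  | smul r t ht =>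
    rw [map_smul]
    simp only [value, eval_smul, _root_.map_smul] at ht ⊢
    rw [ht]
  | op p k hp =>
    rw [map_op]
    simp only [value, eval_op] at hp ⊢
    rw [F.map_m, Chain.map_map (G := fun x => x), Chain.map_map (G := F.obj)
      (ψ := fun f => F.map f)]
    exact congrArg (fun c => B.m c k) (Chain.map_congr _ _ _ hp)

/-- The axioms are formal and so are preserved. Only `gen_d` involves `A` itself, through the value
of `c`, and there `value_map` and the compatibility of `F` with `m¹` give the second premise. -/
theorem map_rel {x y : A.Ob} {k : ℤ} {s t : Raw A x y k} (h : Rel s t) :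
    Rel (s.map F) (t.map F) := by
  induction h with
  | refl => exact .refl _
  | symm _ ih => exact ih.symm
  | trans _ _ ih ih' => exact ih.trans ih'
  | add_congr _ _ ih ih' => simp only [map_add]; exact ih.add_congr ih'
  | smul_congr r _ ih => simp only [map_smul]; exact ih.smul_congr r
  | op_congr p q k _ ih =>
    simp only [map_op, Chain.map_append, Chain.map]; exact .op_congr _ _ _ ih
  | add_assoc => simp only [map_add]; exact .add_assoc _ _ _
  | add_comm => simp only [map_add]; exact .add_comm _ _
  | zero_add => simp only [map_add, map_zero]; exact .zero_add _
  | zero_smul => simp only [map_smul, map_zero]; exact .zero_smul _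
  | one_smul => simp only [map_smul]; exact .one_smul _
  | mul_smul => simp only [map_smul]; exact .mul_smul _ _ _
  | add_smul => simp only [map_smul, map_add]; exact .add_smul _ _ _
  | smul_add => simp only [map_smul, map_add]; exact .smul_add _ _ _
  | op_nil x k => rw [map_op, map_zero]; exact .op_nil _ _
  | op_deg p k h =>
    rw [map_op, map_zero]
    exact .op_deg _ _ (by rwa [Chain.deg_map, Chain.length_map])
  | op_add p s t q k =>
    simp only [map_op, map_add, Chain.map_append, Chain.map]
    exact .op_add _ _ _ _ _
  | op_smul p r s q k =>
    simp only [map_op, map_smul, Chain.map_append, Chain.map]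
    exact .op_smul _ _ _ _ _
  | ainf p k =>
    rw [map_zero]
    have h := ainfSum_map (R := R) (H := Raw A) (H' := Raw B) Raw.op Raw.op F.obj
      (fun t => t.map F) (map_zero F) (map_add F) (map_smul F) (map_op F) p k
    exact h ▸ .ainf _ k
  | one_closed x k =>
    simp only [map_op, map_zero, Chain.single, Chain.map, map_one]
    exact .one_closed _ _
  | one_right t =>
    simp only [map_op, Chain.single, Chain.map, map_one]
    exact .one_right _
  | one_left t =>
    simp only [map_op, map_smul, Chain.single, Chain.map, map_one]
    exact .one_left _
  | op_one p q k h =>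
    simp only [map_op, map_zero, Chain.map_append, Chain.map, map_one]
    exact .op_one _ _ _ (by rwa [Chain.length_map, Chain.length_map])
  | gen_d c f _ hv ih =>
    rw [map_op, map_zero] at ih
    rw [map_op]
    simp only [Chain.single, Chain.map, map_gen] at ih ⊢
    refine .gen_d _ _ ih ?_
    rw [value_map, hv]
    exact F.map_m _ _

theorem map_valid {x y : A.Ob} {k : ℤ} (t : Raw A x y k) : t.Valid → (t.map F).Valid := by
  induction t using induct with
  | one x => intro _; rw [map_one]; exact valid_one _
  | gen c f hc =>
    rw [map_gen, valid_gen_iff, valid_gen_iff]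
    rintro ⟨h1, h2, h3⟩
    refine ⟨hc h1, ?_, ?_⟩
    · have h := map_rel F h2
      rwa [map_op, map_zero] at h
    · rw [value_map, h3]
      exact F.map_m _ _
  | zero => intro _; rw [map_zero]; exact valid_zero
  | add s t hs ht =>
    rw [map_add, valid_add_iff, valid_add_iff]; exact fun h => ⟨hs h.1, ht h.2⟩
  | smul r t ht => rw [map_smul, valid_smul_iff, valid_smul_iff]; exact ht
  | op p k hp =>
    rw [map_op, valid_op_iff, valid_op_iff]
    exact fun h => (hp.and h).map _ _ (fun _ h => h.1 h.2)

end Map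

theorem map_id {x y : A.Ob} {k : ℤ} (t : Raw A x y k) : t.map (𝟙 A : A ⟶ A) = t := by
  induction t using induct with
  | one x => exact map_one _ _
  | gen c f hc =>
    refine (map_gen _ _ _).trans ?_
    rw [hc]; rfl
  | zero => exact map_zero _
  | add s t hs ht =>
    refine (map_add _ _ _).trans ?_
    rw [hs, ht]
  | smul r t ht =>
    refine (map_smul _ _ _).trans ?_
    rw [ht]
  | op p k hp =>
    refine (map_op _ _ _).trans (congrArg (fun c => op c k) ?_)
    exact (Chain.map_congr (fun x => x) _ _ hp).trans (Chain.map_id p)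

theorem map_comp (F : A ⟶ B) (G : B ⟶ C) {x y : A.Ob} {k : ℤ} (t : Raw A x y k) :
    t.map (F ≫ G) = (t.map F).map G := by
  induction t using induct with
  | one x => rw [map_one, map_one, map_one]; rfl
  | gen c f hc =>
    rw [map_gen, map_gen, map_gen, hc]; rfl
  | zero => rw [map_zero, map_zero, map_zero]
  | add s t hs ht => rw [map_add, map_add, map_add, hs, ht]
  | smul r t ht => rw [map_smul, map_smul, map_smul, ht]
  | op p k hp =>
    rw [map_op, map_op, map_op, Chain.map_map (G := G.obj)]
    exact congrArg (fun c => op c k) (Chain.map_congr _ _ _ hp)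

end Raw

end Raw

/-! ### The functor to be shown a semi-free resolution -/

section Resolution

variable {R : Type u} [CommRing R]

/-- The valid expressions. -/
abbrev VRaw (A : SUAInfCat R) (x y : A.Ob) (k : ℤ) : Type u := {t : Raw A x y k // t.Valid}

namespace VRaw

variable {A B : SUAInfCat R}

instance (x y : A.Ob) (k : ℤ) : Zero (VRaw A x y k) := ⟨⟨0, Raw.valid_zero⟩⟩
instance (x y : A.Ob) (k : ℤ) : Add (VRaw A x y k) :=
  ⟨fun s t => ⟨s.1 + t.1, Raw.valid_add_iff.2 ⟨s.2, t.2⟩⟩⟩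
instance (x y : A.Ob) (k : ℤ) : SMul R (VRaw A x y k) :=
  ⟨fun r t => ⟨r • t.1, Raw.valid_smul_iff.2 t.2⟩⟩

/-- The underlying chain of expressions. -/
abbrev vals {x y : A.Ob} (p : Chain (VRaw A) x y) : Chain (Raw A) x y :=
  p.map (H' := Raw A) (fun x => x) (fun t => t.1)

/-- The operations. -/
def op {x y : A.Ob} (p : Chain (VRaw A) x y) (k : ℤ) : VRaw A x y k :=
  ⟨.op (vals p) k, Raw.valid_op_iff.2 <|
    (Chain.All.of_forall (P := fun _ => True) (fun _ => trivial) p).map _ _ (fun t _ => t.2)⟩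

/-- A strict functor applied to a valid expression. -/
def map (F : SUStrictFunctor A B) {x y : A.Ob} {k : ℤ} (t : VRaw A x y k) :
    VRaw B (F.obj x) (F.obj y) k :=
  ⟨t.1.map F, Raw.map_valid F t.1 t.2⟩

theorem map_op (F : SUStrictFunctor A B) {x y : A.Ob} (p : Chain (VRaw A) x y) (k : ℤ) :
    (op p k).map F = op (p.map F.obj (fun t => t.map F)) k := by
  refine Subtype.ext ((Raw.map_op F _ _).trans ?_)
  refine congrArg (fun c => Raw.op c k) ?_
  rw [Chain.map_map (G := F.obj) (ψ := fun t => Raw.map F t)]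
  exact (Chain.map_map (H'' := Raw B) F.obj (fun t => VRaw.map F t) (fun x => x)
    (fun t => t.1) p).symm

end VRaw

/-- The presentation of the resolution of `A` by valid expressions. -/
abbrev sfPresentation (A : SUAInfCat R) : AInfPresentation R where
  Ob := A.Ob
  T := VRaw A
  op := VRaw.op
  one x := ⟨.one x, Raw.valid_one x⟩
  -- A chain of equivalences between valid expressions may pass through invalid ones. This is
  -- harmless, since evaluation and the action of functors are defined on all expressions and
  -- respect the whole congruence.
  rel s t := Raw.Rel s.1 t.1
  refl _ := .refl _
  symm h := .symm h
  trans h h' := .trans h h'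
  add_congr h h' := .add_congr h h'
  smul_congr r _ _ h := .smul_congr r h
  op_congr p s t q k h := by
    simp only [VRaw.op, VRaw.vals, Chain.map_append, Chain.map]
    exact .op_congr _ _ _ h
  add_assoc _ _ _ := .add_assoc _ _ _
  add_comm _ _ := .add_comm _ _
  zero_add _ := .zero_add _
  zero_smul _ := .zero_smul _
  one_smul _ := .one_smul _
  mul_smul _ _ _ := .mul_smul _ _ _
  add_smul _ _ _ := .add_smul _ _ _
  smul_add _ _ _ := .smul_add _ _ _
  op_nil _ _ := .op_nil _ _
  op_deg p k h := .op_deg _ _ (by rwa [Chain.deg_map, Chain.length_map])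
  op_add p s t q k := by
    simp only [VRaw.op, VRaw.vals, Chain.map_append, Chain.map]
    exact .op_add _ _ _ _ _
  op_smul p r s q k := by
    simp only [VRaw.op, VRaw.vals, Chain.map_append, Chain.map]
    exact .op_smul _ _ _ _ _
  ainf p k := by
    have h := ainfSum_map (R := R) (H := VRaw A) (H' := Raw A) VRaw.op Raw.op (fun x => x)
      (fun t => t.1) rfl (fun _ _ => rfl) (fun _ _ => rfl) (fun _ _ => rfl) p k
    exact h ▸ .ainf _ k
  one_closed _ _ := .one_closed _ _
  one_right _ := .one_right _
  one_left _ := .one_left _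
  op_one p q k h := by
    simp only [VRaw.op, VRaw.vals, Chain.map_append, Chain.map]
    exact .op_one _ _ _ (by rwa [Chain.length_map, Chain.length_map])

/-- The resolution of `A`. -/
noncomputable abbrev sfObj (A : SUAInfCat R) : SUAInfCat R := (sfPresentation A).toSUAInfCat

-- The resolution: its differential, functors out of it, and its projection

namespace sfObj

variable {A B C : SUAInfCat R}

/-- The morphism given by a valid expression. -/
def cls {x y : A.Ob} {k : ℤ} (t : Raw A x y k) (ht : t.Valid) :
    (sfObj A).Hom (x : A.Ob) (y : A.Ob) k :=
  AInfPresentation.QHom.mk (P := sfPresentation A) ⟨t, ht⟩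

theorem cls_eq_iff {x y : A.Ob} {k : ℤ} {s t : Raw A x y k} (hs : s.Valid) (ht : t.Valid) :
    cls s hs = cls t ht ↔ s.Rel t :=
  ⟨fun h => AInfPresentation.QHom.exact (P := sfPresentation A) h,
    fun h => AInfPresentation.QHom.sound (P := sfPresentation A) h⟩

theorem exists_cls {x y : A.Ob} {k : ℤ} (f : (sfObj A).Hom x y k) :
    ∃ (t : Raw A x y k) (ht : t.Valid), cls t ht = f := by
  induction f using AInfPresentation.QHom.ind (P := sfPresentation A) with
  | _ t => exact ⟨t.1, t.2, rfl⟩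

theorem m_cls {x y : A.Ob} (p : Chain (VRaw A) x y) (k : ℤ) :
    (sfObj A).m (p.map (fun x => x) (fun t => cls t.1 t.2)) k =
      cls (.op (VRaw.vals p) k) (VRaw.op p k).2 :=
  AInfPresentation.QHom.m_mk (P := sfPresentation A) p k

theorem exists_chain {x y : A.Ob} (p : Chain (sfObj A).Hom x y) :
    ∃ q : Chain (VRaw A) x y, q.map (fun x => x) (fun t => cls t.1 t.2) = p :=
  AInfPresentation.QHom.exists_chain (P := sfPresentation A) p

theorem d_cls {x y : A.Ob} {k : ℤ} (t : Raw A x y k) (ht : t.Valid) (j : ℤ) :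
    (sfObj A).d x y k j (cls t ht) =
      cls (.op (.single t) j) (Raw.valid_op_iff.2 ⟨ht, trivial⟩) :=
  m_cls (.single ⟨t, ht⟩) j

/-- Validity of the generator supplies exactly the two premises of `gen_d`. -/
theorem d_cls_gen {x y : A.Ob} {k : ℤ} (c : Raw A x y (k + 1)) (f : A.Hom x y k)
    (h : (Raw.gen c f).Valid) :
    (sfObj A).d x y k (k + 1) (cls (.gen c f) h) = cls c (Raw.valid_gen_iff.1 h).1 := by
  rw [d_cls, cls_eq_iff]
  exact .gen_d _ _ (Raw.valid_gen_iff.1 h).2.1 (Raw.valid_gen_iff.1 h).2.2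

section Lift

variable (obj : A.Ob → C.Ob)
  (γ : ∀ {x y : A.Ob} {k : ℤ}, Raw A x y (k + 1) → A.Hom x y k →
    C.Hom (obj x) (obj y) (k + 1) → C.Hom (obj x) (obj y) k)
  (hγ : ∀ {x y : A.Ob} {k : ℤ} (c : Raw A x y (k + 1)) (f : A.Hom x y k),
    C.d _ _ (k + 1) (k + 1 + 1) (Raw.eval obj γ c) = 0 → c.value = A.d x y k (k + 1) f →
    C.d _ _ k (k + 1) (γ c f (Raw.eval obj γ c)) = Raw.eval obj γ c)

/-- The strict functor on the resolution which is given by values of the generators. -/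
def lift : SUStrictFunctor (sfObj A) C where
  obj := obj
  map {x y k} :=
    { toFun := Quotient.lift (s := (sfPresentation A).setoid x y k)
        (fun t : VRaw A x y k => Raw.eval obj γ t.1) (fun _ _ h => Raw.eval_rel obj γ hγ h)
      map_add' := fun f g => by
        obtain ⟨s, hs, rfl⟩ := exists_cls f
        obtain ⟨t, ht, rfl⟩ := exists_cls g
        exact Raw.eval_add obj γ s t
      map_smul' := fun r f => by
        obtain ⟨s, hs, rfl⟩ := exists_cls f
        exact Raw.eval_smul obj γ r s }
  map_m p k := by
    obtain ⟨p, rfl⟩ := exists_chain p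
    rw [m_cls, Chain.map_map (G := obj)]
    refine (Raw.eval_op obj γ _ k).trans (congrArg (fun c => C.m c k) ?_)
    exact Chain.map_map (H'' := C.Hom) (fun x => x) (fun t : VRaw A _ _ _ => t.1) obj
      (fun t : Raw A _ _ _ => Raw.eval obj γ t) p
  map_one x := Raw.eval_one obj γ x

end Lift

/-- The functor between the resolutions. -/
noncomputable def map (F : SUStrictFunctor A B) : SUStrictFunctor (sfObj A) (sfObj B) where
  obj := F.obj
  map {x y k} :=
    { toFun := Quotient.lift (s := (sfPresentation A).setoid x y k)
        (fun t : VRaw A x y k => cls (t.1.map F) (Raw.map_valid F t.1 t.2))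
        (fun _ _ h => (cls_eq_iff _ _).2 (Raw.map_rel F h))
      map_add' := fun f g => by
        obtain ⟨s, hs, rfl⟩ := exists_cls f
        obtain ⟨t, ht, rfl⟩ := exists_cls g
        exact (cls_eq_iff (Raw.map_valid F (s + t) (Raw.valid_add_iff.2 ⟨hs, ht⟩))
          (Raw.valid_add_iff.2 ⟨Raw.map_valid F s hs, Raw.map_valid F t ht⟩)).2
          (.of_eq (Raw.map_add F s t))
      map_smul' := fun r f => by
        obtain ⟨s, hs, rfl⟩ := exists_cls f
        exact (cls_eq_iff (Raw.map_valid F (r • s) (Raw.valid_smul_iff.2 hs))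
          (Raw.valid_smul_iff.2 (Raw.map_valid F s hs))).2 (.of_eq (Raw.map_smul F r s)) }
  map_m p k := by
    obtain ⟨p, rfl⟩ := exists_chain p
    rw [m_cls, Chain.map_map (G := F.obj)]
    have h := m_cls (p.map F.obj (fun t => t.map F)) k
    rw [Chain.map_map (G := fun x => x)] at h
    refine Eq.trans ?_ h.symm
    exact congrArg (AInfPresentation.QHom.mk (P := sfPresentation B)) (VRaw.map_op F p k)
  map_one x := (cls_eq_iff (Raw.map_valid F _ (Raw.valid_one x)) (Raw.valid_one _)).2
    (.of_eq (Raw.map_one F x))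

/-- The projection of the resolution of `A` to `A`. -/
noncomputable def proj (A : SUAInfCat R) : SUStrictFunctor (sfObj A) A :=
  lift (fun x => x) (fun _ f _ => f) (fun _ _ _ h => h.symm)

theorem proj_cls {x y : A.Ob} {k : ℤ} (t : Raw A x y k) (ht : t.Valid) :
    (proj A).map (cls t ht) = t.value := rfl

end sfObj

theorem SUStrictFunctor.ext_of_map {A B : SUAInfCat R} {F G : SUStrictFunctor A B}
    (hobj : ∀ x, F.obj x = G.obj x)
    (hmap : ∀ {x y : A.Ob} {k : ℤ} (f : A.Hom x y k), HEq (F.map f) (G.map f)) : F = G := by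
  obtain ⟨⟨Fo, Fm, _⟩, _⟩ := F
  obtain ⟨⟨Go, Gm, _⟩, _⟩ := G
  obtain rfl : Fo = Go := funext hobj
  congr
  funext x y k
  exact LinearMap.ext fun f => eq_of_heq (hmap f)

/-- The resolution as a functor. -/
noncomputable def sfFunctor (R : Type u) [CommRing R] : SUAInfCat.{u} R ⥤ SUAInfCat.{u} R where
  obj := sfObj
  map F := sfObj.map F
  map_id A := by
    refine SUStrictFunctor.ext_of_map (fun _ => rfl) fun f => heq_of_eq ?_
    obtain ⟨t, ht, rfl⟩ := sfObj.exists_cls f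
    exact (sfObj.cls_eq_iff _ _).2 (.of_eq (Raw.map_id t))
  map_comp F G := by
    refine SUStrictFunctor.ext_of_map (fun _ => rfl) fun f => heq_of_eq ?_
    obtain ⟨t, ht, rfl⟩ := sfObj.exists_cls f
    exact (sfObj.cls_eq_iff _ _).2 (.of_eq (Raw.map_comp F G t))

/-- The natural projection of the resolution. -/
noncomputable def sfProj (R : Type u) [CommRing R] : sfFunctor R ⟶ 𝟭 (SUAInfCat.{u} R) where
  app A := sfObj.proj A
  naturality A B F := by
    refine SUStrictFunctor.ext_of_map (fun _ => rfl) fun f => heq_of_eq ?_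
    obtain ⟨t, ht, rfl⟩ := sfObj.exists_cls f
    exact Raw.value_map F t

end Resolution

/-! ### Adjoining a contraction

For a strictly unital A∞-category `A`, the tensor product of `A` with the DG algebra `R[ε]`,
`deg ε = -1`, `m¹ ε = 1`, `ε² = 0`, is a strictly unital A∞-category in which every closed
morphism is exact, and which contains `A` as a subcategory. -/

namespace Chain

variable {R : Type u} [CommRing R] {O : Type u} {H : O → O → ℤ → Type u} {M N : Type u}
  [AddCommGroup M] [Module R M] [AddCommGroup N] [Module R N]

/-- The sum of `K b c` over all ways to cut a chain into a first part `b` and a last part `c`. -/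
def splitSum {x y : O} (K : ∀ z : O, Chain H x z → Chain H z y → M) (p : Chain H x y) : M :=
  (p.splits.map fun s => K s.1 s.2.1 s.2.2).sum

theorem splitSum_nil {x : O} (K : ∀ z : O, Chain H x z → Chain H z x → M) :
    splitSum K (nil x) = K x (nil x) (nil x) := by
  simp [splitSum, splits]

theorem splitSum_cons {w x y : O} {k : ℤ} (K : ∀ z : O, Chain H w z → Chain H z y → M)
    (f : H w x k) (p : Chain H x y) :
    splitSum K (cons f p) =
      K w (nil w) (cons f p) + splitSum (fun z b c => K z (cons f b) c) p := by
  simp [splitSum, splits, List.map_map, Function.comp_def]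

theorem splitSum_add {x y : O} (K L : ∀ z : O, Chain H x z → Chain H z y → M) (p : Chain H x y) :
    splitSum (fun z b c => K z b c + L z b c) p = splitSum K p + splitSum L p := by
  simp [splitSum, List.sum_map_add]

theorem splitSum_map_linear {x y : O} (L : M →ₗ[R] N)
    (K : ∀ z : O, Chain H x z → Chain H z y → M) (p : Chain H x y) :
    L (splitSum K p) = splitSum (fun z b c => L (K z b c)) p := by
  simp [splitSum, map_list_sum, List.map_map, Function.comp_def]

theorem splitSum_smul {x y : O} (r : R) (K : ∀ z : O, Chain H x z → Chain H z y → M)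
    (p : Chain H x y) : splitSum (fun z b c => r • K z b c) p = r • splitSum K p :=
  (splitSum_map_linear (r • LinearMap.id : M →ₗ[R] M) K p).symm

theorem splitSum_neg {x y : O} (K : ∀ z : O, Chain H x z → Chain H z y → M)
    (p : Chain H x y) : splitSum (fun z b c => -K z b c) p = -splitSum K p := by
  simp [splitSum, List.sum_neg, List.map_map, Function.comp_def]

theorem splitSum_zero {x y : O} (p : Chain H x y) :
    splitSum (fun _ _ _ => (0 : M)) p = 0 := by
  simp [splitSum]

theorem splitSum_map {O' : Type u} {H' : O' → O' → ℤ → Type u} (F : O → O')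
    (φ : ∀ {x y : O} {k : ℤ}, H x y k → H' (F x) (F y) k) {x y : O}
    (K : ∀ z : O', Chain H' (F x) z → Chain H' z (F y) → M) (p : Chain H x y) :
    splitSum K (p.map F φ) = splitSum (fun z b c => K (F z) (b.map F φ) (c.map F φ)) p := by
  simp [splitSum, splits_map, List.map_map, Function.comp_def]

/-- Only the summand with empty last part is nonzero. -/
theorem splitSum_last {x y : O} (K : ∀ z : O, Chain H x z → Chain H z y → M)
    (hK : ∀ {z w : O} {k : ℤ} (b : Chain H x z) (f : H z w k) (c : Chain H w y),
      K z b (cons f c) = 0) (p : Chain H x y) : splitSum K p = K y p (nil y) := by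
  induction p with
  | nil => exact splitSum_nil K
  | cons f p ih =>
    rw [splitSum_cons, hK, zero_add]
    exact ih _ (fun b g c => hK (cons f b) g c)

/-- Only the summand whose first part has one morphism is nonzero. -/
theorem splitSum_single {w x y : O} {k : ℤ} (K : ∀ z : O, Chain H w z → Chain H z y → M)
    (f : H w x k) (p : Chain H x y) (h0 : K w (nil w) (cons f p) = 0)
    (h2 : ∀ {z v : O} {j : ℤ} (g : H x v j) (b : Chain H v z) (c : Chain H z y),
      K z (cons f (cons g b)) c = 0) : splitSum K (cons f p) = K x (single f) p := by
  rw [splitSum_cons, h0, zero_add]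
  cases p with
  | nil => rw [splitSum_nil]; rfl
  | cons g p =>
    rw [splitSum_cons]
    simp only [h2, splitSum_zero, add_zero]
    rfl

/-- The sum of `± G (c, m b, a)` over all ways to cut a chain into parts `a`, `b`, `c`. -/
def barSum (R : Type u) [CommRing R] [Module R M]
    (m : ∀ {x y : O}, Chain H x y → ∀ k : ℤ, H x y k) {x y : O} (G : Chain H x y → M)
    (p : Chain H x y) : M :=
  splitSum (fun _ a r => splitSum (fun _ b c => koszulSign R (a.deg - a.length) •
    G (a.append (cons (m b (b.deg + 2 - b.length)) c))) r) p

variable (m : ∀ {x y : O}, Chain H x y → ∀ k : ℤ, H x y k)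

theorem barSum_nil {x : O} (G : Chain H x x → M) :
    barSum R m G (nil x) = G (cons (m (nil x) ((nil x : Chain H x x).deg + 2 -
      (nil x : Chain H x x).length)) (nil x)) := by
  rw [barSum, splitSum_nil, splitSum_nil]
  simp [deg, length, koszulSign_zero, append]

/-- The cuts are sorted by whether `f` belongs to the first part `a`. If it does, it contributes the
sign `(-1)^(k-1)` and can be absorbed into `G`; so induction on the chain requires an arbitrary `G`
in place of an operation. -/
theorem barSum_cons {w x y : O} {k : ℤ} (G : Chain H w y → M) (f : H w x k) (p : Chain H x y) :
    barSum R m G (cons f p) =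
      splitSum (fun _ b c => G (cons (m b (b.deg + 2 - b.length)) c)) (cons f p) +
        koszulSign R (k - 1) • barSum R m (fun q => G (cons f q)) p := by
  rw [barSum, splitSum_cons (f := f)]
  congr 1
  · simp only [deg, length, sub_self, koszulSign_zero, one_smul, append]
  · rw [barSum, ← splitSum_smul]
    congr 1
    funext z a r
    rw [← splitSum_smul]
    congr 1
    funext v b c
    rw [smul_smul, ← koszulSign_add, append]
    congr 2
    simp only [deg, length]; ring

theorem barSum_add {x y : O} (G G' : Chain H x y → M) (p : Chain H x y) :
    barSum R m (fun q => G q + G' q) p = barSum R m G p + barSum R m G' p := by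
  simp only [barSum, smul_add, splitSum_add]

theorem barSum_map_linear {x y : O} (L : M →ₗ[R] N) (G : Chain H x y → M) (p : Chain H x y) :
    L (barSum R m G p) = barSum R m (fun q => L (G q)) p := by
  simp only [barSum, splitSum_map_linear, map_smul]

theorem barSum_smul {x y : O} (r : R) (G : Chain H x y → M) (p : Chain H x y) :
    barSum R m (fun q => r • G q) p = r • barSum R m G p :=
  (barSum_map_linear m (r • LinearMap.id : M →ₗ[R] M) G p).symm

theorem barSum_eq_zero {x y : O} (G : Chain H x y → M)
    (hG : ∀ {z w : O} {k : ℤ} (a : Chain H x z) (f : H z w k) (c : Chain H w y),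
      G (a.append (cons f c)) = 0) (p : Chain H x y) : barSum R m G p = 0 := by
  simp only [barSum, hG, smul_zero, splitSum_zero]

-- The operations on `H ⊗ R[ε]` and their A∞-equations

section Multilinear

set_option linter.unusedSectionVars false

variable [∀ x y k, AddCommGroup (H x y k)] [∀ x y k, Module R (H x y k)]

theorem ainfSum_eq_barSum {x y : O} (p : Chain H x y) (k : ℤ) :
    ainfSum (R := R) m p k = barSum R m (fun q => m q k) p := rfl

/-- `G` is linear in every morphism of the chain. -/
structure IsMultilinear (R : Type u) [CommRing R] [∀ x y k, Module R (H x y k)] [Module R M]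
    {x y : O} (G : Chain H x y → M) : Prop where
  add : ∀ {z w : O} (p : Chain H x z) {j : ℤ} (f g : H z w j) (q : Chain H w y),
    G (p.append (cons (f + g) q)) = G (p.append (cons f q)) + G (p.append (cons g q))
  smul : ∀ {z w : O} (p : Chain H x z) {j : ℤ} (r : R) (f : H z w j) (q : Chain H w y),
    G (p.append (cons (r • f) q)) = r • G (p.append (cons f q))

namespace IsMultilinear

variable {x y z : O} {k : ℤ} {G : Chain H x y → M}

theorem cons (hG : IsMultilinear R G) (f : H x z k) :
    IsMultilinear R (fun q => G (.cons f q)) :=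
  ⟨fun p _ e g q => hG.add (.cons f p) e g q, fun p _ r g q => hG.smul (.cons f p) r g q⟩

theorem zero {z w : O} (hG : IsMultilinear R G) (p : Chain H x z) {j : ℤ} (q : Chain H w y) :
    G (p.append (.cons (0 : H z w j) q)) = 0 := by
  have h := hG.smul p (0 : R) (0 : H z w j) q
  rwa [zero_smul, zero_smul] at h

theorem add_first (hG : IsMultilinear R G) (f g : H x z k) (q : Chain H z y) :
    G (.cons (f + g) q) = G (.cons f q) + G (.cons g q) := hG.add (.nil x) f g q

theorem smul_first (hG : IsMultilinear R G) (r : R) (f : H x z k) (q : Chain H z y) :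
    G (.cons (r • f) q) = r • G (.cons f q) := hG.smul (.nil x) r f q

theorem zero_first (hG : IsMultilinear R G) (q : Chain H z y) :
    G (.cons (0 : H x z k) q) = 0 := hG.zero (.nil x) q

/-- `G` as a linear function of the first morphism. -/
def firstMap (hG : IsMultilinear R G) (q : Chain H z y) : H x z k →ₗ[R] M where
  toFun f := G (.cons f q)
  map_add' f g := hG.add_first f g q
  map_smul' r f := hG.smul_first r f q

end IsMultilinear

/-- Pairs `(a, a')`, which stand for `a + ε a'` with `deg ε = -1`. -/
abbrev EpsHom (H : O → O → ℤ → Type u) (x y : O) (k : ℤ) : Type u := H x y k × H x y (k + 1)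

/-- The chain of the parts without `ε`. -/
abbrev fsts {x y : O} (p : Chain (EpsHom H) x y) : Chain H x y :=
  p.map (fun x => x) (fun f => f.1)

/-- The coefficient of `ε` in the value of `G` on a chain of pairs. -/
def epsSum (R : Type u) [CommRing R] [Module R M] : ∀ {x y : O}, Chain (EpsHom H) x y →
    (Chain H x y → M) → M
  | _, _, nil _, _ => 0
  | _, _, cons (k := k) f p, G => G (cons f.2 (fsts p)) +
      koszulSign R (k - 1) • epsSum R p (fun q => G (cons f.1 q))

theorem epsSum_add {x y : O} (p : Chain (EpsHom H) x y) (G G' : Chain H x y → M) :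
    epsSum R p (fun q => G q + G' q) = epsSum R p G + epsSum R p G' := by
  induction p with
  | nil => simp [epsSum]
  | cons f p ih => simp only [epsSum, ih, smul_add]; abel

theorem epsSum_map_linear (L : M →ₗ[R] N) {x y : O} (p : Chain (EpsHom H) x y)
    (G : Chain H x y → M) : L (epsSum R p G) = epsSum R p (fun q => L (G q)) := by
  induction p with
  | nil => simp [epsSum]
  | cons f p ih => simp only [epsSum, map_add, map_smul, ih]

theorem epsSum_smul {x y : O} (r : R) (p : Chain (EpsHom H) x y) (G : Chain H x y → M) :
    epsSum R p (fun q => r • G q) = r • epsSum R p G :=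
  (epsSum_map_linear (r • LinearMap.id : M →ₗ[R] M) p G).symm

/-- Each summand takes the coefficient of `ε` in one arrow and the part without `ε` in the others,
which raises the total degree by one and keeps the length. Only the restriction of `G` to such
chains matters. -/
theorem epsSum_congr {x y : O} (p : Chain (EpsHom H) x y) (G G' : Chain H x y → M)
    (h : ∀ q, q.deg = p.deg + 1 → q.length = p.length → G q = G' q) :
    epsSum R p G = epsSum R p G' := by
  induction p with
  | nil => rfl
  | cons f p ih =>
    simp only [epsSum]
    rw [h, ih]
    · intro q h1 h2
      exact h _ (by simp only [deg, h1]; ring) (by simp only [length, h2])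
    · simp only [deg, deg_map]; ring
    · simp only [length, length_map]

theorem epsSum_eq_zero {x y : O} (p : Chain (EpsHom H) x y) (G : Chain H x y → M)
    (h : ∀ q, q.deg = p.deg + 1 → q.length = p.length → G q = 0) :
    epsSum R p G = 0 := by
  rw [epsSum_congr p G (fun _ => (0 : R) • (0 : M)) (fun q h1 h2 => by rw [h q h1 h2, zero_smul]),
    epsSum_smul, zero_smul]

theorem epsSum_isMultilinear {x y : O} {G : Chain H x y → M} (hG : IsMultilinear R G) :
    IsMultilinear R (fun p : Chain (EpsHom H) x y => epsSum R p G) := by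
  constructor
  · intro z w p j f g q
    induction p with
    | nil =>
      simp only [append, epsSum, Prod.snd_add, Prod.fst_add, hG.add_first, epsSum_add, smul_add]
      abel
    | cons e p ih =>
      simp only [append, epsSum, fsts, map_append, map, Prod.fst_add]
      have h := hG.add (cons e.2 (fsts p)) f.1 g.1 (fsts q)
      simp only [append] at h
      rw [h, ih (hG.cons e.1), smul_add]
      abel
  · intro z w p j r f q
    induction p with
    | nil =>
      simp only [append, epsSum, Prod.smul_snd, Prod.smul_fst, hG.smul_first, epsSum_smul,
        smul_add]
      rw [smul_comm]
    | cons e p ih =>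
      simp only [append, epsSum, fsts, map_append, map, Prod.smul_fst]
      have h := hG.smul (cons e.2 (fsts p)) r f.1 (fsts q)
      simp only [append] at h
      rw [h, ih (hG.cons e.1), smul_add]
      rw [smul_comm]

theorem fsts_isMultilinear {x y : O} {G : Chain H x y → M} (hG : IsMultilinear R G) :
    IsMultilinear R (fun p : Chain (EpsHom H) x y => G (fsts p)) := by
  constructor
  · intro z w p j f g q
    simp only [fsts, map_append, map, Prod.fst_add]
    exact hG.add _ _ _ _
  · intro z w p j r f q
    simp only [fsts, map_append, map, Prod.smul_fst]
    exact hG.smul _ _ _ _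

theorem splitSum_fsts {x y : O} (K : ∀ z : O, Chain H x z → Chain H z y → M)
    (p : Chain (EpsHom H) x y) :
    splitSum K (fsts p) = splitSum (fun z b c => K z (fsts b) (fsts c)) p :=
  splitSum_map (fun x => x) (fun f : EpsHom H _ _ _ => f.1) K p

theorem cons_op_fsts {x y z : O} (b : Chain (EpsHom H) x y) (c : Chain H y z) :
    cons (m (fsts b) ((fsts b).deg + 2 - (fsts b).length)) c =
      cons (m (fsts b) (b.deg + 2 - b.length)) c := by
  rw [fsts, deg_map, length_map]

/-- The Leibniz rule for the coefficient of `ε`. -/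
theorem epsSum_splitSum {x y : O} (p : Chain (EpsHom H) x y)
    (K : ∀ z : O, Chain H x z → Chain H z y → M) :
    epsSum R p (fun q => splitSum K q) =
      splitSum (fun z b c => epsSum R b (fun b' => K z b' (fsts c)) +
        koszulSign R (b.deg - b.length) • epsSum R c (fun c' => K z (fsts b) c')) p := by
  induction p with
  | nil => simp [splitSum_nil, epsSum]
  | cons f p ih =>
    rename_i k
    rw [splitSum_cons]
    simp only [epsSum, splitSum_cons, epsSum_add, ih, splitSum_add, splitSum_fsts, deg, length,
      sub_self, koszulSign_zero, one_smul, zero_add, smul_add, splitSum_smul, map]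
    -- Putting `f` at the front of the first part multiplies the sign for an `ε` in the second part
    -- by `(-1)^(k-1)`.
    have e : ∀ a b : ℤ, k + a - (b + 1) = (k - 1) + (a - b) := fun a b => by ring
    simp only [e, koszulSign_add, ← smul_smul, splitSum_smul]
    abel

/-- The part `ε a' ↦ a'` of the differential, extended by zero to all chains. -/
def sndPart : ∀ {x y : O}, Chain (EpsHom H) x y → ∀ k : ℤ, H x y k
  | _, _, cons (k := i) f (nil _), k => if h : i + 1 = k then h ▸ f.2 else 0
  | _, _, _, _ => 0

/-- The operations on pairs. -/
def epsOp (R : Type u) [CommRing R] [∀ x y k, Module R (H x y k)]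
    (m : ∀ {x y : O}, Chain H x y → ∀ k : ℤ, H x y k) {x y : O} (p : Chain (EpsHom H) x y)
    (k : ℤ) : EpsHom H x y k :=
  (m (fsts p) k + sndPart p k, -epsSum R p (fun q => m q (k + 1)))

theorem sndPart_single_eq {x y : O} {i j : ℤ} (f : EpsHom H x y i) (h : i + 1 = j) :
    sndPart (single f) j = h ▸ f.2 := by
  simp [single, sndPart, h]

theorem sndPart_single_ne {x y : O} {i j : ℤ} (f : EpsHom H x y i) (h : i + 1 ≠ j) :
    sndPart (single f) j = 0 := by
  simp [single, sndPart, h]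

theorem sndPart_nil (x : O) (k : ℤ) : sndPart (nil x : Chain (EpsHom H) x x) k = 0 := rfl

theorem sndPart_cons_cons {x y z w : O} {i j : ℤ} (f : EpsHom H x y i) (g : EpsHom H y z j)
    (p : Chain (EpsHom H) z w) (k : ℤ) : sndPart (cons f (cons g p)) k = 0 := rfl

theorem sndPart_append_cons_cons {x y z w v : O} {i j : ℤ} (q : Chain (EpsHom H) v x)
    (f : EpsHom H x y i) (g : EpsHom H y z j)
    (p : Chain (EpsHom H) z w) (k : ℤ) : sndPart (q.append (cons f (cons g p))) k = 0 := by
  cases q with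
  | nil => rfl
  | cons e q => cases q <;> rfl

theorem cons_sndPart_single {x y z : O} {i j : ℤ} (f : EpsHom H x y i) (h : i + 1 = j)
    (q : Chain H y z) : cons (sndPart (single f) j) q = cons f.2 q := by
  subst h
  rw [sndPart_single_eq f rfl]

variable (hm0 : ∀ (x : O) (k : ℤ), m (nil x) k = 0)

include hm0

theorem epsOp_nil (x : O) (k : ℤ) : epsOp R m (nil x) k = 0 := by
  simp only [epsOp, fsts, map, hm0, sndPart_nil, epsSum]
  ext <;> simp

/-- The part of the inner operation without `ε` differs from `m` only by the term `m¹ ε = 1`. That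
term is present only when the middle part is the single arrow `f`, which it replaces by `f.2`. -/
theorem splitSum_epsOp_fst {w x y : O} {k : ℤ} (f : EpsHom H w x k) (p : Chain (EpsHom H) x y)
    {G : Chain H w y → M} (hG : IsMultilinear R G) :
    splitSum (fun _ b c => G (cons (epsOp R m b (b.deg + 2 - b.length)).1 (fsts c))) (cons f p) =
      splitSum (fun _ b c => G (cons (m b (b.deg + 2 - b.length)) c)) (fsts (cons f p)) +
        G (cons f.2 (fsts p)) := by
  simp only [epsOp, hG.add_first, splitSum_add]
  congr 1
  · rw [splitSum_fsts]
    simp only [cons_op_fsts]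
  · rw [splitSum_single]
    · rw [cons_sndPart_single]
      simp only [single, deg, length]; ring
    · rw [sndPart_nil, hG.zero_first]
    · intro z v j g b c
      rw [sndPart_cons_cons, hG.zero_first]

/-- The correction comes from `m¹ ε = 1`: some arrow `a + ε a'` is replaced by `a'`. Summing over
the arrows, with the signs of the A∞-equation, gives `epsSum`. -/
theorem barSum_epsOp_fsts {x y : O} (p : Chain (EpsHom H) x y) {G : Chain H x y → M}
    (hG : IsMultilinear R G) :
    barSum R (epsOp R m) (fun q => G (fsts q)) p = barSum R m G (fsts p) + epsSum R p G := by
  induction p with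
  | nil x =>
    simp only [fsts, map, epsSum, barSum_nil, epsOp_nil m hm0, hm0, add_zero]
    rfl
  | cons f p ih =>
    rw [barSum_cons, fsts, map, barSum_cons]
    simp only [map, epsSum]
    rw [ih (hG.cons f.1), splitSum_epsOp_fst m hm0 f p hG, smul_add]
    simp only [map]
    abel

/-- The surviving `ε` is either in the middle part or behind it. The summands with `m` combine by
the Leibniz rule `epsSum_splitSum`. The term `m¹ ε = 1` needs the middle part to be `f` alone; then
the `ε` comes from `p` and has to pass `f.2`, of degree `k + 1`, whence the sign `(-1)^k`. -/
theorem splitSum_epsOp_epsSum {w x y : O} {k : ℤ} (f : EpsHom H w x k)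
    (p : Chain (EpsHom H) x y) {G : Chain H w y → M} (hG : IsMultilinear R G) :
    splitSum (fun _ b c => epsSum R (cons (epsOp R m b (b.deg + 2 - b.length)) c) G) (cons f p) =
      -epsSum R (cons f p)
          (fun q => splitSum (fun _ b c => G (cons (m b (b.deg + 2 - b.length)) c)) q) +
        koszulSign R k • epsSum R p (fun q => G (cons f.2 q)) := by
  rw [epsSum_splitSum, ← splitSum_neg]
  have h1 : ∀ {z : O} (b : Chain (EpsHom H) w z) (c : Chain (EpsHom H) z y),
      epsSum R (cons (epsOp R m b (b.deg + 2 - b.length)) c) G =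
        -(epsSum R b (fun b' => G (cons (m b' (b'.deg + 2 - b'.length)) (fsts c))) +
          koszulSign R (b.deg - b.length) • epsSum R c
            (fun c' => G (cons (m (fsts b) ((fsts b).deg + 2 - (fsts b).length)) c'))) +
        koszulSign R (b.deg + 2 - b.length - 1) • epsSum R c
          (fun c' => G (cons (sndPart b (b.deg + 2 - b.length)) c')) := by
    intro z b c
    -- The degree in which `m` is taken depends on the chain. For the chains that occur in `epsSum`
    -- the total degree is one higher and the length is the same, so it is the degree of the
    -- `ε`-coefficient.
    have h2 : G (cons (epsOp R m b (b.deg + 2 - b.length)).2 (fsts c)) =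
        -epsSum R b (fun b' => G (cons (m b' (b'.deg + 2 - b'.length)) (fsts c))) := by
      refine ((hG.firstMap (fsts c)).map_neg _).trans (congrArg _ ?_)
      rw [epsSum_map_linear]
      refine epsSum_congr _ _ _ fun q hq hq' => ?_
      have e : b.deg + 2 - b.length + 1 = q.deg + 2 - q.length := by rw [hq, hq']; ring
      rw [e]
      rfl
    have e : b.deg + 2 - b.length - 1 = b.deg - b.length + 1 := by ring
    simp only [epsSum, h2]
    simp only [epsOp, hG.add_first, epsSum_add, smul_add, cons_op_fsts, e,
      koszulSign_add_one, neg_smul]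
    abel
  simp only [h1]
  rw [splitSum_add]
  congr 1
  rw [splitSum_single]
  · have e : (single f).deg + 2 - (single f).length = k + 1 := by
      simp only [single, deg, length]; ring
    rw [e, add_sub_cancel_right]
    congr 2
    funext q
    rw [cons_sndPart_single f rfl]
  · rw [epsSum_eq_zero, smul_zero]
    intro q _ _
    rw [sndPart_nil, hG.zero_first]
  · intro z v j g b c
    rw [epsSum_eq_zero, smul_zero]
    intro q _ _
    rw [sndPart_cons_cons, hG.zero_first]

/-- The summands with `m` pick up a minus sign from `ε`. Those from `m¹ ε = 1` remove one `ε` and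
keep another, and cancel in pairs: with the `ε` of `f` removed and one in `p` kept, they occur once
with `(-1)^k` from the cuts at `f` and once with `(-1)^(k-1)` from the cuts behind `f`. -/
theorem barSum_epsOp_epsSum {x y : O} (p : Chain (EpsHom H) x y) {G : Chain H x y → M}
    (hG : IsMultilinear R G) :
    barSum R (epsOp R m) (fun q => epsSum R q G) p = -epsSum R p (fun q => barSum R m G q) := by
  induction p with
  | nil x =>
    simp only [epsSum, barSum_nil, epsOp_nil m hm0]
    simp [hG.zero_first]
  | cons f p ih =>
    rename_i k
    rw [barSum_cons, splitSum_epsOp_epsSum m hm0 f p hG]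
    simp only [epsSum]
    rw [barSum_add, barSum_smul, barSum_epsOp_fsts m hm0 p (hG.cons f.2), ih (hG.cons f.1)]
    simp only [barSum_cons, epsSum_add, epsSum_smul, smul_add, add_sub_cancel_right, smul_neg,
      smul_smul, koszulSign_mul_self, one_smul]
    simp only [koszulSign_sub_one, neg_smul]
    abel

/-- `sndPart` vanishes unless the chain has exactly one arrow, so the only cut that counts has the
whole chain as its middle part. -/
theorem barSum_sndPart (μ : ∀ {x y : O}, Chain (EpsHom H) x y → ∀ k : ℤ, EpsHom H x y k)
    {x y : O} (p : Chain (EpsHom H) x y) (k : ℤ) :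
    barSum R μ (fun q => sndPart q k) p =
      sndPart (single (μ p (p.deg + 2 - p.length))) k := by
  cases p with
  | nil => rw [barSum_nil]; rfl
  | cons f p =>
    rw [barSum_cons, barSum_eq_zero (G := fun q => sndPart (cons f q) k), smul_zero, add_zero,
      splitSum_last]
    · rfl
    · intro _ _ _ _ _ _; rfl
    · intro _ _ _ a _ _; cases a <;> rfl

/-- In the component without `ε`, the excess `epsSum` of `barSum_epsOp_fsts` cancels against `m¹ ε =
1` applied to the `ε`-coefficient of the inner operation, which is minus the same sum. In the
`ε`-component, every summand is an A∞-equation for `m`. -/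
theorem ainfSum_epsOp (hm : ∀ {x y : O} (k : ℤ), IsMultilinear R (fun q : Chain H x y => m q k))
    (hdeg : ∀ {x y : O} (p : Chain H x y) (k : ℤ), k ≠ p.deg + 2 - p.length → m p k = 0)
    (hainf : ∀ {x y : O} (p : Chain H x y) (k : ℤ), ainfSum (R := R) m p k = 0)
    {x y : O} (p : Chain (EpsHom H) x y) (k : ℤ) : ainfSum (R := R) (epsOp R m) p k = 0 := by
  rw [ainfSum_eq_barSum]
  refine Prod.ext ?_ ?_
  · refine (barSum_map_linear (epsOp R m) (LinearMap.fst R (H x y k) (H x y (k + 1))) _ p).trans ?_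
    change barSum R (epsOp R m) (fun q => m (fsts q) k + sndPart q k) p = 0
    rw [barSum_add, barSum_epsOp_fsts m hm0 p (hm k), ← ainfSum_eq_barSum, hainf, zero_add,
      barSum_sndPart m hm0]
    -- In any other degree `k`, the two cancelling terms are both zero.
    by_cases h : p.deg + 2 - p.length + 1 = k
    · subst h
      rw [sndPart_single_eq _ rfl]
      exact add_neg_cancel _
    · rw [sndPart_single_ne _ h, add_zero]
      refine epsSum_eq_zero _ _ fun q hq hq' => hdeg _ _ ?_
      rw [hq, hq']
      omega
  · refine (barSum_map_linear (epsOp R m) (LinearMap.snd R (H x y k) (H x y (k + 1))) _ p).trans ?_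
    have h : barSum R (epsOp R m) (fun q => (-1 : R) • epsSum R q (fun q' => m q' (k + 1))) p
        = 0 := by
      rw [barSum_smul, barSum_epsOp_epsSum m hm0 p (hm (k + 1))]
      simp only [← ainfSum_eq_barSum, hainf]
      rw [epsSum_eq_zero _ _ (fun _ _ _ => rfl), neg_zero, smul_zero]
    simpa [epsOp] using h

end Multilinear

end Chain

-- The strictly unital structure on `A ⊗ R[ε]` and its contraction

section Contractible

variable {R : Type u} [CommRing R]

open Chain

theorem AInfCat.m_isMultilinear (A : AInfCat R) {x y : A.Ob} (k : ℤ) :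
    IsMultilinear R (fun q : Chain A.Hom x y => A.m q k) :=
  ⟨fun p _ f g q => A.m_add p f g q k, fun p _ r f q => A.m_smul p r f q k⟩

theorem Chain.sndPart_add {O : Type u} {H : O → O → ℤ → Type u}
    [∀ x y k, AddCommGroup (H x y k)] {w x y z : O} (p : Chain (EpsHom H) w x) {j : ℤ}
    (f g : EpsHom H x y j) (q : Chain (EpsHom H) y z) (k : ℤ) :
    sndPart (p.append (cons (f + g) q)) k =
      sndPart (p.append (cons f q)) k + sndPart (p.append (cons g q)) k := by
  cases p with
  | nil =>
    cases q with
    | nil =>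
      by_cases h : j + 1 = k
      · subst h
        simp [append, sndPart]
      · simp [append, sndPart, h]
    | cons e q => simp [append, sndPart]
  | cons e p => cases p <;> simp [append, sndPart]

theorem Chain.sndPart_smul {O : Type u} {H : O → O → ℤ → Type u}
    [∀ x y k, AddCommGroup (H x y k)] [∀ x y k, Module R (H x y k)] {w x y z : O}
    (p : Chain (EpsHom H) w x) {j : ℤ} (r : R) (f : EpsHom H x y j) (q : Chain (EpsHom H) y z)
    (k : ℤ) : sndPart (p.append (cons (r • f) q)) k = r • sndPart (p.append (cons f q)) k := by
  cases p with
  | nil =>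
    cases q with
    | nil =>
      by_cases h : j + 1 = k
      · subst h
        simp [append, sndPart]
      · simp [append, sndPart, h]
    | cons e q => simp [append, sndPart]
  | cons e p => cases p <;> simp [append, sndPart]

theorem Chain.sndPart_deg {O : Type u} {H : O → O → ℤ → Type u}
    [∀ x y k, AddCommGroup (H x y k)] {x y : O} (p : Chain (EpsHom H) x y) (k : ℤ)
    (h : k ≠ p.deg + 2 - p.length) : sndPart p k = 0 := by
  cases p with
  | nil => rfl
  | cons f p =>
    cases p with
    | nil =>
      refine sndPart_single_ne f ?_
      simp only [deg, length] at h
      omega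
    | cons g p => rfl

/-- The unit has no `ε`-part, so the `ε` is taken from another arrow and every remaining summand
still contains the unit. -/
theorem SUAInfCat.epsSum_one (A : SUAInfCat R) {x y z : A.Ob} (p : Chain (EpsHom A.Hom) x y)
    (q : Chain (EpsHom A.Hom) y z) {M : Type u} [AddCommGroup M] [Module R M]
    {G : Chain A.Hom x z → M} (hG : IsMultilinear R G)
    (h : ∀ (p' : Chain A.Hom x y) (q' : Chain A.Hom y z), p'.length = p.length →
      q'.length = q.length → G (p'.append (cons (A.one y) q')) = 0) :
    epsSum R (p.append (cons (A.one y, 0) q)) G = 0 := by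
  induction p with
  | nil =>
    simp only [append, epsSum, hG.zero_first, zero_add]
    rw [epsSum_eq_zero, smul_zero]
    exact fun q' _ hq' => h (nil _) q' rfl hq'
  | cons f p ih =>
    simp only [append, epsSum]
    rw [ih q (hG.cons f.1), smul_zero, add_zero, fsts, map_append]
    · exact h (cons f.2 (fsts p)) (fsts q) (by simp only [length, fsts, length_map])
        (by rw [fsts, length_map])
    · exact fun p' q' hp' hq' => h (cons f.1 p') q' (by simp only [length, hp']) hq'

/-- The category `A ⊗ R[ε]` with `deg ε = -1` and `m¹ ε = 1`. -/
abbrev SUAInfCat.eps (A : SUAInfCat R) : SUAInfCat R where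
  Ob := A.Ob
  Hom := EpsHom A.Hom
  m := epsOp R A.m
  m_nil := epsOp_nil A.m A.m_nil
  m_deg p k h := by
    refine Prod.ext ?_ ?_
    · change A.m (fsts p) k + sndPart p k = 0
      rw [sndPart_deg p k h, A.m_deg, add_zero]
      rwa [fsts, deg_map, length_map]
    · change -epsSum R p _ = 0
      rw [epsSum_eq_zero, neg_zero]
      intro q hq hq'
      apply A.m_deg
      rw [hq, hq']
      omega
  m_add p j f g q k := by
    refine Prod.ext ?_ ?_
    · have h := (fsts_isMultilinear (A.m_isMultilinear k)).add p f g q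
      change A.m (fsts _) k + sndPart _ k = A.m (fsts _) k + sndPart _ k +
        (A.m (fsts _) k + sndPart _ k)
      rw [h, sndPart_add]
      abel
    · have h := (epsSum_isMultilinear (A.m_isMultilinear (k + 1))).add p f g q
      change -epsSum R _ _ = -epsSum R _ _ + -epsSum R _ _
      rw [h, neg_add]
  m_smul p j r f q k := by
    refine Prod.ext ?_ ?_
    · have h := (fsts_isMultilinear (A.m_isMultilinear k)).smul p r f q
      change A.m (fsts _) k + sndPart _ k = r • (A.m (fsts _) k + sndPart _ k)
      rw [h, sndPart_smul, smul_add]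
    · have h := (epsSum_isMultilinear (A.m_isMultilinear (k + 1))).smul p r f q
      change -epsSum R _ _ = r • -epsSum R _ _
      rw [h, smul_neg]
  ainf := ainfSum_epsOp A.m A.m_nil A.m_isMultilinear A.m_deg A.ainf
  one x := (A.one x, 0)
  one_closed x k := by
    refine Prod.ext ?_ ?_
    · change A.m (single (A.one x)) k + sndPart (single (A.one x, 0)) k = 0
      rw [A.one_closed, zero_add]
      by_cases h : (0 : ℤ) + 1 = k
      · subst h
        exact sndPart_single_eq _ rfl
      · exact sndPart_single_ne _ h
    · change -epsSum R (single (A.one x, 0)) _ = 0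
      simp only [single, epsSum, (A.m_isMultilinear (k + 1)).zero_first, smul_zero, add_zero,
        neg_zero]
  m_one_right {x y k} f := by
    refine Prod.ext ?_ ?_
    · change A.m (cons (A.one x) (single f.1)) k + 0 = f.1
      rw [A.m_one_right, add_zero]
    -- Moving `ε` past the unit, of degree `0`, gives `-1`, which cancels the sign built into
    -- `epsOp`.
    · change -epsSum R (cons (A.one x, 0) (single f)) _ = f.2
      have h := A.m_one_right f.2
      simp only [single] at h
      simp only [single, epsSum, (A.m_isMultilinear (k + 1)).zero_first, smul_zero, add_zero,
        zero_add, fsts, Chain.map, koszulSign_sub_one, koszulSign_zero, neg_smul, one_smul, h,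
        neg_neg]
  m_one_left {x y k} f := by
    refine Prod.ext ?_ ?_
    · change A.m (cons f.1 (single (A.one y))) k + 0 = _
      rw [A.m_one_left, add_zero]
      rfl
    · change -epsSum R (cons f (single (A.one y, 0))) _ = _
      have h := A.m_one_left f.2
      have h0 : A.m (cons f.1 (cons (0 : A.Hom y y (0 + 1)) (nil y))) (k + 1) = 0 :=
        (A.m_isMultilinear (k + 1)).zero (single f.1) (nil y)
      simp only [single] at h
      simp only [single, epsSum, h0, smul_zero, add_zero, fsts, Chain.map, h]
      -- `f.2` has degree `k + 1`, so the unit axiom for it gives `(-1)^(k+1)`; the minus sign in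
      -- `epsOp` turns this into `(-1)^k`.
      have e := koszulSign_add_one (R := R) k
      rw [koszulSign, koszulSign] at e
      rw [e, neg_smul, neg_neg]
      rfl
  m_one {x y z} p q k h := by
    refine Prod.ext ?_ ?_
    · change A.m (fsts _) k + sndPart _ k = 0
      have h1 : sndPart (p.append (cons ((A.one y, 0) : EpsHom A.Hom y y 0) q)) k = 0 := by
        cases q with
        | nil =>
          cases p with
          | nil => simp [length] at h
          | cons e p => cases p <;> rfl
        | cons e q => exact sndPart_append_cons_cons _ _ _ _ _
      rw [h1, add_zero, fsts, map_append]
      exact A.m_one _ _ _ (by rwa [length_map, length_map])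
    · change -epsSum R _ _ = 0
      rw [A.epsSum_one p q (A.m_isMultilinear (k + 1)), neg_zero]
      intro p' q' hp hq
      exact A.m_one _ _ _ (by rwa [hp, hq])

theorem Chain.epsSum_inl {O : Type u} {H : O → O → ℤ → Type u}
    [∀ x y k, AddCommGroup (H x y k)] [∀ x y k, Module R (H x y k)] {M : Type u} [AddCommGroup M]
    [Module R M] {x y : O} (p : Chain H x y) {G : Chain H x y → M} (hG : IsMultilinear R G) :
    epsSum R (p.map (H' := EpsHom H) (fun x => x) (fun f => (f, 0))) G = 0 := by
  induction p with
  | nil => rfl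
  | cons f p ih => simp only [Chain.map, epsSum, hG.zero_first, ih (hG.cons f), smul_zero, add_zero]

/-- The inclusion `a ↦ a ⊗ 1`. -/
def SUAInfCat.epsIncl (A : SUAInfCat R) : SUStrictFunctor A A.eps where
  obj := fun x => x
  map := LinearMap.inl R _ _
  map_m {x y} p k := by
    have hf : fsts (p.map (H' := EpsHom A.Hom) (fun x => x) (fun f => (f, 0))) = p :=
      (Chain.map_map (H'' := A.Hom) (fun x => x) (fun f => ((f, 0) : EpsHom A.Hom _ _ _))
        (fun x => x) (fun f => f.1) p).trans (Chain.map_id p)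
    have hs : sndPart (p.map (H' := EpsHom A.Hom) (fun x => x) (fun f => (f, 0))) k = 0 := by
      cases p with
      | nil => rfl
      | cons f p =>
        cases p with
        | nil =>
          rename_i j
          by_cases h : j + 1 = k
          · subst h
            exact sndPart_single_eq _ rfl
          · exact sndPart_single_ne _ h
        | cons g p => rfl
    refine Prod.ext ?_ ?_
    · refine Eq.trans ?_ (congrArg₂ (· + ·) (congrArg (fun c => A.m c k) hf.symm) hs.symm)
      exact (add_zero _).symm
    · exact (neg_eq_zero.2 (epsSum_inl p (A.m_isMultilinear (k + 1)))).symm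
  map_one _ := rfl

/-- The contraction `v ↦ ε v`. -/
def SUAInfCat.epsContraction (A : SUAInfCat R) {x y : A.Ob} {k : ℤ} (v : A.eps.Hom x y (k + 1)) :
    A.eps.Hom x y k := (0, v.1)

/-- If `v = a + ε a'` is closed, the part of `m¹ v` without `ε` gives `a' = -m¹ a`, and then `m¹ (ε
a) = a - ε m¹ a = v`. -/
theorem SUAInfCat.d_epsContraction (A : SUAInfCat R) {x y : A.Ob} {k : ℤ}
    (v : A.eps.Hom x y (k + 1)) (hv : A.eps.d x y (k + 1) (k + 1 + 1) v = 0) :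
    A.eps.d x y k (k + 1) (A.epsContraction v) = v := by
  have h1 : A.m (single v.1) (k + 1 + 1) + v.2 = 0 := by
    have h := congrArg Prod.fst hv
    change A.m (single v.1) (k + 1 + 1) + sndPart (single v) (k + 1 + 1) = 0 at h
    rwa [sndPart_single_eq v rfl] at h
  refine Prod.ext ?_ ?_
  · change A.m (single 0) (k + 1) + sndPart (single (0, v.1)) (k + 1) = v.1
    rw [sndPart_single_eq _ rfl, single, (A.m_isMultilinear (k + 1)).zero_first, zero_add]
  · change -epsSum R (single (0, v.1)) _ = v.2
    simp only [single, epsSum, smul_zero, add_zero, fsts, Chain.map]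
    exact neg_eq_of_add_eq_zero_right h1

end Contractible

/-! ### Laurent polynomials in a variable of degree one -/

section Laurent

open Chain

variable {R : Type u} [CommRing R]

theorem Chain.length_of_mem_splits {O : Type u} {H : O → O → ℤ → Type u} {x y : O}
    (p : Chain H x y) : ∀ s ∈ p.splits, s.2.1.length + s.2.2.length = p.length := by
  induction p with
  | nil => simp [splits, length]
  | cons f p ih =>
    intro s hs
    simp only [splits, List.mem_cons, List.mem_map] at hs
    rcases hs with rfl | ⟨t, ht, rfl⟩
    · simp [length]
    · simp only [length, ← ih t ht]; ring

/-- The hom-spaces: `R · tᵏ` in degree `k`. -/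
abbrev LaurentHom (R : Type u) (_ _ : PUnit.{u + 1}) (_ : ℤ) : Type u := R

/-- The operations: only `m²` is nonzero. -/
def laurentOp : ∀ {x y : PUnit.{u + 1}}, Chain (LaurentHom R) x y → ∀ k : ℤ, LaurentHom R x y k
  | _, _, cons (k := i) f (cons (k := j) g (nil _)), k =>
      if k = i + j then koszulSign R i * (f * g) else 0
  | _, _, _, _ => 0

theorem laurentOp_pair {x y z : PUnit.{u + 1}} {i j : ℤ} (f : LaurentHom R x y i)
    (g : LaurentHom R y z j) (k : ℤ) :
    laurentOp (cons f (cons g (nil z))) k = if k = i + j then koszulSign R i * (f * g) else 0 := rfl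

theorem laurentOp_of_length_ne {x y : PUnit.{u + 1}} (p : Chain (LaurentHom R) x y) (k : ℤ)
    (h : p.length ≠ 2) : laurentOp p k = 0 := by
  match p with
  | nil _ => rfl
  | cons f (nil _) => rfl
  | cons f (cons g (nil _)) => exact absurd (by simp [length]) h
  | cons f (cons g (cons e p)) => rfl

theorem laurentOp_isMultilinear {x y : PUnit.{u + 1}} (k : ℤ) :
    IsMultilinear R (fun p : Chain (LaurentHom R) x y => laurentOp p k) := by
  constructor
  · intro z w p j f g q
    by_cases h : (p.append (cons f q)).length = 2
    · match p, q with
      | nil _, cons e (nil _) =>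
        simp only [append, laurentOp_pair]
        split_ifs <;> ring
      | cons e (nil _), nil _ =>
        simp only [append, laurentOp_pair]
        split_ifs <;> ring
      | nil _, nil _ => simp [append, length] at h
      | nil _, cons e (cons e' q) =>
        have := q.length_nonneg
        simp only [append, length] at h
        omega
      | cons e (nil _), cons e' q =>
        have := q.length_nonneg
        simp only [append, length] at h
        omega
      | cons e (cons e' p), q =>
        have := q.length_nonneg
        have := p.length_nonneg
        simp only [append, length, length_append] at h
        omega
    · have h' : ∀ e : LaurentHom R z w j, (p.append (cons e q)).length ≠ 2 := by
        intro e
        simpa only [length_append, length] using h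
      simp only [laurentOp_of_length_ne _ _ (h' _), add_zero]
  · intro z w p j r f q
    by_cases h : (p.append (cons f q)).length = 2
    · match p, q with
      | nil _, cons e (nil _) =>
        simp only [append, laurentOp_pair, smul_eq_mul]
        split_ifs <;> ring
      | cons e (nil _), nil _ =>
        simp only [append, laurentOp_pair, smul_eq_mul]
        split_ifs <;> ring
      | nil _, nil _ => simp [append, length] at h
      | nil _, cons e (cons e' q) =>
        have := q.length_nonneg
        simp only [append, length] at h
        omega
      | cons e (nil _), cons e' q =>
        have := q.length_nonneg
        simp only [append, length] at h
        omega
      | cons e (cons e' p), q =>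
        have := q.length_nonneg
        have := p.length_nonneg
        simp only [append, length, length_append] at h
        omega
    · have h' : ∀ e : LaurentHom R z w j, (p.append (cons e q)).length ≠ 2 := by
        intro e
        simpa only [length_append, length] using h
      simp only [laurentOp_of_length_ne _ _ (h' _), smul_zero]

theorem laurentOp_deg {x y : PUnit.{u + 1}} (p : Chain (LaurentHom R) x y) (k : ℤ)
    (h : k ≠ p.deg + 2 - p.length) : laurentOp p k = 0 := by
  match p with
  | nil _ => rfl
  | cons f (nil _) => rfl
  | cons f (cons g (nil _)) =>
    simp only [deg, length] at h
    rw [laurentOp_pair, if_neg]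
    omega
  | cons f (cons g (cons e p)) => rfl

/-- Only `m²` inside `m²` can contribute, so the chain must have three arrows. Then two summands
remain, and they cancel by associativity of the product and the signs in `laurentOp`. -/
theorem ainfSum_laurentOp {x y : PUnit.{u + 1}} (p : Chain (LaurentHom R) x y) (k : ℤ) :
    ainfSum (R := R) laurentOp p k = 0 := by
  by_cases h : p.length = 3
  · match p with
    | nil _ => simp [length] at h
    | cons f (nil _) => simp [length] at h
    | cons f (cons g (nil _)) => simp [length] at h
    | cons (k := i₁) f (cons (k := i₂) g (cons (k := i₃) e (nil _))) =>
      rw [ainfSum_eq_barSum]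
      simp only [barSum_cons, barSum_nil, splitSum_cons, splitSum_nil, laurentOp, add_zero, zero_add,
        smul_zero, deg, length]
      have e₁ : ∀ a b : ℤ, a + b + 2 - (1 + 1) = a + b := fun a b => by ring
      simp only [e₁, if_true, ← add_assoc, koszulSign_sub_one, koszulSign_add, smul_eq_mul]
      split_ifs
      · ring
      · simp
    | cons f (cons g (cons e (cons e' p))) =>
      have := p.length_nonneg
      simp only [length] at h
      omega
  · refine List.sum_eq_zero fun v hv => ?_
    obtain ⟨s, hs, rfl⟩ := List.mem_map.1 hv
    refine List.sum_eq_zero fun v hv => ?_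
    obtain ⟨t, ht, rfl⟩ := List.mem_map.1 hv
    have h1 := length_of_mem_splits _ _ hs
    have h2 := length_of_mem_splits _ _ ht
    change _ • laurentOp (s.2.1.append (cons (laurentOp t.2.1 _) t.2.2)) k = 0
    by_cases hb : t.2.1.length = 2
    · rw [laurentOp_of_length_ne, smul_zero]
      rw [length_append, length]
      omega
    · rw [laurentOp_of_length_ne t.2.1 _ hb, (laurentOp_isMultilinear k).zero, smul_zero]

/-- Laurent polynomials in a variable of degree one, as a category with one object. -/
abbrev laurentCat (R : Type u) [CommRing R] : SUAInfCat R where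
  Ob := PUnit.{u + 1}
  Hom := LaurentHom R
  m := laurentOp
  m_nil _ _ := rfl
  m_deg := laurentOp_deg
  m_add p _ f g q k := (laurentOp_isMultilinear k).add p f g q
  m_smul p _ r f q k := (laurentOp_isMultilinear k).smul p r f q
  ainf := ainfSum_laurentOp
  one _ := (1 : R)
  one_closed _ _ := rfl
  m_one_right f := by
    rw [single, laurentOp_pair, if_pos (by ring), koszulSign_zero, one_mul, one_mul]
  m_one_left f := by
    rw [single, laurentOp_pair, if_pos (by ring), mul_one]
    rfl
  m_one p q k h := laurentOp_of_length_ne _ _ (by rw [length_append, length]; omega)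

end Laurent

/-! ### The A∞-category freely generated relative to a subcategory -/

section RelFree

variable {R : Type u} [CommRing R]

theorem Chain.attach_all {O : Type u} {H : O → O → ℤ → Type u}
    {P : ∀ {x y : O} {k : ℤ}, H x y k → Prop}
    {S : ∀ {x y : O} {k : ℤ} (f : H x y k), P f → Prop} {x y : O} (p : Chain H x y)
    (hp : p.All P) (hS : p.All (fun f => ∀ h : P f, S f h)) :
    (p.attach hp).All (fun f => S f.1 f.2) := by
  induction p with
  | nil => trivial
  | cons f p ih => exact ⟨hS.1 _, ih _ hS.2⟩

-- Induction on the morphisms of a free A∞-category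

section FreeInduction

set_option linter.unusedSectionVars false

variable {Q : DGQuiver R} {P : ∀ {x y : Q.Ob} {k : ℤ}, FreeHom Q x y k → Prop}
  (gen : ∀ {x y : Q.Ob} {k : ℤ} (f : Q.Hom x y k), P (freeGen Q f))
  (zero : ∀ {x y : Q.Ob} {k : ℤ}, P (0 : FreeHom Q x y k))
  (add : ∀ {x y : Q.Ob} {k : ℤ} (f g : FreeHom Q x y k), P f → P g → P (f + g))
  (smul : ∀ {x y : Q.Ob} {k : ℤ} (r : R) (f : FreeHom Q x y k), P f → P (r • f))
  (m : ∀ {x y : Q.Ob} (p : Chain (FreeHom Q) x y) (k : ℤ), p.All P → P (FreeHom.m p k))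

include gen zero add smul m

mutual

theorem FreeTerm.inductMk : ∀ {x y : Q.Ob} {k : ℤ} (t : FreeTerm Q x y k), P (FreeHom.mk t)
  | _, _, _, .gen f => gen f
  | _, _, _, .zero => zero
  | _, _, _, .add s t => add _ _ (FreeTerm.inductMk s) (FreeTerm.inductMk t)
  | _, _, _, .smul r t => smul r _ (FreeTerm.inductMk t)
  | _, _, _, .op p k => FreeHom.m_mk p k ▸ m _ k (FreeTerm.inductMkChain p)

theorem FreeTerm.inductMkChain : ∀ {x y : Q.Ob} (p : Chain (FreeTerm Q) x y),
    (p.map (fun x => x) (fun t => FreeHom.mk t)).All P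
  | _, _, .nil _ => trivial
  | _, _, .cons t p => ⟨FreeTerm.inductMk t, FreeTerm.inductMkChain p⟩

end

/-- Induction on the morphisms of the free A∞-category. -/
theorem FreeHom.induct {x y : Q.Ob} {k : ℤ} (f : FreeHom Q x y k) : P f := by
  induction f using FreeHom.ind with
  | _ t => exact FreeTerm.inductMk gen zero add smul m t

end FreeInduction

/-- The inclusion of generators as a linear map. -/
def freeGenₗ (Q : DGQuiver R) {x y : Q.Ob} {k : ℤ} : Q.Hom x y k →ₗ[R] FreeHom Q x y k where
  toFun f := freeGen Q f
  map_add' f g := FreeHom.sound (.gen_add f g)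
  map_smul' r f := FreeHom.sound (.gen_smul r f)

theorem m_single_freeGen (Q : DGQuiver R) {x y : Q.Ob} {i : ℤ} (f : Q.Hom x y i) (j : ℤ) :
    FreeHom.m (.single (freeGen Q f)) j = freeGen Q (Q.d x y i j f) :=
  (FreeHom.m_mk (.single (.gen f)) j).trans (FreeHom.sound (.gen_d i j f))

-- Ideals, quotients and the relative free category

theorem AInfCat.isIdeal_idealGeneratedBy (C : AInfCat R)
    (S : ∀ {x y : C.Ob} {k : ℤ}, C.Hom x y k → Prop) : C.IsIdeal (C.idealGeneratedBy S) := by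
  intro w x y z j p f q k hf
  simp only [AInfCat.idealGeneratedBy, Submodule.mem_iInf] at hf ⊢
  exact fun I hI hS => hI p f q k (hf I hI hS)

theorem AInfCat.mem_idealGeneratedBy (C : AInfCat R)
    (S : ∀ {x y : C.Ob} {k : ℤ}, C.Hom x y k → Prop) {x y : C.Ob} {k : ℤ} (f : C.Hom x y k)
    (hf : S f) : f ∈ C.idealGeneratedBy S x y k := by
  simp only [AInfCat.idealGeneratedBy, Submodule.mem_iInf]
  exact fun I _ hS => hS f hf

theorem AInfCat.idealGeneratedBy_le (C : AInfCat R)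
    (S : ∀ {x y : C.Ob} {k : ℤ}, C.Hom x y k → Prop)
    (I : ∀ (x y : C.Ob) (k : ℤ), Submodule R (C.Hom x y k)) (hI : C.IsIdeal I)
    (hS : ∀ {x y : C.Ob} {k : ℤ} (f : C.Hom x y k), S f → f ∈ I x y k) (x y : C.Ob) (k : ℤ) :
    C.idealGeneratedBy S x y k ≤ I x y k := by
  intro f hf
  simp only [AInfCat.idealGeneratedBy, Submodule.mem_iInf] at hf
  exact hf I hI hS

/-- The quotient of an A∞-category by an ideal, modulo which it has strict units. -/
abbrev AInfCat.quotientPresentation (C : AInfCat R)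
    (I : ∀ (x y : C.Ob) (k : ℤ), Submodule R (C.Hom x y k)) (hI : C.IsIdeal I)
    (one : ∀ x : C.Ob, C.Hom x x 0) (one_closed : ∀ x k, C.m (.single (one x)) k ∈ I x x k)
    (one_right : ∀ {x y : C.Ob} {k : ℤ} (f : C.Hom x y k),
      C.m (.cons (one x) (.single f)) k - f ∈ I x y k)
    (one_left : ∀ {x y : C.Ob} {k : ℤ} (f : C.Hom x y k),
      C.m (.cons f (.single (one y))) k - ((k.negOnePow : ℤ) : R) • f ∈ I x y k)
    (m_one : ∀ {x y z : C.Ob} (p : Chain C.Hom x y) (q : Chain C.Hom y z) (k : ℤ),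
      2 ≤ p.length + q.length → C.m (p.append (.cons (one y) q)) k ∈ I x z k) :
    AInfPresentation R where
  Ob := C.Ob
  T := C.Hom
  op := C.m
  one := one
  rel {x y k} f g := f - g ∈ I x y k
  refl f := by rw [sub_self]; exact zero_mem _
  symm h := by rw [← neg_sub]; exact neg_mem h
  trans h h' := by rw [← sub_add_sub_cancel]; exact add_mem h h'
  add_congr h h' := by rw [add_sub_add_comm]; exact add_mem h h'
  smul_congr r _ _ h := by rw [← smul_sub]; exact Submodule.smul_mem _ r h
  op_congr p s t q k h := by
    have h1 := C.m_add p (s - t) t q k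
    rw [sub_add_cancel] at h1
    rw [h1, add_sub_cancel_right]
    exact hI p _ q k h
  add_assoc s t v := by rw [add_assoc, sub_self]; exact zero_mem _
  add_comm s t := by rw [add_comm, sub_self]; exact zero_mem _
  zero_add s := by rw [zero_add, sub_self]; exact zero_mem _
  zero_smul s := by rw [zero_smul, sub_self]; exact zero_mem _
  one_smul s := by rw [one_smul, sub_self]; exact zero_mem _
  mul_smul a b s := by rw [mul_smul, sub_self]; exact zero_mem _
  add_smul a b s := by rw [add_smul, sub_self]; exact zero_mem _
  smul_add a s t := by rw [smul_add, sub_self]; exact zero_mem _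
  op_nil x k := by rw [C.m_nil, sub_self]; exact zero_mem _
  op_deg p k h := by rw [C.m_deg p k h, sub_self]; exact zero_mem _
  op_add p s t q k := by rw [C.m_add, sub_self]; exact zero_mem _
  op_smul p r s q k := by rw [C.m_smul, sub_self]; exact zero_mem _
  ainf p k := by rw [C.ainf, sub_self]; exact zero_mem _
  one_closed x k := by rw [sub_zero]; exact one_closed x k
  one_right := one_right
  one_left := one_left
  op_one p q k h := by rw [sub_zero]; exact m_one p q k h

variable {A : SUAInfCat R}

theorem AInfSubcategory.m_mem_of_all (K : AInfSubcategory A) {x y : A.Ob} (p : Chain A.Hom x y)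
    (k : ℤ) (hp : p.All (fun {x y k} f => f ∈ K.carrier x y k)) : A.m p k ∈ K.carrier x y k := by
  have h := K.m_mem (p.attach hp) k
  rwa [show (p.attach hp).map (H' := A.Hom) (fun x => x) (fun f => f.1) = p from
    p.attach_map_val hp] at h

section

variable (K : AInfSubcategory A) (Q : DGSubquiver A.toDGQuiver)
  (hKQ : ∀ x y k, K.carrier x y k ≤ Q.carrier x y k)

/-- The presentation of the strictly unital A∞-category freely generated by `Q` relative to the
subcategory `K`. -/
noncomputable abbrev relFreePresentation : AInfPresentation R :=
  (freeAInfCat Q.toDGQuiver).quotientPresentation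
    ((freeAInfCat Q.toDGQuiver).idealGeneratedBy (RelFreeRelation K Q hKQ))
    ((freeAInfCat Q.toDGQuiver).isIdeal_idealGeneratedBy _)
    (fun x => freeGen Q.toDGQuiver ⟨A.one x, hKQ _ _ _ (K.one_mem x)⟩)
    (fun x k => by
      have h : FreeHom.m (.single (freeGen Q.toDGQuiver
          ⟨A.one x, hKQ _ _ _ (K.one_mem x)⟩)) k = 0 := by
        -- Closedness of units is not among the defining relations. It holds already in the free
        -- category, whose `m¹` restricts to the differential of `Q`.
        rw [m_single_freeGen]
        refine Eq.trans (congrArg _ (Subtype.ext ?_)) (freeGenₗ Q.toDGQuiver).map_zero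
        exact A.one_closed x k
      change FreeHom.m _ k ∈ _
      rw [h]
      exact zero_mem _)
    (fun f => AInfCat.mem_idealGeneratedBy _ _ _ (.one_right f))
    (fun f => AInfCat.mem_idealGeneratedBy _ _ _ (.one_left f))
    (fun p q k h => AInfCat.mem_idealGeneratedBy _ _ _ (.one p q k h))

/-- The strictly unital A∞-category freely generated by `Q` relative to the subcategory `K`. -/
noncomputable abbrev relFreeCat : SUAInfCat R := (relFreePresentation K Q hKQ).toSUAInfCat

/-- The projection of the free A∞-category. -/
noncomputable def relFreeMk : StrictFunctor (freeAInfCat Q.toDGQuiver)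
    (relFreeCat K Q hKQ).toAInfCat where
  obj := fun x => x
  map :=
    { toFun := fun f => AInfPresentation.QHom.mk (P := relFreePresentation K Q hKQ) f
      map_add' := fun _ _ => rfl
      map_smul' := fun _ _ => rfl }
  map_m p k := (AInfPresentation.QHom.m_mk (P := relFreePresentation K Q hKQ) p k).symm

theorem relFreeMk_eq_iff {x y : A.Ob} {k : ℤ} (f g : FreeHom Q.toDGQuiver x y k) :
    (relFreeMk K Q hKQ).map f = (relFreeMk K Q hKQ).map g ↔
      f - g ∈ (freeAInfCat Q.toDGQuiver).idealGeneratedBy (RelFreeRelation K Q hKQ) x y k :=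
  ⟨fun h => AInfPresentation.QHom.exact (P := relFreePresentation K Q hKQ) h,
    fun h => AInfPresentation.QHom.sound (P := relFreePresentation K Q hKQ) h⟩

theorem evaluation_freeGen {x y : A.Ob} {k : ℤ} (f : Q.carrier x y k) :
    (evaluation Q).map (freeGen Q.toDGQuiver (x := x) (y := y) f) = f.1 :=
  FreeTerm.eval_gen Q.incl f

theorem isIdeal_ker_evaluation : (freeAInfCat Q.toDGQuiver).IsIdeal
    (fun x y k => LinearMap.ker ((evaluation Q).map (x := x) (y := y) (k := k))) := by
  intro w x y z j p f q k hf
  rw [LinearMap.mem_ker] at hf ⊢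
  rw [(evaluation Q).map_m, Chain.map_append, Chain.map, hf]
  exact (A.m_isMultilinear k).zero _ _

/-- The kernel is an ideal because evaluation commutes with the operations. It contains the
relations because the operations of `K` are those of `A` and the units of `A` are strict. -/
theorem ideal_le_ker_evaluation (x y : A.Ob) (k : ℤ) :
    (freeAInfCat Q.toDGQuiver).idealGeneratedBy (RelFreeRelation K Q hKQ) x y k ≤
      LinearMap.ker ((evaluation Q).map (x := x) (y := y) (k := k)) := by
  refine AInfCat.idealGeneratedBy_le _ _
    (fun x y k => LinearMap.ker ((evaluation Q).map (x := x) (y := y) (k := k)))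
    (isIdeal_ker_evaluation Q) ?_ x y k
  intro x y k f hf
  rw [LinearMap.mem_ker]
  cases hf with
  | m p =>
    rw [map_sub, (evaluation Q).map_m, evaluation_freeGen]
    refine sub_eq_zero.2 (congrArg (fun c => A.m c k) ?_)
    refine (Chain.map_map (H'' := A.Hom) _ _ (evaluation Q).obj
      (fun f => (evaluation Q).map f) p).trans ?_
    exact Chain.map_congr _ _ _ (Chain.All.of_forall (fun f => evaluation_freeGen Q _) p)
  | one_right t =>
    rw [map_sub, (evaluation Q).map_m, Chain.single, Chain.map, Chain.map, evaluation_freeGen]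
    exact sub_eq_zero.2 (A.m_one_right _)
  | one_left t =>
    rw [map_sub, (evaluation Q).map_m, Chain.single, Chain.map, Chain.map, Chain.map,
      evaluation_freeGen, map_smul]
    exact sub_eq_zero.2 (A.m_one_left _)
  | one p q k h =>
    rw [(evaluation Q).map_m, Chain.map_append, Chain.map, evaluation_freeGen]
    exact A.m_one _ _ _ (by rwa [Chain.length_map, Chain.length_map])

end

end RelFree

/-! ### The filtration of the resolution -/

-- Linear independence modulo a submodule

section Independent

variable {R : Type u} [CommRing R] {M : Type u} [AddCommGroup M] [Module R M] {ι : Type u}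
  (N : Submodule R M) (v : ι → M)
  (hv : ∀ l : ι →₀ R, Finsupp.linearCombination R v l ∈ N → l = 0)

include hv

theorem disjoint_span_of_independent_mod : Disjoint N (Submodule.span R (Set.range v)) := by
  rw [Submodule.disjoint_def]
  intro a ha ha'
  obtain ⟨l, rfl⟩ := (Finsupp.mem_span_range_iff_exists_finsupp).1 ha'
  rw [← Finsupp.linearCombination_apply] at ha ⊢
  rw [hv l ha, map_zero]

/-- The classes of the `v i` are a basis of the quotient: independence is `hv`, and they generate
because every element of the sum is congruent to a combination of them. -/
theorem free_quotient_of_independent_mod :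
    Module.Free R (↥(N ⊔ Submodule.span R (Set.range v)) ⧸
      N.submoduleOf (N ⊔ Submodule.span R (Set.range v))) := by
  have hmem : ∀ l, Finsupp.linearCombination R v l ∈ N ⊔ Submodule.span R (Set.range v) := by
    intro l
    refine Submodule.mem_sup_right ?_
    rw [← Finsupp.range_linearCombination]
    exact LinearMap.mem_range_self _ l
  let φ : (ι →₀ R) →ₗ[R] (↥(N ⊔ Submodule.span R (Set.range v)) ⧸
      N.submoduleOf (N ⊔ Submodule.span R (Set.range v))) :=
    (Submodule.mkQ _).comp ((Finsupp.linearCombination R v).codRestrict _ hmem)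
  refine Module.Free.of_equiv (LinearEquiv.ofBijective φ ⟨?_, ?_⟩)
  · rw [← LinearMap.ker_eq_bot, LinearMap.ker_eq_bot']
    intro l hl
    have h := (Submodule.Quotient.mk_eq_zero (N.submoduleOf _)).1 hl
    exact hv l h
  · intro a
    obtain ⟨⟨a, ha⟩, rfl⟩ := Submodule.Quotient.mk_surjective _ a
    obtain ⟨b, hb, c, hc, rfl⟩ := Submodule.mem_sup.1 ha
    rw [← Finsupp.range_linearCombination] at hc
    obtain ⟨l, rfl⟩ := hc
    refine ⟨l, (Submodule.Quotient.eq _).2 ?_⟩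
    change Finsupp.linearCombination R v l - (b + Finsupp.linearCombination R v l) ∈ N
    rw [sub_add_cancel_right]
    exact neg_mem hb

end Independent

section Filtration

variable {R : Type u} [CommRing R] {A : SUAInfCat R}

open sfObj

/-- The subcategory of morphisms given by expressions of level at most `n`. -/
def sfSub (A : SUAInfCat R) (n : ℕ) : AInfSubcategory (sfObj A) where
  carrier x y k :=
    { carrier := {f | ∃ (t : Raw A x y k) (ht : t.Valid), t.level ≤ n ∧ cls t ht = f}
      add_mem' := by
        rintro _ _ ⟨s, hs, hs', rfl⟩ ⟨t, ht, ht', rfl⟩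
        exact ⟨s + t, Raw.valid_add_iff.2 ⟨hs, ht⟩, by rw [Raw.level_add]; exact max_le hs' ht',
          rfl⟩
      zero_mem' := ⟨0, Raw.valid_zero, by rw [Raw.level_zero]; exact Nat.zero_le n, rfl⟩
      smul_mem' := by
        rintro r _ ⟨t, ht, ht', rfl⟩
        exact ⟨r • t, Raw.valid_smul_iff.2 ht, by rwa [Raw.level_smul], rfl⟩ }
  m_mem {x y} p k := by
    have h : ∀ {x y : A.Ob} {k : ℤ} (f : {f : (sfObj A).Hom x y k //
        ∃ (t : Raw A x y k) (ht : t.Valid), t.level ≤ n ∧ cls t ht = f}),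
        ∃ t : VRaw A x y k, t.1.level ≤ n ∧ cls t.1 t.2 = f.1 := by
      rintro x y k ⟨_, t, ht, ht', rfl⟩
      exact ⟨⟨t, ht⟩, ht', rfl⟩
    choose σ hσ hσ' using @h
    refine ⟨_, (VRaw.op (p.map (fun x => x) (fun f => σ f)) k).2, ?_, ?_⟩
    · refine Raw.level_op_le_iff.2 ?_
      refine Chain.All.map (P := fun t : VRaw A _ _ _ => t.1.level ≤ n) _ _ (fun t ht => ht) ?_
      exact (Chain.All.of_forall (P := fun _ => True) (fun _ => trivial) p).map _ _
        (fun f _ => hσ f)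
    · refine (m_cls _ k).symm.trans (congrArg (fun c => (sfObj A).m c k) ?_)
      refine (Chain.map_map (H'' := (sfObj A).Hom) (fun x => x) (fun f => σ f) (fun x => x)
        (fun t => cls t.1 t.2) p).trans ?_
      exact Chain.map_congr _ _ _ (Chain.All.of_forall (fun f => hσ' f) p)
  one_mem x := ⟨Raw.one (A := A) x, Raw.valid_one (A := A) x,
    (Raw.level_one (A := A) x).trans_le (Nat.zero_le n), rfl⟩

theorem mem_sfSub_iff {n : ℕ} {x y : A.Ob} {k : ℤ} {f : (sfObj A).Hom x y k} :
    f ∈ (sfSub A n).carrier x y k ↔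
      ∃ (t : Raw A x y k) (ht : t.Valid), t.level ≤ n ∧ cls t ht = f := Iff.rfl

theorem cls_mem_sfSub {n : ℕ} {x y : A.Ob} {k : ℤ} (t : Raw A x y k) (ht : t.Valid)
    (h : t.level ≤ n) : cls t ht ∈ (sfSub A n).carrier x y k :=
  mem_sfSub_iff.2 ⟨t, ht, h, rfl⟩

/-- The index set of the generators of level `n + 1`. -/
def GenIndex (A : SUAInfCat R) (n : ℕ) (x y : A.Ob) (k : ℤ) : Type u :=
  {g : Raw A x y (k + 1) × A.Hom x y k // (Raw.gen g.1 g.2).Valid ∧ g.1.level = n}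

/-- The generators of level `n + 1`. -/
def genVec (A : SUAInfCat R) (n : ℕ) (x y : A.Ob) (k : ℤ) (g : GenIndex A n x y k) :
    (sfObj A).Hom x y k := cls (.gen g.1.1 g.1.2) g.2.1

theorem d_mem_sfSub {n : ℕ} {x y : A.Ob} (i j : ℤ) (f : (sfObj A).Hom x y i)
    (hf : f ∈ (sfSub A n).carrier x y i) : (sfObj A).d x y i j f ∈ (sfSub A n).carrier x y j :=
  (sfSub A n).m_mem_of_all (.single f) j ⟨hf, trivial⟩

/-- The boundary of `gen c f` is `c`, of level `n`. This makes the span of level `n` and the new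
generators a DG subquiver and the differential of the quotient zero. -/
theorem d_mem_sfSub_of_mem_sup {n : ℕ} {x y : A.Ob} (i j : ℤ) (f : (sfObj A).Hom x y i)
    (hf : f ∈ (sfSub A n).carrier x y i ⊔ Submodule.span R (Set.range (genVec A n x y i))) :
    (sfObj A).d x y i j f ∈ (sfSub A n).carrier x y j := by
  by_cases hij : i + 1 = j
  · subst hij
    suffices h : (sfSub A n).carrier x y i ⊔ Submodule.span R (Set.range (genVec A n x y i)) ≤
        ((sfSub A n).carrier x y (i + 1)).comap ((sfObj A).d x y i (i + 1)) from h hf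
    refine sup_le (fun f hf => d_mem_sfSub _ _ f hf) (Submodule.span_le.2 ?_)
    rintro _ ⟨g, rfl⟩
    change (sfObj A).d x y i (i + 1) (cls _ _) ∈ (sfSub A n).carrier x y (i + 1)
    rw [d_cls_gen]
    exact cls_mem_sfSub _ _ g.2.2.le
  · rw [(sfObj A).shape x y i j hij]
    exact zero_mem _

/-- The DG subquiver spanned by `sfSub A n` and the generators of level `n + 1`. -/
noncomputable def sfQuiv (A : SUAInfCat R) (n : ℕ) : DGSubquiver (sfObj A).toDGQuiver where
  carrier x y k := (sfSub A n).carrier x y k ⊔ Submodule.span R (Set.range (genVec A n x y k))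
  d_mem i j f hf := Submodule.mem_sup_left (d_mem_sfSub_of_mem_sup i j f hf)

theorem sfSub_le_sfQuiv (A : SUAInfCat R) (n : ℕ) (x y : A.Ob) (k : ℤ) :
    (sfSub A n).carrier x y k ≤ (sfQuiv A n).carrier x y k := le_sup_left

theorem cls_gen_mem_sfQuiv {n : ℕ} {x y : A.Ob} {k : ℤ} (c : Raw A x y (k + 1)) (f : A.Hom x y k)
    (h : (Raw.gen c f).Valid) (hn : c.level ≤ n) :
    cls (.gen c f) h ∈ (sfQuiv A n).carrier x y k := by
  rcases hn.lt_or_eq with hn | hn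
  · exact sfSub_le_sfQuiv _ _ _ _ _ (cls_mem_sfSub _ _ (by rw [Raw.level_gen]; exact hn))
  · exact Submodule.mem_sup_right (Submodule.subset_span ⟨⟨(c, f), h, hn⟩, rfl⟩)

theorem sfQuiv_le_sfSub (n : ℕ) (x y : A.Ob) (k : ℤ) :
    (sfQuiv A n).carrier x y k ≤ (sfSub A (n + 1)).carrier x y k := by
  refine sup_le ?_ (Submodule.span_le.2 ?_)
  · intro f hf
    obtain ⟨t, ht, h, rfl⟩ := mem_sfSub_iff.1 hf
    exact cls_mem_sfSub t ht (h.trans n.le_succ)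
  · rintro _ ⟨g, rfl⟩
    refine cls_mem_sfSub _ _ ?_
    rw [Raw.level_gen, g.2.2]

/-! Linear independence of the generators -/

section Weight

variable (w : ∀ {x y : A.Ob} {k : ℤ}, Raw A x y (k + 1) → A.Hom x y k → R)

/-- Values of the generators in a contractible category, with prescribed closed parts. -/
def weightValue {x y : A.Ob} {k : ℤ} (c : Raw A x y (k + 1)) (f : A.Hom x y k)
    (v : (laurentCat R).eps.Hom ⟨⟩ ⟨⟩ (k + 1)) : (laurentCat R).eps.Hom ⟨⟩ ⟨⟩ k :=
  (laurentCat R).epsContraction v + (laurentCat R).epsIncl.map (x := ⟨⟩) (y := ⟨⟩) (k := k) (w c f)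

/-- The contraction already has boundary `v`. The added weight is closed, since Laurent polynomials
have zero differential and their inclusion is a functor. -/
theorem d_weightValue {x y : A.Ob} {k : ℤ} (c : Raw A x y (k + 1)) (f : A.Hom x y k)
    (v : (laurentCat R).eps.Hom ⟨⟩ ⟨⟩ (k + 1))
    (hv : (laurentCat R).eps.d _ _ (k + 1) (k + 1 + 1) v = 0) :
    (laurentCat R).eps.d _ _ k (k + 1) (weightValue w c f v) = v := by
  rw [weightValue, map_add, SUAInfCat.d_epsContraction _ _ hv, add_eq_left]
  refine ((laurentCat R).epsIncl.map_m (x := ⟨⟩) (y := ⟨⟩)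
    (Chain.single (H := LaurentHom R) (x := ⟨⟩) (y := ⟨⟩) (k := k) (w c f)) (k + 1)).symm.trans ?_
  exact (laurentCat R).epsIncl.map.map_zero

/-- The functor on the resolution with these values. -/
def weightFunctor : SUStrictFunctor (sfObj A) (laurentCat R).eps :=
  lift (fun _ => ⟨⟩) (weightValue w) (fun c f hc _ => d_weightValue w c f _ hc)

theorem weightFunctor_cls {x y : A.Ob} {k : ℤ} (t : Raw A x y k) (ht : t.Valid) :
    (weightFunctor w).map (cls t ht) =
      Raw.eval (C := (laurentCat R).eps) (fun _ => ⟨⟩) (weightValue w) t := rfl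

/-- Every generator `gen c f` inside an expression of level `≤ n` has `c.level < n`, so no other
weights enter. -/
theorem eval_weightValue_congr (w' : ∀ {x y : A.Ob} {k : ℤ}, Raw A x y (k + 1) → A.Hom x y k → R)
    (n : ℕ) (hw : ∀ {x y : A.Ob} {k : ℤ} (c : Raw A x y (k + 1)) (f : A.Hom x y k),
      c.level < n → w c f = w' c f) {x y : A.Ob} {k : ℤ} (t : Raw A x y k) : t.level ≤ n →
    Raw.eval (C := (laurentCat R).eps) (fun _ => ⟨⟩) (weightValue w) t =
      Raw.eval (C := (laurentCat R).eps) (fun _ => ⟨⟩) (weightValue w') t := by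
  induction t using Raw.induct with
  | one x => intro _; rw [Raw.eval_one, Raw.eval_one]
  | gen c f hc =>
    intro h
    rw [Raw.level_gen] at h
    rw [Raw.eval_gen, Raw.eval_gen, hc (by omega), weightValue, weightValue, hw c f (by omega)]
  | zero => intro _; rw [Raw.eval_zero, Raw.eval_zero]
  | add s t hs ht =>
    intro h
    rw [Raw.level_add, max_le_iff] at h
    rw [Raw.eval_add, Raw.eval_add, hs h.1, ht h.2]
  | smul r t ht =>
    intro h
    rw [Raw.level_smul] at h
    rw [Raw.eval_smul, Raw.eval_smul, ht h]
  | op p k hp =>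
    intro h
    rw [Raw.level_op_le_iff] at h
    rw [Raw.eval_op, Raw.eval_op]
    refine congrArg (fun c => (laurentCat R).eps.m c k) (Chain.map_congr _ _ _ ?_)
    exact (hp.and h).imp fun t h => h.1 h.2

end Weight

/-- With any weights, here zero, the unit goes to the unit of `R[t, t⁻¹] ⊗ R[ε]`, whose part without
`ε` is `1 ∈ R`. -/
theorem sfObj_one_free (x : A.Ob) (r : R) (h : r • (sfObj A).one x = 0) : r = 0 := by
  have h1 := congrArg (weightFunctor (A := A) (fun _ _ => 0)).map h
  rw [map_smul, (weightFunctor (A := A) (fun _ _ => 0)).map_one, map_zero] at h1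
  have h2 := congrArg Prod.fst h1
  simpa using h2

-- Changing the value of a single generator `g₀` of level `n + 1` by a closed element gives another
-- functor, with the same values on level `≤ n`; the difference of the two detects the coefficient
-- of `g₀`. The generators are indexed by pairs of expressions and morphisms themselves, so
-- generators with congruent boundaries are also independent.
open Classical in
theorem genVec_independent (n : ℕ) (x y : A.Ob) (k : ℤ) (l : GenIndex A n x y k →₀ R)
    (hl : Finsupp.linearCombination R (genVec A n x y k) l ∈ (sfSub A n).carrier x y k) :
    l = 0 := by
  ext g₀
  -- The indicator function of `g₀` among the generators between all objects and in all degrees.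
  let w : ∀ {x y : A.Ob} {k : ℤ}, Raw A x y (k + 1) → A.Hom x y k → R :=
    fun {x' y' k'} c f =>
      if (⟨x', y', k', c, f⟩ : Σ (x y : A.Ob) (k : ℤ), Raw A x y (k + 1) × A.Hom x y k) =
        ⟨x, y, k, g₀.1⟩ then 1 else 0
  have hw : ∀ {x' y' : A.Ob} {k' : ℤ} (c : Raw A x' y' (k' + 1)) (f : A.Hom x' y' k'),
      c.level < n → w c f = 0 := by
    intro x' y' k' c f hc
    refine if_neg fun h => ?_
    have h1 := congrArg (fun s : Σ (x y : A.Ob) (k : ℤ), Raw A x y (k + 1) × A.Hom x y k =>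
      s.2.2.2.1.level) h
    change c.level = g₀.1.1.level at h1
    rw [g₀.2.2] at h1
    omega
  have hwg : ∀ g : GenIndex A n x y k, w g.1.1 g.1.2 = if g = g₀ then 1 else 0 := by
    intro g
    refine if_congr ?_ rfl rfl
    constructor
    · intro h
      simp only [Sigma.mk.injEq, heq_eq_eq, true_and] at h
      exact Subtype.ext h
    · rintro rfl
      rfl
  let δ : (sfObj A).Hom x y k →ₗ[R] (laurentCat R).eps.Hom ⟨⟩ ⟨⟩ k :=
    (weightFunctor w).map - (weightFunctor (A := A) (fun _ _ => 0)).map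
  have hδ : ∀ f ∈ (sfSub A n).carrier x y k, δ f = 0 := by
    intro f hf
    obtain ⟨t, ht, h, rfl⟩ := mem_sfSub_iff.1 hf
    rw [LinearMap.sub_apply, weightFunctor_cls, weightFunctor_cls,
      eval_weightValue_congr w (fun _ _ => 0) n hw t h, sub_self]
  -- The boundary of `g` has level `n`, so both functors give it the same value. The contractions
  -- cancel, and only the weight of `g` is left.
  have hδg : ∀ g : GenIndex A n x y k, δ (genVec A n x y k g) =
      (laurentCat R).epsIncl.map (x := ⟨⟩) (y := ⟨⟩) (k := k) (if g = g₀ then 1 else 0 : R) := by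
    intro g
    rw [LinearMap.sub_apply, genVec, weightFunctor_cls, weightFunctor_cls, Raw.eval_gen,
      Raw.eval_gen, eval_weightValue_congr w (fun _ _ => 0) n hw g.1.1 g.2.2.le, weightValue,
      weightValue, hwg, map_zero, add_zero, add_sub_cancel_left]
  have h1 := hδ _ hl
  rw [Finsupp.linearCombination_apply, Finsupp.sum, map_sum] at h1
  simp only [map_smul, hδg] at h1
  have h2 := congrArg Prod.fst h1
  rw [Prod.fst_sum] at h2
  change ∑ g ∈ l.support, l g * (if g = g₀ then 1 else 0 : R) = 0 at h2
  simpa using h2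

end Filtration

-- Generators and relations of each stage of the filtration

section SemiFree

variable {R : Type u} [CommRing R] {A : SUAInfCat R}

open sfObj

theorem Chain.IsMultilinear.mem_of_all_span {O : Type u} {H : O → O → ℤ → Type u}
    [∀ x y k, AddCommGroup (H x y k)] [∀ x y k, Module R (H x y k)] {M : Type u} [AddCommGroup M]
    [Module R M] {S : ∀ {x y : O} {k : ℤ}, H x y k → Prop} {x y : O} {G : Chain H x y → M}
    (hG : IsMultilinear R G) (N : Submodule R M) (h : ∀ p : Chain H x y, p.All S → G p ∈ N)
    (p : Chain H x y) (hp : p.All (fun f => f ∈ Submodule.span R {f | S f})) : G p ∈ N := by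
  induction p with
  | nil x => exact h _ trivial
  | cons f p ih =>
    obtain ⟨hf, hp⟩ := hp
    induction hf using Submodule.span_induction with
    | mem f hf => exact ih (hG.cons f) (fun q hq => h (Chain.cons f q) ⟨hf, hq⟩) hp
    | zero => rw [hG.zero_first]; exact zero_mem _
    | add f g _ _ hf hg => rw [hG.add_first]; exact add_mem hf hg
    | smul r f _ hf => rw [hG.smul_first]; exact Submodule.smul_mem _ r hf

/-- Such a chain repeats one unit: `m¹` kills it, `m²` of two copies is the unit again, and the
higher operations vanish. -/
theorem SUAInfCat.m_mem_span_units (B : SUAInfCat R) {x y : B.Ob} (p : Chain B.Hom x y) (k : ℤ)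
    (hp : p.All (fun f => B.IsUnitMorphism f)) :
    B.m p k ∈ Submodule.span R {f | B.IsUnitMorphism f} := by
  cases p with
  | nil => rw [B.m_nil]; exact zero_mem _
  | cons f p =>
    obtain ⟨hf, hp⟩ := hp
    cases hf with | one =>
    cases p with
    | nil =>
      have h := B.one_closed x k
      rw [Chain.single] at h
      rw [h]; exact zero_mem _
    | cons g p =>
      obtain ⟨hg, hp⟩ := hp
      cases hg with | one =>
      cases p with
      | nil =>
        by_cases hk : k = 0
        · subst hk
          have h := B.m_one_right (B.one x)
          rw [Chain.single] at h
          rw [h]; exact Submodule.subset_span (.one x)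
        · rw [B.m_deg]
          · exact zero_mem _
          · simpa [Chain.deg, Chain.length] using hk
      | cons e p =>
        have h := B.m_one (.nil x) (.cons (B.one x) (.cons e p)) k (by
          have := p.length_nonneg
          simp only [Chain.length]
          omega)
        rw [Chain.append] at h
        rw [h]; exact zero_mem _

theorem AInfSubcategory.span_units_le {B : SUAInfCat R} (K : AInfSubcategory B) (x y : B.Ob)
    (k : ℤ) : Submodule.span R {f | B.IsUnitMorphism f} ≤ K.carrier x y k := by
  refine Submodule.span_le.2 fun f hf => ?_
  cases hf with
  | one => exact K.one_mem x

theorem sfObj.m_cls_attach {x y : A.Ob} (p : Chain (Raw A) x y)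
    (hp : p.All (fun t => t.Valid)) (k : ℤ) :
    cls (.op p k) (Raw.valid_op_iff.2 hp) =
      (sfObj A).m ((p.attach hp).map (fun x => x) (fun t => cls t.1 t.2)) k := by
  refine Eq.trans ?_ (m_cls (p.attach hp) k).symm
  exact (cls_eq_iff (Raw.valid_op_iff.2 hp) (VRaw.op (p.attach hp) k).2).2
    (.of_eq (congrArg (fun c => Raw.op c k) (p.attach_map_val hp).symm))

theorem m_mem_range_evaluation (Q : DGSubquiver (sfObj A).toDGQuiver) {x y : A.Ob}
    (p : Chain (sfObj A).Hom x y) (k : ℤ)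
    (hp : p.All (fun {x y k} f =>
      f ∈ LinearMap.range ((evaluation Q).map (x := x) (y := y) (k := k)))) :
    (sfObj A).m p k ∈ LinearMap.range ((evaluation Q).map (x := x) (y := y) (k := k)) := by
  have h : ∀ {x y : A.Ob} {k : ℤ} (f : {f : (sfObj A).Hom x y k //
      f ∈ LinearMap.range ((evaluation Q).map (x := x) (y := y) (k := k))}),
      ∃ g : FreeHom Q.toDGQuiver x y k, (evaluation Q).map g = f.1 := fun f => f.2
  choose σ hσ using @h
  refine ⟨FreeHom.m ((p.attach hp).map (fun x => x) (fun f => σ f)) k, ?_⟩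
  refine ((evaluation Q).map_m _ k).trans (congrArg (fun c => (sfObj A).m c k) ?_)
  refine (Chain.map_map (H'' := (sfObj A).Hom) (fun x => x) (fun f => σ f) (evaluation Q).obj
    (fun f => (evaluation Q).map f) (p.attach hp)).trans ?_
  refine Eq.trans ?_ (p.attach_map_val hp)
  exact Chain.map_congr _ _ _ (Chain.All.of_forall (fun f => hσ f) _)

/-- A generator of level at most `n + 1` lies in the `n`-th quiver, hence in the range, and the
range is closed under linear combinations and operations. -/
theorem cls_mem_range_evaluation (n : ℕ) {x y : A.Ob} {k : ℤ} (t : Raw A x y k) :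
    ∀ ht : t.Valid, t.level ≤ n + 1 →
      cls t ht ∈ LinearMap.range ((evaluation (sfQuiv A n)).map (x := x) (y := y) (k := k)) := by
  have gen_mem : ∀ {x y : A.Ob} {k : ℤ} (f : (sfObj A).Hom x y k),
      f ∈ (sfQuiv A n).carrier x y k →
      f ∈ LinearMap.range ((evaluation (sfQuiv A n)).map (x := x) (y := y) (k := k)) :=
    fun f hf => ⟨freeGen _ ⟨f, hf⟩, evaluation_freeGen (sfQuiv A n) ⟨f, hf⟩⟩
  induction t using Raw.induct with
  | one x => exact fun _ _ => gen_mem _ (sfSub_le_sfQuiv A _ _ _ _ ((sfSub A n).one_mem x))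
  | gen c f _ =>
    intro ht h
    rw [Raw.level_gen] at h
    exact gen_mem _ (cls_gen_mem_sfQuiv c f ht (by omega))
  | zero => exact fun _ _ => zero_mem _
  | add s t hs ht =>
    intro h h'
    rw [Raw.level_add, max_le_iff] at h'
    exact add_mem (hs (Raw.valid_add_iff.1 h).1 h'.1) (ht (Raw.valid_add_iff.1 h).2 h'.2)
  | smul r t ht =>
    intro h h'
    rw [Raw.level_smul] at h'
    exact Submodule.smul_mem _ r (ht (Raw.valid_smul_iff.1 h) h')
  | op p k hp =>
    intro h h'
    rw [m_cls_attach p (Raw.valid_op_iff.1 h)]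
    refine m_mem_range_evaluation _ _ k ?_
    refine Chain.All.map (P := fun {x y k} (t : VRaw A x y k) => cls t.1 t.2 ∈
      LinearMap.range ((evaluation (sfQuiv A n)).map (x := x) (y := y) (k := k))) (fun x => x)
      (fun t => cls t.1 t.2) (fun t ht => ht) (p.attach_all
        (S := fun {x y k} t ht => cls t ht ∈
          LinearMap.range ((evaluation (sfQuiv A n)).map (x := x) (y := y) (k := k)))
        (Raw.valid_op_iff.1 h) ?_)
    exact (hp.and (Raw.level_op_le_iff.1 h')).imp fun t ht hv => ht.1 hv ht.2

theorem range_evaluation_sfQuiv (n : ℕ) (x y : A.Ob) (k : ℤ) :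
    LinearMap.range ((evaluation (sfQuiv A n)).map (x := x) (y := y) (k := k)) =
      (sfSub A (n + 1)).carrier x y k := by
  refine le_antisymm ?_ ?_
  · rintro _ ⟨f, rfl⟩
    refine FreeHom.induct (Q := (sfQuiv A n).toDGQuiver)
      (P := fun {x y k} f => (evaluation (sfQuiv A n)).map f ∈ (sfSub A (n + 1)).carrier x y k)
      (fun f => ?_) (zero_mem _) (fun f g hf hg => ?_) (fun r f hf => ?_) (fun p k hp => ?_) f
    · have h := evaluation_freeGen (sfQuiv A n) f
      exact h ▸ sfQuiv_le_sfSub _ _ _ _ f.2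
    · rw [map_add]; exact add_mem hf hg
    · rw [map_smul]; exact Submodule.smul_mem _ r hf
    · have h := (evaluation (sfQuiv A n)).map_m p k
      refine h ▸ (sfSub A (n + 1)).m_mem_of_all _ k ?_
      exact hp.map (H' := (sfObj A).Hom) _ (fun f => (evaluation (sfQuiv A n)).map f)
        (fun f hf => hf)
  · intro f hf
    obtain ⟨t, ht, h, rfl⟩ := mem_sfSub_iff.1 hf
    exact cls_mem_range_evaluation n t ht h

/-! The kernel of the evaluation -/

/-- The category freely generated by `sfQuiv A n` relative to `sfSub A n`. -/
noncomputable abbrev sfStep (A : SUAInfCat R) (n : ℕ) : SUAInfCat R :=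
  relFreeCat (sfSub A n) (sfQuiv A n) (sfSub_le_sfQuiv A n)

/-- The canonical map of `sfQuiv A n` to a contractible extension of `sfStep A n`. -/
noncomputable def sfStepGen (A : SUAInfCat R) (n : ℕ) {x y : A.Ob} {k : ℤ} :
    (sfQuiv A n).carrier x y k →ₗ[R] (sfStep A n).eps.Hom x y k :=
  (sfStep A n).epsIncl.map ∘ₗ
    (relFreeMk (sfSub A n) (sfQuiv A n) (sfSub_le_sfQuiv A n)).map ∘ₗ
    freeGenₗ (sfQuiv A n).toDGQuiver

theorem d_sfStepGen (n : ℕ) {x y : A.Ob} {k : ℤ} (f : (sfQuiv A n).carrier x y k) (j : ℤ) :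
    (sfStep A n).eps.d x y k j (sfStepGen A n f) =
      sfStepGen A n ((sfQuiv A n).toDGQuiver.d x y k j f) := by
  refine ((sfStep A n).epsIncl.map_m (.single
    ((relFreeMk (sfSub A n) (sfQuiv A n) (sfSub_le_sfQuiv A n)).map
      (freeGen (sfQuiv A n).toDGQuiver f))) j).symm.trans (congrArg (sfStep A n).epsIncl.map ?_)
  refine ((relFreeMk (sfSub A n) (sfQuiv A n) (sfSub_le_sfQuiv A n)).map_m
    (.single (freeGen (sfQuiv A n).toDGQuiver f)) j).symm.trans (congrArg _ ?_)
  exact m_single_freeGen (sfQuiv A n).toDGQuiver f j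

/-- The first kind of defining relation, read in the quotient: on the subcategory of level `≤ n`,
the canonical map to the quotient respects operations. -/
theorem m_sfStepGen (n : ℕ) {x y : A.Ob}
    (p : Chain (fun x y k => (sfSub A n).carrier x y k) x y) (k : ℤ) :
    (sfStep A n).eps.m (p.map (fun x => x)
        (fun f => sfStepGen A n ⟨f.1, sfSub_le_sfQuiv A n _ _ _ f.2⟩)) k =
      sfStepGen A n ⟨_, sfSub_le_sfQuiv A n _ _ _ ((sfSub A n).m_mem p k)⟩ := by
  have h1 := (relFreeMk_eq_iff (sfSub A n) (sfQuiv A n) (sfSub_le_sfQuiv A n) _ _).2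
    (AInfCat.mem_idealGeneratedBy _ _ _ (RelFreeRelation.m p k))
  refine Eq.trans ?_ (congrArg ((sfStep A n).epsIncl.map) h1)
  rw [StrictFunctor.map_m]
  refine Eq.trans ?_ ((sfStep A n).epsIncl.map_m _ k).symm
  refine congrArg (fun c => (sfStep A n).eps.m c k) ?_
  refine Eq.symm ((congrArg _ (Chain.map_map (H'' := (sfStep A n).Hom) _ _ _ _ p)).trans ?_)
  exact Chain.map_map (H'' := (sfStep A n).eps.Hom) _ _ _ _ p

open Classical in
/-- Values of the generators in a contractible extension of `sfStep A n`. -/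
noncomputable def sfStepValue (A : SUAInfCat R) (n : ℕ) {x y : A.Ob} {k : ℤ}
    (c : Raw A x y (k + 1)) (f : A.Hom x y k) (v : (sfStep A n).eps.Hom x y (k + 1)) :
    (sfStep A n).eps.Hom x y k :=
  if h : (Raw.gen c f).Valid ∧ c.level ≤ n then
    sfStepGen A n ⟨cls (.gen c f) h.1, cls_gen_mem_sfQuiv c f h.1 h.2⟩
  -- For the remaining generators, invalid or of level above `n + 1`, any element with boundary `v`
  -- would do.
  else (sfStep A n).epsContraction v

/-- Generators have the prescribed value by definition, and operations on level `≤ n` are respected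
by `m_sfStepGen`. This identifies the value of the boundary of each generator in the `n`-th quiver.
-/
theorem eval_sfStepValue (n : ℕ) {x y : A.Ob} {k : ℤ} (t : Raw A x y k) :
    ∀ (ht : t.Valid) (h : t.level ≤ n),
      Raw.eval (A := A) (C := (sfStep A n).eps) (fun x => x) (sfStepValue A n) t =
        sfStepGen A n ⟨cls t ht, sfSub_le_sfQuiv A n _ _ _ (cls_mem_sfSub t ht h)⟩ := by
  induction t using Raw.induct with
  | one x => intro _ _; rw [Raw.eval_one]; rfl
  | gen c f _ =>
    intro ht h
    rw [Raw.level_gen] at h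
    rw [Raw.eval_gen, sfStepValue, dif_pos ⟨ht, by omega⟩]
  | zero =>
    intro _ _
    rw [Raw.eval_zero]
    exact (sfStepGen A n).map_zero.symm
  | add s t hs ht =>
    intro h h'
    rw [Raw.level_add, max_le_iff] at h'
    rw [Raw.eval_add, hs (Raw.valid_add_iff.1 h).1 h'.1, ht (Raw.valid_add_iff.1 h).2 h'.2]
    exact ((sfStepGen A n).map_add ⟨cls s _, _⟩ ⟨cls t _, _⟩).symm
  | smul r t ht =>
    intro h h'
    rw [Raw.level_smul] at h'
    rw [Raw.eval_smul, ht (Raw.valid_smul_iff.1 h) h']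
    exact ((sfStepGen A n).map_smul r ⟨cls t _, _⟩).symm
  | @op x y p k hp =>
    intro h h'
    have hv := Raw.valid_op_iff.1 h
    have hl := Raw.level_op_le_iff.1 h'
    -- The arguments are bundled with their validity and level bounds, so that the chain can be read
    -- both in the subcategory of level `≤ n` and as a chain of valid expressions.
    let q := p.attach (hv.and hl)
    have hq : q.map (fun x => x) (fun t => t.1) = p := p.attach_map_val (hv.and hl)
    let p' : Chain (fun x y k => (sfSub A n).carrier x y k) x y :=
      q.map (H' := fun x y k => (sfSub A n).carrier x y k) (fun x => x)
        (fun t => ⟨cls t.1 t.2.1, cls_mem_sfSub t.1 t.2.1 t.2.2⟩)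
    rw [Raw.eval_op]
    refine Eq.trans (congrArg (fun c => (sfStep A n).eps.m c k) ?_)
      ((m_sfStepGen n p' k).trans (congrArg (sfStepGen A n) (Subtype.ext ?_)))
    · refine (congrArg (Chain.map (H' := (sfStep A n).eps.Hom) (fun x => x) _) hq.symm).trans ?_
      refine (Chain.map_map (H'' := (sfStep A n).eps.Hom) _ _ _ _ q).trans ?_
      refine Eq.trans ?_ (Chain.map_map (H' := fun x y k => (sfSub A n).carrier x y k)
        (H'' := (sfStep A n).eps.Hom) (fun x => x)
        (fun t => ⟨cls t.1 t.2.1, cls_mem_sfSub t.1 t.2.1 t.2.2⟩) (fun x => x)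
        (fun f => sfStepGen A n ⟨f.1, sfSub_le_sfQuiv A n _ _ _ f.2⟩) q).symm
      exact Chain.map_congr _ _ _ (p.attach_all
        (S := fun {x y k} t (ht : t.Valid ∧ t.level ≤ n) =>
          Raw.eval (A := A) (C := (sfStep A n).eps) (fun x => x) (sfStepValue A n) t =
            sfStepGen A n ⟨cls t ht.1, sfSub_le_sfQuiv A n _ _ _ (cls_mem_sfSub t ht.1 ht.2)⟩)
        (hv.and hl) (hp.imp fun t ht h => ht h.1 h.2))
    · refine (congrArg (fun c => (sfObj A).m c k) ?_).trans
        ((m_cls (q.map (H' := VRaw A) (fun x => x) (fun t => ⟨t.1, t.2.1⟩)) k).trans ?_)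
      · refine (Chain.map_map (H'' := (sfObj A).Hom) _ _ _ _ q).trans ?_
        exact (Chain.map_map (H' := VRaw A) (H'' := (sfObj A).Hom) (fun x => x)
          (fun t => ⟨t.1, t.2.1⟩) (fun x => x) (fun t => cls t.1 t.2) q).symm
      · refine (cls_eq_iff (VRaw.op _ k).2 h).2 (.of_eq (congrArg (fun c => Raw.op c k) ?_))
        exact (Chain.map_map (H'' := Raw A) _ _ _ _ q).trans hq

/-- In the first case the canonical map of the quiver commutes with differentials and sends `c`, of
level `≤ n`, to its value. In the second case the contraction does it, as the value of `c` is
closed. -/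
theorem d_sfStepValue (n : ℕ) {x y : A.Ob} {k : ℤ} (c : Raw A x y (k + 1)) (f : A.Hom x y k)
    (hc : (sfStep A n).eps.d _ _ (k + 1) (k + 1 + 1)
      (Raw.eval (A := A) (C := (sfStep A n).eps) (fun x => x) (sfStepValue A n) c) = 0) :
    (sfStep A n).eps.d _ _ k (k + 1) (sfStepValue A n c f
      (Raw.eval (A := A) (C := (sfStep A n).eps) (fun x => x) (sfStepValue A n) c)) =
        Raw.eval (A := A) (C := (sfStep A n).eps) (fun x => x) (sfStepValue A n) c := by
  rw [sfStepValue]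
  split_ifs with h
  · rw [d_sfStepGen, eval_sfStepValue n c (Raw.valid_gen_iff.1 h.1).1 h.2]
    exact congrArg _ (Subtype.ext (d_cls_gen c f h.1))
  · exact SUAInfCat.d_epsContraction _ _ hc

/-- The functor on the resolution with these values. -/
noncomputable def sfStepFunctor (A : SUAInfCat R) (n : ℕ) :
    SUStrictFunctor (sfObj A) (sfStep A n).eps :=
  lift (fun x => x) (sfStepValue A n) (fun c f hc _ => d_sfStepValue n c f hc)

theorem sfStepFunctor_map (n : ℕ) {x y : A.Ob} {k : ℤ} (f : (sfQuiv A n).carrier x y k) :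
    (sfStepFunctor A n).map f.1 = sfStepGen A n f := by
  -- The membership proof inside the subtype is separated from the one to be decomposed, so that `f`
  -- can be split and induction on the span applied.
  suffices h : ∀ f ∈ (sfQuiv A n).carrier x y k, ∀ hf : f ∈ (sfQuiv A n).carrier x y k,
      (sfStepFunctor A n).map f = sfStepGen A n ⟨f, hf⟩ from h f.1 f.2 f.2
  intro f hf hf'
  obtain ⟨a, ha, b, hb, rfl⟩ := Submodule.mem_sup.1 hf
  have hb' : b ∈ (sfQuiv A n).carrier x y k := Submodule.mem_sup_right hb
  have h1 : (sfStepFunctor A n).map a = sfStepGen A n ⟨a, sfSub_le_sfQuiv A n _ _ _ ha⟩ := by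
    obtain ⟨t, ht, h, rfl⟩ := mem_sfSub_iff.1 ha
    exact eval_sfStepValue n t ht h
  have h2 : ∀ hb' : b ∈ (sfQuiv A n).carrier x y k,
      (sfStepFunctor A n).map b = sfStepGen A n ⟨b, hb'⟩ := by
    clear hb' hf hf'
    induction hb using Submodule.span_induction with
    | mem b hb =>
      intro hb'
      obtain ⟨g, rfl⟩ := hb
      refine (Raw.eval_gen (A := A) (C := (sfStep A n).eps) (fun x => x) (sfStepValue A n) g.1.1
        g.1.2).trans ?_
      exact dif_pos ⟨g.2.1, g.2.2.le⟩
    | zero => 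
      intro hb'
      rw [map_zero]
      exact (sfStepGen A n).map_zero.symm
    | add a b ha hb iha ihb =>
      intro _
      rw [map_add, iha (Submodule.mem_sup_right ha), ihb (Submodule.mem_sup_right hb)]
      exact ((sfStepGen A n).map_add ⟨a, _⟩ ⟨b, _⟩).symm
    | smul r a ha iha =>
      intro _
      rw [map_smul, iha (Submodule.mem_sup_right ha)]
      exact ((sfStepGen A n).map_smul r ⟨a, _⟩).symm
  rw [map_add, h1, h2 hb']
  exact ((sfStepGen A n).map_add ⟨a, _⟩ ⟨b, _⟩).symm

/-- Both sides are composites of strict functors on a free category, so it suffices to compare them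
on generators, where `sfStepFunctor_map` applies. -/
theorem sfStepFunctor_evaluation (n : ℕ) {x y : A.Ob} {k : ℤ}
    (f : FreeHom (sfQuiv A n).toDGQuiver x y k) :
    (sfStepFunctor A n).map ((evaluation (sfQuiv A n)).map f) =
      (sfStep A n).epsIncl.map
        ((relFreeMk (sfSub A n) (sfQuiv A n) (sfSub_le_sfQuiv A n)).map f) := by
  refine FreeHom.induct (Q := (sfQuiv A n).toDGQuiver)
    (P := fun {x y k} f => (sfStepFunctor A n).map ((evaluation (sfQuiv A n)).map f) =
      (sfStep A n).epsIncl.map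
        ((relFreeMk (sfSub A n) (sfQuiv A n) (sfSub_le_sfQuiv A n)).map f))
    (fun f => ?_) ?_ (fun f g hf hg => ?_) (fun r f hf => ?_) (fun p k hp => ?_) f
  · refine (congrArg _ (evaluation_freeGen (sfQuiv A n) f)).trans ?_
    exact sfStepFunctor_map n f
  · intro x y k
    simp only [map_zero]
    rfl
  · simp only [map_add, hf, hg]
    rfl
  · simp only [map_smul, hf]
    rfl
  · refine (congrArg _ ((evaluation (sfQuiv A n)).map_m p k)).trans ?_
    refine ((sfStepFunctor A n).map_m _ k).trans ?_
    refine Eq.trans ?_ (congrArg _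
      ((relFreeMk (sfSub A n) (sfQuiv A n) (sfSub_le_sfQuiv A n)).map_m p k)).symm
    refine Eq.trans ?_ ((sfStep A n).epsIncl.map_m _ k).symm
    refine congrArg (fun c => (sfStep A n).eps.m c k) ?_
    refine (Chain.map_map (H'' := (sfStep A n).eps.Hom) _ _ _ _ p).trans ?_
    refine Eq.trans ?_ (Chain.map_map (H'' := (sfStep A n).eps.Hom) _ _ _ _ p).symm
    exact Chain.map_congr _ _ _ hp

/-- If `f` evaluates to zero, then by `sfStepFunctor_evaluation` its class in the quotient becomes
zero in the contractible extension. The inclusion `a ↦ a + ε 0` is injective, so the class is zero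
and `f` lies in the ideal. -/
theorem ker_evaluation_sfQuiv (n : ℕ) (x y : A.Ob) (k : ℤ) :
    LinearMap.ker ((evaluation (sfQuiv A n)).map (x := x) (y := y) (k := k)) =
      (freeAInfCat (sfQuiv A n).toDGQuiver).idealGeneratedBy
        (RelFreeRelation (sfSub A n) (sfQuiv A n) (sfSub_le_sfQuiv A n)) x y k := by
  refine le_antisymm ?_ (ideal_le_ker_evaluation (sfSub A n) (sfQuiv A n) (sfSub_le_sfQuiv A n) x y k)
  intro f hf
  have h := sfStepFunctor_evaluation n f
  rw [LinearMap.mem_ker] at hf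
  rw [hf, map_zero] at h
  have h1 := congrArg Prod.fst h
  have h2 := (relFreeMk_eq_iff (sfSub A n) (sfQuiv A n) (sfSub_le_sfQuiv A n) f 0).1
    (h1.symm.trans (map_zero _).symm)
  rwa [sub_zero] at h2

/-- An expression of level `0` contains no generators, and the span of the units is closed under the
operations, by multilinearity and `SUAInfCat.m_mem_span_units`. -/
theorem sfSub_zero_eq_span (x y : A.Ob) (k : ℤ) : (sfSub A 0).carrier x y k =
    Submodule.span R {f | (sfObj A).IsUnitMorphism f} := by
  refine le_antisymm ?_ ((sfSub A 0).span_units_le x y k)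
  · intro f hf
    obtain ⟨t, ht, h, rfl⟩ := mem_sfSub_iff.1 hf
    clear hf
    revert ht h
    induction t using Raw.induct with
  | one x => exact fun _ _ => Submodule.subset_span (SUAInfCat.IsUnitMorphism.one (A := sfObj A) x)
  | gen c f _ =>
    intro _ h
    rw [Raw.level_gen] at h
    omega
  | zero => exact fun _ _ => zero_mem _
  | add s t hs ht =>
    intro h h'
    rw [Raw.level_add, max_le_iff] at h'
    exact add_mem (hs (Raw.valid_add_iff.1 h).1 h'.1) (ht (Raw.valid_add_iff.1 h).2 h'.2)
  | smul r t ht =>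
    intro h h'
    rw [Raw.level_smul] at h'
    exact Submodule.smul_mem _ r (ht (Raw.valid_smul_iff.1 h) h')
  | op p k hp =>
    intro h h'
    rw [m_cls_attach p (Raw.valid_op_iff.1 h)]
    refine ((sfObj A).m_isMultilinear k).mem_of_all_span
      (S := fun f => (sfObj A).IsUnitMorphism f) _
      (fun p hp => (sfObj A).m_mem_span_units p k hp) _ ?_
    refine Chain.All.map (P := fun {x y k} (t : VRaw A x y k) => cls t.1 t.2 ∈
      Submodule.span R {f | (sfObj A).IsUnitMorphism f}) (fun x => x)
      (fun t => cls t.1 t.2) (fun t ht => ht) (p.attach_all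
        (S := fun {x y k} t ht => cls t ht ∈ Submodule.span R {f | (sfObj A).IsUnitMorphism f})
        (Raw.valid_op_iff.1 h) ?_)
    exact (hp.and (Raw.level_op_le_iff.1 h')).imp fun t ht hv => ht.1 hv ht.2

/-- The resolution is semi-free. -/
theorem sfObj_isSemiFree (A : SUAInfCat R) : (sfObj A).IsSemiFree :=
  ⟨{  sub := sfSub A
      quiv := sfQuiv A
      sub_le_quiv := sfSub_le_sfQuiv A
      quiv_le_sub := sfQuiv_le_sfSub
      exhaust := fun f => by
        obtain ⟨t, ht, rfl⟩ := exists_cls f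
        exact ⟨t.level, cls_mem_sfSub t ht le_rfl⟩
      sub_zero := sfSub_zero_eq_span (A := A)
      one_free := sfObj_one_free (A := A)
      complement := fun n x y k => ⟨Submodule.span R (Set.range (genVec A n x y k)),
        disjoint_span_of_independent_mod _ _ (genVec_independent (A := A) n x y k), rfl⟩
      quotient_free := fun n x y k =>
        free_quotient_of_independent_mod _ _ (genVec_independent (A := A) n x y k)
      quotient_d := fun n _ _ i j f hf => d_mem_sfSub_of_mem_sup i j f hf
      range_evaluation := range_evaluation_sfQuiv (A := A)
      ker_evaluation := ker_evaluation_sfQuiv (A := A) }⟩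

end SemiFree

/-! ### The projection is a quasi-equivalence -/

/-- A morphism of short complexes of modules is a quasi-isomorphism if it is injective on
homology and every cycle of the target lifts to a cycle. -/
theorem quasiIso_of_lifts {R : Type u} [CommRing R] {S T : ShortComplex (ModuleCat.{u} R)}
    (φ : S ⟶ T) (inj : ∀ s : S.X₂, S.g s = 0 → (∃ t, T.f t = φ.τ₂ s) → ∃ w, S.f w = s)
    (surj : ∀ t : T.X₂, T.g t = 0 → ∃ s, S.g s = 0 ∧ φ.τ₂ s = t) :
    ShortComplex.QuasiIso φ := by
  let γ : ShortComplex.LeftHomologyMapData φ S.moduleCatLeftHomologyData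
    T.moduleCatLeftHomologyData := default
  have hi (z : LinearMap.ker S.g.hom) : (γ.φK z : LinearMap.ker T.g.hom).1 = φ.τ₂ z.1 :=
    congrArg (fun f => f.hom z) γ.commi
  have hπ (z : LinearMap.ker S.g.hom) :
      γ.φH ((LinearMap.range S.moduleCatToCycles).mkQ z) =
        (LinearMap.range T.moduleCatToCycles).mkQ (γ.φK z) :=
    (congrArg (fun f => f.hom z) γ.commπ).symm
  rw [γ.quasiIso_iff, ConcreteCategory.isIso_iff_bijective]
  constructor
  · refine (injective_iff_map_eq_zero γ.φH.hom).2 fun a ha => ?_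
    obtain ⟨z, rfl⟩ := Submodule.mkQ_surjective _ a
    obtain ⟨t, ht⟩ := (Submodule.Quotient.mk_eq_zero _).1 ((hπ z).symm.trans ha)
    obtain ⟨w, hw⟩ := inj z.1 z.2 ⟨t, (congrArg Subtype.val ht).trans (hi z)⟩
    exact (Submodule.Quotient.mk_eq_zero _).2 ⟨w, Subtype.ext hw⟩
  · intro b
    obtain ⟨z, rfl⟩ := Submodule.mkQ_surjective _ b
    obtain ⟨s, hs, hz⟩ := surj z.1 z.2
    exact ⟨_, (hπ ⟨s, hs⟩).trans (congrArg _ (Subtype.ext ((hi ⟨s, hs⟩).trans hz)))⟩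

namespace sfObj

variable {R : Type u} [CommRing R] {A : SUAInfCat.{u} R}

theorem rel_op_single_zero {x y : A.Ob} {k j : ℤ} :
    Raw.Rel (.op (.single (0 : Raw A x y k)) j) 0 :=
  (cls_eq_iff ((Raw.valid_op_iff (p := .single (0 : Raw A x y k))).2 ⟨Raw.valid_zero, trivial⟩)
    Raw.valid_zero).1
    ((d_cls (0 : Raw A x y k) Raw.valid_zero j).symm.trans ((sfObj A).d x y k j).map_zero)

theorem valid_gen_zero {x y : A.Ob} {k : ℤ} {f : A.Hom x y k} (hf : A.d x y k (k + 1) f = 0) :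
    (Raw.gen 0 f).Valid :=
  Raw.valid_gen_iff.2 ⟨Raw.valid_zero, rel_op_single_zero, (Raw.eval_zero _ _).trans hf.symm⟩

/-- Every morphism is the value of a generator. -/
theorem valid_gen_gen {x y : A.Ob} {k : ℤ} (f : A.Hom x y k) :
    (Raw.gen (Raw.gen 0 (A.d x y k (k + 1) f)) f).Valid := by
  -- As `m¹ f` is closed, `gen 0 (m¹ f)` is a valid closed expression with value `m¹ f`; so it may
  -- serve as the boundary of a generator over `f`.
  have h := valid_gen_zero (A.d_d x y _ (k + 1) _ f)
  have h' := Raw.valid_gen_iff.1 h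
  exact Raw.valid_gen_iff.2 ⟨h, .gen_d _ _ h'.2.1 h'.2.2, Raw.eval_gen _ _ _ _⟩

theorem proj_surjective : SUStrictFunctor.IsSurjectiveOnMorphisms (proj A) :=
  fun _ _ _ f => ⟨cls _ (valid_gen_gen f), (proj_cls _ _).trans (Raw.eval_gen _ _ _ _)⟩

/-- A cycle `c` with value `m¹ f` is the boundary of the generator `gen c f`, and a cycle `f` lifts
to the cycle `gen 0 f`. -/
theorem proj_quasiIso (x y : A.Ob) : QuasiIso ((proj A).homComplexMap x y) := by
  refine ⟨fun n => ?_⟩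
  -- The boundary of a generator of degree `k` has degree `k + 1` by its type, so the cycles
  -- considered are put in that form.
  obtain ⟨k, rfl⟩ : ∃ k, n = k + 1 := ⟨n - 1, (sub_add_cancel n 1).symm⟩
  rw [quasiIsoAt_iff' _ k (k + 1) (k + 1 + 1) (by simp) (by simp)]
  refine quasiIso_of_lifts _ (fun c hc h => ?_) (fun f hf => ?_)
  · obtain ⟨f, hf⟩ := h
    obtain ⟨c, hv, rfl⟩ := exists_cls c
    have hg : (Raw.gen c f).Valid := Raw.valid_gen_iff.2
      ⟨hv, (cls_eq_iff _ Raw.valid_zero).1 ((d_cls c hv _).symm.trans hc), hf.symm⟩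
    exact ⟨cls _ hg, d_cls_gen c f hg⟩
  · exact ⟨cls _ (valid_gen_zero hf), d_cls_gen _ _ (valid_gen_zero hf), Raw.eval_gen _ _ _ _⟩

/-- The projection is the identity on objects, so the units serve as the isomorphisms in `H⁰`. -/
theorem proj_isQuasiEquivalence : SUStrictFunctor.IsQuasiEquivalence (proj A) := by
  have h (y : A.Ob) : A.m (.cons (A.one y) (.single (A.one y))) 0 - A.one y ∈
      LinearMap.range (A.d y y (-1) 0) := by
    rw [A.m_one_right, sub_self]
    exact Submodule.zero_mem _
  exact ⟨proj_quasiIso (A := A), fun y => ⟨y, A.one y, A.one y, A.one_closed y 1,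
    A.one_closed y 1, h y, h y⟩⟩

end sfObj

/-- Every strictly unital A∞-category has a semi-free resolution, functorially with respect to
strict strictly unital A∞-functors. -/
theorem mainTheorem2 (R : Type u) [CommRing R] :
    ∃ (sf : SUAInfCat.{u} R ⥤ SUAInfCat.{u} R) (Ψ : sf ⟶ 𝟭 (SUAInfCat.{u} R)),
      ∀ A : SUAInfCat.{u} R,
        (sf.obj A).IsSemiFree ∧
        SUStrictFunctor.IsQuasiEquivalence (Ψ.app A) ∧
        SUStrictFunctor.IsSurjectiveOnMorphisms (Ψ.app A) :=
  ⟨sfFunctor R, sfProj R, fun A =>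
    ⟨sfObj_isSemiFree A, sfObj.proj_isQuasiEquivalence, sfObj.proj_surjective⟩⟩
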